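/- Consider on $\mathbb{R}^3$ the Transport-Stokes system $$-\Delta u+\nabla p=-\rho\,e_3,\qquad \operatorname{div}u=0,\qquad \partial_t\rho+\operatorname{div}(\rho u)=0,\qquad \rho(0,\cdot)=\rho_0,\qquad \lim_{|x|\to\infty}u(t,x)=0 .$$ A (global weak) solution with initial datum $\rho_0\in L^1\cap L^\infty(\mathbb{R}^3)$ is a density $\rho\in L^\infty_{loc}([0,\infty);L^1\cap L^\infty(\mathbb{R}^3))$ for which there are a velocity $u\in L^1_{loc}([0,\infty)\times\mathbb{R}^3;\mathbb{R}^3)$ and a pressure $p$ such that: for almost every $t>0$, $u(t,\cdot)$ and $p(t,\cdot)$ are locally integrable, solve the two Stokes equations with density $\rho(t,\cdot)$ in the sense of distributions on $\mathbb{R}^3$, and $u(t,x)\to0$ (essentially) as $|x|\to\infty$; and $$\int_0^\infty\!\!\int_{\mathbb{R}^3}\rho\,(\partial_t\varphi+u\cdot\nabla\varphi)\,dx\,dt+\int_{\mathbb{R}^3}\rho_0\,\varphi(0,\cdot)\,dx=0\qquad\text{for all }\varphi\in C_c^\infty(\mathbb{R}\times\mathbb{R}^3).$$ Let $R>0$ and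 $\rho_{R,0}=\frac{1}{|B(0,R)|}\mathbf 1_{B(0,R)}$. Then the Transport-Stokes system with initial datum $\rho_{R,0}$ has exactly one solution (up to equality for almost every $(t,x)\in(0,\infty)\times\mathbb{R}^3$), and it is $$\rho_R(t,x)=\frac1{R^3}\,\rho_{1,0}\!\left(\frac{x}{R}-\frac{t}{|B(0,1)|\,R^2}\,c\right),\qquad c=-\frac{4}{15}\,e_3 .$$ -/

import Mathlib

open MeasureTheory Filter Topology Set
open scoped ContDiff ENNReal NNReal

/-- Physical space `ℝ³` with its Euclidean structure. -/
abbrev Space3 : Type := EuclideanSpace ℝ (Fin 3)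

/-- The third vector `e₃` of the canonical basis of `ℝ³`. -/
noncomputable def e₃ : Space3 := EuclideanSpace.single 2 1

/-- The divergence `∑ᵢ ∂ᵢ ψᵢ` of a vector field on `ℝ³`. -/
noncomputable def divergence (ψ : Space3 → Space3) (x : Space3) : ℝ :=
  ∑ i : Fin 3, (fderiv ℝ ψ x (EuclideanSpace.single i 1)) i

/-- `(u, p)` solves the steady Stokes problem `-Δu + ∇p = -ρ e₃`, `div u = 0` on `ℝ³` in the sense
of distributions, and `u(x) → 0` as `|x| → ∞`. Since `u` is only defined up to null sets, the limit
is an essential limit. -/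
structure IsStokesSolution (ρ : Space3 → ℝ) (u : Space3 → Space3) (p : Space3 → ℝ) : Prop where
  locallyIntegrable_velocity : LocallyIntegrable u volume
  locallyIntegrable_pressure : LocallyIntegrable p volume
  momentum : ∀ ψ : Space3 → Space3, ContDiff ℝ ∞ ψ → HasCompactSupport ψ →
    -(∫ x, inner ℝ (u x) (Laplacian.laplacian ψ x)) - ∫ x, p x * divergence ψ x
      = -∫ x, ρ x * inner ℝ e₃ (ψ x)
  incompressible : ∀ φ : Space3 → ℝ, ContDiff ℝ ∞ φ → HasCompactSupport φ →
    ∫ x, inner ℝ (u x) (gradient φ x) = 0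
  tendsto_zero : Tendsto u (cocompact Space3 ⊓ ae volume) (𝓝 0)

/-- The region `(0, ∞) × ℝ³` of space-time. -/
def positiveTimes : Set (ℝ × Space3) := Ioi 0 ×ˢ univ

/-- `(ρ, u, p)` is a global weak solution of the Transport-Stokes system with initial datum `ρ₀`,
with density in `L^∞_loc([0, ∞); L¹ ∩ L^∞)`:
* at almost every time `t > 0`, `(u t, p t)` solves the Stokes problem with density `ρ t`;
* `∂ₜρ + div (ρ u) = 0` with `ρ(0) = ρ₀`, in the sense of distributions on `[0, ∞) × ℝ³`.
Only the values at times `t ≥ 0` matter. -/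
structure IsTransportStokesSolution (ρ₀ : Space3 → ℝ) (ρ : ℝ → Space3 → ℝ)
    (u : ℝ → Space3 → Space3) (p : ℝ → Space3 → ℝ) : Prop where
  aestronglyMeasurable_density :
    AEStronglyMeasurable (fun z : ℝ × Space3 => ρ z.1 z.2) (volume.restrict positiveTimes)
  bounded_density : ∀ T : ℝ, 0 < T → ∃ M : ℝ≥0, ∀ᵐ t ∂(volume.restrict (Ioo 0 T)),
    eLpNorm (ρ t) 1 volume ≤ M ∧ eLpNorm (ρ t) ∞ volume ≤ M
  locallyIntegrable_velocity :
    LocallyIntegrableOn (fun z : ℝ × Space3 => u z.1 z.2) (Ici 0 ×ˢ univ) volume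
  stokes : ∀ᵐ t ∂(volume.restrict (Ioi 0)), IsStokesSolution (ρ t) (u t) (p t)
  /- The derivative of `φ` at `(t, x)` in the direction `(1, u)` is `∂ₜφ + u · ∇ₓφ`. -/
  transport : ∀ φ : ℝ × Space3 → ℝ, ContDiff ℝ ∞ φ → HasCompactSupport φ →
    (∫ z in positiveTimes, ρ z.1 z.2 * fderiv ℝ φ z (1, u z.1 z.2))
      + ∫ x, ρ₀ x * φ (0, x) = 0

/-- The normalized indicator `1_{B(0,R)} / |B(0,R)|`. -/
noncomputable def ballDensity (R : ℝ) : Space3 → ℝ :=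
  (Metric.ball (0 : Space3) R).indicator
    (fun _ => (volume.real (Metric.ball (0 : Space3) R))⁻¹)

/-- The translating patch
`ρ_R(t, x) = R⁻³ ρ_{1,0} (x / R - t c / (|B(0,1)| R²))` with `c = -(4/15) e₃`. -/
noncomputable def translatingPatch (R : ℝ) (t : ℝ) (x : Space3) : ℝ :=
  1 / R ^ 3 * ballDensity 1
    ((1 / R) • x - (t / (volume.real (Metric.ball (0 : Space3) 1) * R ^ 2)) •
      (-(4 / 15 : ℝ) • e₃))

/-!
The velocity of a Stokes problem whose density `ρ` is bounded and integrable is the Oseen potential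
`stokesVel ρ` of that density, so that the system is a transport equation with a nonlocal velocity.
That this potential solves the Stokes problem is deduced from an explicit case: the flow generated
by a ball, `dropVel`, is computed from the radial biharmonic potential of the ball
(`dropVel_momentum`), and the Oseen kernel is its limit as the ball shrinks to a point
(`oseen_momentum`). The difference of two velocities for the same density is componentwise
biharmonic and tends to zero at infinity, hence vanishes by the maximum principle
(`ae_eq_zero_of_biharmonic`, `IsStokesSolution.velocity_eq`).

**Existence.** On the ball of radius `R`, the explicit velocity minus the constant `fallVel R` is the
curl of a field vanishing on the boundary. It is therefore divergence free and tangent to the sphere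
(`integral_ballDensity_relVel`), and the ball translates with velocity `fallVel R` without being
deformed (`isTransportStokesSolution_translatingPatch`).

**Uniqueness.** In the frame falling with velocity `fallVel R`, the density `τ` of a solution is
transported by its own flow `stokesVel τ - fallVel R`
(`IsTransportStokesSolution.exists_weakTransport`), which is Lipschitz and divergence free. Smooth
functions of `τ` are then transported as well (`WeakTransport.renormalize`): mollify `τ`, and bound
the commutator by the mean oscillation of `τ`, which tends to zero at Lebesgue points. Consequently
`τ` keeps its mass (`WeakTransport.integral_eq`) and keeps its values in `{0, m}`, where
`m = 1 / |B(0,R)|` (`WeakTransport.range`).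

Measure the distance between `τ` and the ball `d = ballDensity R` by
`E = ∫ |τ - d| | |x|² - R² |`. Since `0 ≤ τ ≤ m`, the difference `σ = τ - d` is nonpositive inside
the ball and nonnegative outside, like `|x|² - R²`; so the absolute values may be dropped, and by
conservation of mass `E` is, up to a constant, the integral of `τ` against a fixed test function.
Its derivative along the transport equation splits into four terms, according to `τ = d + σ` and
`stokesVel τ - fallVel R = U + w`, where `U` is the relative flow of the ball and `w = stokesVel σ`:

* `d` against `U` contributes nothing, because the ball is stationary in this frame;
* `d` against `w` contributes nothing, because `w` is divergence free and so has no flux through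
  spheres (`integral_ballDensity_inner`);
* `σ` against `U` is at most a multiple of `E`, because `U` is Lipschitz and tangent to the sphere
  (`exists_relVel_bound`);
* `σ` against `w` is at most a multiple of the energy `∬ |σ(x)| |σ(y)| / |x - y|`. By symmetry, only
  the points `y` which are closer to the sphere than `x` need to be considered
  (`BddDensity.interaction_le`). They lie in an annulus, whose Newtonian potential is bounded by the
  difference of the squared radii (`integral_annulus_inv_norm_le`), so that this term, too, is at
  most a multiple of `E`.

Grönwall's lemma gives `E = 0`, that is `τ = d` (`WeakTransport.ae_eq_ballDensity`).
-/

/-! ### Partial derivatives and test functions on `ℝ³` -/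

/-- The `i`-th partial derivative of a scalar function on `ℝ³`. -/
noncomputable def pd (i : Fin 3) (f : Space3 → ℝ) (x : Space3) : ℝ :=
  fderiv ℝ f x (EuclideanSpace.single i 1)

/-- The Laplacian of a scalar function, written in coordinates. -/
noncomputable def lap (f : Space3 → ℝ) (x : Space3) : ℝ := ∑ i, pd i (pd i f) x

/-- Smooth compactly supported scalar functions on `ℝ³`. -/
structure IsTest (f : Space3 → ℝ) : Prop where
  smooth : ContDiff ℝ ∞ f
  supp : HasCompactSupport f

theorem fderiv_eq_sum_pd (f : Space3 → ℝ) (x v : Space3) :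
    fderiv ℝ f x v = ∑ i, v i * pd i f x := by
  have hv : v = ∑ i, v i • EuclideanSpace.single i (1 : ℝ) := by
    ext k; simp [Pi.single_apply]
  conv_lhs => rw [hv]
  simp [pd, map_sum]

theorem inner_eq_sum (a b : Space3) : inner ℝ a b = ∑ i, a i * b i := by
  simp [PiLp.inner_apply, mul_comm]

theorem inner_gradient_eq (φ : Space3 → ℝ) (x v : Space3) :
    inner ℝ v (gradient φ x) = fderiv ℝ φ x v := by
  rw [real_inner_comm, gradient, InnerProductSpace.toDual_symm_apply]

theorem two_le_infty : (2 : WithTop ℕ∞) ≤ (∞ : WithTop ℕ∞) :=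
  WithTop.coe_le_coe.2 (le_top : (2 : ℕ∞) ≤ ⊤)

theorem contDiff_pd {f : Space3 → ℝ} (hf : ContDiff ℝ ∞ f) (i : Fin 3) :
    ContDiff ℝ ∞ (pd i f) := by
  unfold pd
  exact (hf.fderiv_right (m := ∞) (by simp)).clm_apply contDiff_const

theorem pd_comm {f : Space3 → ℝ} (hf : ContDiff ℝ ∞ f) (i j : Fin 3) :
    pd i (pd j f) = pd j (pd i f) := by
  have hd : Differentiable ℝ (fderiv ℝ f) :=
    (hf.fderiv_right (m := ∞) (by simp)).differentiable (by simp)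
  have key : ∀ (a b : Space3) (x : Space3),
      fderiv ℝ (fun y => fderiv ℝ f y b) x a = fderiv ℝ (fderiv ℝ f) x a b := by
    intro a b x
    rw [fderiv_clm_apply hd.differentiableAt (by fun_prop)]
    simp
  funext x
  unfold pd
  rw [key, key]
  exact (hf.contDiffAt.isSymmSndFDerivAt (by simpa using two_le_infty)).eq _ _

theorem pd_sub {f g : Space3 → ℝ} (hf : Differentiable ℝ f) (hg : Differentiable ℝ g)
    (i : Fin 3) (x : Space3) : pd i (fun y => f y - g y) x = pd i f x - pd i g x := by
  unfold pd; rw [fderiv_fun_sub hf.differentiableAt hg.differentiableAt]; rfl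

theorem pd_mul {f g : Space3 → ℝ} (hf : Differentiable ℝ f) (hg : Differentiable ℝ g)
    (i : Fin 3) (x : Space3) :
    pd i (fun y => f y * g y) x = f x * pd i g x + pd i f x * g x := by
  unfold pd; rw [fderiv_fun_mul hf.differentiableAt hg.differentiableAt]; simp [mul_comm]

theorem pd_const_mul {f : Space3 → ℝ} (hf : Differentiable ℝ f) (c : ℝ)
    (i : Fin 3) (x : Space3) : pd i (fun y => c * f y) x = c * pd i f x := by
  unfold pd; rw [fderiv_const_mul hf.differentiableAt]; rfl

theorem pd_sum {ι : Type*} (s : Finset ι) {f : ι → Space3 → ℝ}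
    (hf : ∀ k ∈ s, Differentiable ℝ (f k)) (i : Fin 3) (x : Space3) :
    pd i (fun y => ∑ k ∈ s, f k y) x = ∑ k ∈ s, pd i (f k) x := by
  unfold pd; rw [fderiv_fun_sum (fun k hk => (hf k hk).differentiableAt)]; simp

theorem pd_coord (i j : Fin 3) (x : Space3) :
    pd i (fun y : Space3 => y j) x = if i = j then 1 else 0 := by
  have : (fun y : Space3 => y j) = (EuclideanSpace.proj j : Space3 →L[ℝ] ℝ) := rfl
  unfold pd; rw [this, ContinuousLinearMap.fderiv]
  simp [eq_comm]

theorem fderiv_comp_sub_left {F : Type*} [NormedAddCommGroup F] [NormedSpace ℝ F]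
    {f : Space3 → F} (hf : Differentiable ℝ f) (x y : Space3) :
    fderiv ℝ (fun z => f (x - z)) y = -fderiv ℝ f (x - y) := by
  have h := (hf.differentiableAt (x := x - y)).hasFDerivAt.comp y
    ((hasFDerivAt_id y).const_sub x)
  have h2 : HasFDerivAt (fun z => f (x - z)) (-fderiv ℝ f (x - y)) y := by
    convert! h using 1
    ext v; simp
  exact h2.fderiv

theorem pd_comp_sub_left {f : Space3 → ℝ} (hf : Differentiable ℝ f) (i : Fin 3) (x y : Space3) :
    pd i (fun z => f (x - z)) y = -pd i f (x - y) := by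
  unfold pd; rw [fderiv_comp_sub_left hf]; rfl

theorem pd_comp_add_right (f : Space3 → ℝ) (i : Fin 3) (x a : Space3) :
    pd i (fun z => f (z + a)) x = pd i f (x + a) := by
  unfold pd; rw [fderiv_comp_add_right]

theorem lap_comp_add_right (f : Space3 → ℝ) (x a : Space3) :
    lap (fun z => f (z + a)) x = lap f (x + a) := by
  unfold lap
  refine Finset.sum_congr rfl fun i _ => ?_
  have : pd i (fun z => f (z + a)) = fun z => pd i f (z + a) := by
    funext z; exact pd_comp_add_right f i z a
  rw [this, pd_comp_add_right]

namespace IsTest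

variable {f g : Space3 → ℝ}

theorem differentiable (hf : IsTest f) : Differentiable ℝ f := hf.smooth.differentiable (by simp)

theorem continuous (hf : IsTest f) : Continuous f := hf.smooth.continuous

theorem integrable (hf : IsTest f) : Integrable f := hf.continuous.integrable_of_hasCompactSupport hf.supp

theorem pd (hf : IsTest f) (i : Fin 3) : IsTest (pd i f) where
  smooth := contDiff_pd hf.smooth i
  supp := by
    unfold _root_.pd
    exact (hf.supp.fderiv (𝕜 := ℝ)).comp_left (g := fun L : Space3 →L[ℝ] ℝ =>
      L (EuclideanSpace.single i 1)) (by simp)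

theorem add (hf : IsTest f) (hg : IsTest g) : IsTest (fun x => f x + g x) :=
  ⟨hf.smooth.add hg.smooth, hf.supp.add hg.supp⟩

theorem neg (hf : IsTest f) : IsTest (fun x => -f x) :=
  ⟨hf.smooth.neg, hf.supp.neg⟩

theorem sub (hf : IsTest f) (hg : IsTest g) : IsTest (fun x => f x - g x) := by
  simpa [sub_eq_add_neg] using hf.add hg.neg

theorem mul_left {a : Space3 → ℝ} (hf : IsTest f) (ha : ContDiff ℝ ∞ a) :
    IsTest (fun x => a x * f x) :=
  ⟨ha.mul hf.smooth, hf.supp.mul_left⟩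

theorem const_mul (hf : IsTest f) (c : ℝ) : IsTest (fun x => c * f x) :=
  hf.mul_left contDiff_const

theorem zero : IsTest (fun _ => (0 : ℝ)) :=
  ⟨contDiff_const, HasCompactSupport.zero⟩

theorem sum {ι : Type*} (s : Finset ι) {F : ι → Space3 → ℝ} (hF : ∀ k ∈ s, IsTest (F k)) :
    IsTest (fun x => ∑ k ∈ s, F k x) := by
  classical
  induction s using Finset.induction_on with
  | empty => simpa using zero
  | insert a s ha ih =>
    simp only [Finset.sum_insert ha]
    exact (hF a (by simp)).add (ih fun k hk => hF k (by simp [hk]))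

theorem lap (hf : IsTest f) : IsTest (lap f) := by
  unfold _root_.lap
  exact sum _ fun i _ => (hf.pd i).pd i

theorem comp_homeomorph (hf : IsTest f) (e : Space3 ≃ₜ Space3) (he : ContDiff ℝ ∞ e) :
    IsTest (fun x => f (e x)) :=
  ⟨hf.smooth.comp he, hf.supp.comp_homeomorph e⟩

theorem comp_add_right (hf : IsTest f) (a : Space3) : IsTest (fun x => f (x + a)) :=
  hf.comp_homeomorph (Homeomorph.addRight a) (contDiff_id.add contDiff_const)

theorem comp_sub_left (hf : IsTest f) (a : Space3) : IsTest (fun x => f (a - x)) :=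
  hf.comp_homeomorph (Homeomorph.subLeft a) (contDiff_const.sub contDiff_id)

theorem exists_bound (hf : IsTest f) : ∃ C, 0 < C ∧ ∀ x, |f x| ≤ C := by
  obtain ⟨C, hC⟩ := hf.continuous.bounded_above_of_compact_support hf.supp
  exact ⟨max C 1, by positivity, fun x => (hC x).trans (le_max_left _ _)⟩

theorem exists_fderiv_bound (hf : IsTest f) : ∃ C, 0 < C ∧ ∀ x, ‖fderiv ℝ f x‖ ≤ C := by
  obtain ⟨C, hC⟩ := (hf.smooth.continuous_fderiv (by simp)).bounded_above_of_compact_support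
    (hf.supp.fderiv (𝕜 := ℝ))
  exact ⟨max C 1, by positivity, fun x => (hC x).trans (le_max_left _ _)⟩

theorem exists_radius (hf : IsTest f) : ∃ r : ℝ, 0 < r ∧ ∀ x, r ≤ ‖x‖ → f x = 0 := by
  obtain ⟨r, hr⟩ := hf.supp.isCompact.isBounded.subset_ball (0 : Space3)
  refine ⟨max r 1, by positivity, fun x hx => ?_⟩
  by_contra h
  have := hr (subset_tsupport f h)
  rw [mem_ball_zero_iff] at this
  exact absurd this (not_lt.2 ((le_max_left _ _).trans hx))

theorem integrable_mul (hf : IsTest f) {u : Space3 → ℝ} (hu : LocallyIntegrable u volume) :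
    Integrable (fun x => u x * f x) :=  by
  simpa [mul_comm] using hu.integrable_smul_left_of_hasCompactSupport hf.continuous hf.supp

/-- The integral of a derivative of a test function vanishes. -/
theorem integral_fderiv (hf : IsTest f) (v : Space3) : ∫ x, fderiv ℝ f x v = 0 := by
  have hc : Continuous fun x => fderiv ℝ f x v :=
    (hf.smooth.continuous_fderiv (by simp)).clm_apply continuous_const
  have hs : HasCompactSupport fun x => fderiv ℝ f x v :=
    (hf.supp.fderiv (𝕜 := ℝ)).comp_left (g := fun L : Space3 →L[ℝ] ℝ => L v) (by simp)
  have := integral_mul_fderiv_eq_neg_fderiv_mul_of_integrable (μ := (volume : Measure Space3))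
    (f := fun _ => (1 : ℝ)) (g := f) (v := v) (by simp)
    (by simpa using hc.integrable_of_hasCompactSupport hs)
    (by simpa using hf.integrable) (fun x _ => by fun_prop) (fun x _ => hf.differentiable x)
  simpa using this

end IsTest

theorem pd_pd_eq_fderiv_fderiv {f : Space3 → ℝ} (hf : ContDiff ℝ 2 f) (i j : Fin 3) (x : Space3) :
    pd i (pd j f) x = fderiv ℝ (fderiv ℝ f) x (EuclideanSpace.single i 1)
      (EuclideanSpace.single j 1) := by
  have hd : Differentiable ℝ (fderiv ℝ f) :=
    (hf.fderiv_right (m := 1) (by norm_num)).differentiable (by simp)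
  unfold pd
  rw [fderiv_clm_apply hd.differentiableAt (by fun_prop)]
  simp

theorem laplacian_eq_lap {f : Space3 → ℝ} (hf : ContDiff ℝ 2 f) (x : Space3) :
    Laplacian.laplacian f x = lap f x := by
  rw [InnerProductSpace.laplacian_eq_iteratedFDeriv_orthonormalBasis f
    (EuclideanSpace.basisFun (Fin 3) ℝ)]
  unfold lap
  refine Finset.sum_congr rfl fun i _ => ?_
  rw [iteratedFDeriv_two_apply, pd_pd_eq_fderiv_fderiv hf]
  simp

theorem laplacian_apply {ψ : Space3 → Space3} (hψ : ContDiff ℝ 2 ψ) (x : Space3) (k : Fin 3) :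
    (Laplacian.laplacian ψ x) k = lap (fun y => ψ y k) x := by
  have h := (hψ.contDiffAt (x := x)).laplacian_CLM_comp_left
    (l := (EuclideanSpace.proj k : Space3 →L[ℝ] ℝ))
  have h2 : ContDiff ℝ 2 (fun y => ψ y k) :=
    (EuclideanSpace.proj k : Space3 →L[ℝ] ℝ).contDiff.comp hψ
  rw [← laplacian_eq_lap h2]
  exact h.symm

theorem divergence_eq_sum_pd {ψ : Space3 → Space3} (hψ : Differentiable ℝ ψ) (x : Space3) :
    divergence ψ x = ∑ i, pd i (fun y => ψ y i) x := by
  unfold divergence pd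
  refine Finset.sum_congr rfl fun i _ => ?_
  have h := ((EuclideanSpace.proj i : Space3 →L[ℝ] ℝ).hasFDerivAt.comp x
    (hψ x).hasFDerivAt).fderiv
  have h' : fderiv ℝ (fun y => ψ y i) x
    = (EuclideanSpace.proj i : Space3 →L[ℝ] ℝ).comp (fderiv ℝ ψ x) := h
  rw [h']; rfl

/-- A test vector field, assembled from its components. -/
noncomputable def vecField (ψ : Fin 3 → Space3 → ℝ) (x : Space3) : Space3 :=
  WithLp.toLp 2 (fun k => ψ k x)

theorem vecField_smooth {ψ : Fin 3 → Space3 → ℝ} (h : ∀ k, IsTest (ψ k)) :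
    ContDiff ℝ ∞ (vecField ψ) := by
  rw [contDiff_euclidean]
  exact fun k => (h k).smooth

theorem vecField_supp {ψ : Fin 3 → Space3 → ℝ} (h : ∀ k, IsTest (ψ k)) :
    HasCompactSupport (vecField ψ) := by
  choose r hr0 hr using fun k => (h k).exists_radius
  refine HasCompactSupport.of_support_subset_isCompact
    (isCompact_closedBall (0 : Space3) (max (r 0) (max (r 1) (r 2)))) ?_
  intro x hx
  rw [Function.mem_support] at hx
  rw [mem_closedBall_zero_iff]
  by_contra hlt
  push Not at hlt
  apply hx
  simp only [max_lt_iff] at hlt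
  ext k
  fin_cases k
  · exact hr 0 x hlt.1.le
  · exact hr 1 x hlt.2.1.le
  · exact hr 2 x hlt.2.2.le

theorem isTest_component {ψ : Space3 → Space3} (h : ContDiff ℝ ∞ ψ) (hs : HasCompactSupport ψ)
    (k : Fin 3) : IsTest (fun x => ψ x k) :=
  ⟨(EuclideanSpace.proj k : Space3 →L[ℝ] ℝ).contDiff.comp h,
    hs.comp_left (g := fun v : Space3 => v k) rfl⟩

theorem inner_e₃ (v : Space3) : inner ℝ e₃ v = v 2 := by
  simp [e₃, EuclideanSpace.inner_single_left]

/-- The weak Stokes momentum equation, in coordinates. -/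
theorem IsStokesSolution.momentum_coord {ρ : Space3 → ℝ} {u : Space3 → Space3} {p : Space3 → ℝ}
    (h : IsStokesSolution ρ u p) {ψ : Fin 3 → Space3 → ℝ} (hψ : ∀ k, IsTest (ψ k)) :
    -(∫ x, ∑ k, u x k * lap (ψ k) x) - ∫ x, p x * ∑ i, pd i (ψ i) x = -∫ x, ρ x * ψ 2 x := by
  have hs := vecField_smooth hψ
  have := h.momentum (vecField ψ) hs (vecField_supp hψ)
  simp only [inner_eq_sum (u _), laplacian_apply (hs.of_le two_le_infty),
    divergence_eq_sum_pd (hs.differentiable (by simp)), inner_e₃] at this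
  exact this

theorem IsStokesSolution.incompressible_fderiv {ρ : Space3 → ℝ} {u : Space3 → Space3}
    {p : Space3 → ℝ} (h : IsStokesSolution ρ u p) {φ : Space3 → ℝ} (hφ : IsTest φ) :
    ∫ x, fderiv ℝ φ x (u x) = 0 := by
  simpa only [inner_gradient_eq] using h.incompressible φ hφ.smooth hφ.supp

/-! ### Radial functions glued along a sphere -/

/-- The function equal to `a` on `(-∞, S]` and to `b` on `(S, ∞)`. -/
noncomputable def glue (S : ℝ) (a b : ℝ → ℝ) (s : ℝ) : ℝ := if s ≤ S then a s else b s

theorem glue_of_le {S s : ℝ} (a b : ℝ → ℝ) (h : s ≤ S) : glue S a b s = a s := if_pos h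

theorem glue_of_lt {S s : ℝ} (a b : ℝ → ℝ) (h : S < s) : glue S a b s = b s :=
  if_neg (not_le.2 h)

theorem glue_of_ge {S s : ℝ} {a b : ℝ → ℝ} (hab : a S = b S) (h : S ≤ s) :
    glue S a b s = b s := by
  rcases h.eq_or_lt with rfl | h
  · rw [glue_of_le _ _ le_rfl, hab]
  · exact glue_of_lt _ _ h

theorem continuous_glue {S : ℝ} {a b : ℝ → ℝ} (hS : 0 < S) (ha : Continuous a)
    (hb : ContinuousOn b (Ioi 0)) (hab : a S = b S) : Continuous (glue S a b) :=
  continuous_if_le continuous_id continuous_const ha.continuousOn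
    (hb.mono fun s (hs : S ≤ s) => hS.trans_le hs) (fun s hs => by rw [hs, hab])

theorem locallyIntegrable_glue {S : ℝ} {a b : ℝ → ℝ} (hS : 0 < S) (ha : Continuous a)
    (hb : ContinuousOn b (Ioi 0)) :
    LocallyIntegrable (fun x : Space3 => glue S a b (‖x‖ ^ 2)) volume := by
  have hbc : Continuous fun s => b (max s S) :=
    hb.comp_continuous (by fun_prop) fun s => hS.trans_le (le_max_right s S)
  have hc : Continuous fun x : Space3 => |a (‖x‖ ^ 2)| + |b (max (‖x‖ ^ 2) S)| :=
    (ha.comp (by fun_prop)).abs.add (hbc.comp (by fun_prop : Continuous fun x : Space3 => ‖x‖ ^ 2)).abs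
  have hm : Measurable (glue S a fun s => b (max s S)) :=
    Measurable.ite measurableSet_Iic ha.measurable hbc.measurable
  have he : glue S a b = glue S a fun s => b (max s S) := by
    funext s
    rcases le_or_gt s S with h | h
    · rw [glue_of_le _ _ h, glue_of_le _ _ h]
    · rw [glue_of_lt _ _ h, glue_of_lt _ _ h, max_eq_left h.le]
  refine hc.locallyIntegrable.mono ?_ (.of_forall fun x => ?_)
  · rw [he]
    exact (hm.comp (by fun_prop : Measurable fun x : Space3 => ‖x‖ ^ 2)).aestronglyMeasurable
  · refine le_trans ?_ (le_abs_self _)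
    rw [Real.norm_eq_abs]
    rcases le_or_gt (‖x‖ ^ 2) S with h | h
    · rw [glue_of_le _ _ h]; exact le_add_of_nonneg_right (abs_nonneg _)
    · rw [glue_of_lt _ _ h, max_eq_left h.le]; exact le_add_of_nonneg_left (abs_nonneg _)

theorem exists_lipschitzOnWith_glue {S : ℝ} {a b a' b' : ℝ → ℝ} (hS : 0 < S)
    (ha : ∀ s, HasDerivAt a (a' s) s) (hb : ∀ s, 0 < s → HasDerivAt b (b' s) s)
    (ca : Continuous a') (cb : ContinuousOn b' (Ioi 0)) (hab : a S = b S) (T : ℝ) :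
    ∃ C : ℝ, 0 ≤ C ∧ ∀ s ∈ Icc 0 T, ∀ t ∈ Icc 0 T, |glue S a b t - glue S a b s| ≤ C * |t - s| := by
  obtain ⟨C₁, hC₁⟩ := (isCompact_Icc (a := (0 : ℝ)) (b := S)).exists_bound_of_continuousOn
    ca.continuousOn
  obtain ⟨C₂, hC₂⟩ := (isCompact_Icc (a := S) (b := T)).exists_bound_of_continuousOn
    (cb.mono fun s hs => hS.trans_le hs.1)
  set C := max (max C₁ C₂) 0
  have hin : ∀ s ∈ Icc 0 S, ∀ t ∈ Icc 0 S, |glue S a b t - glue S a b s| ≤ C * |t - s| := by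
    intro s hs t ht
    rw [glue_of_le _ _ hs.2, glue_of_le _ _ ht.2]
    exact (convex_Icc 0 S).norm_image_sub_le_of_norm_hasDerivWithin_le
      (fun u _ => (ha u).hasDerivWithinAt)
      (fun u hu => (hC₁ u hu).trans ((le_max_left _ _).trans (le_max_left _ _))) hs ht
  have hout : ∀ s ∈ Icc S T, ∀ t ∈ Icc S T, |glue S a b t - glue S a b s| ≤ C * |t - s| := by
    intro s hs t ht
    rw [glue_of_ge hab hs.1, glue_of_ge hab ht.1]
    exact (convex_Icc S T).norm_image_sub_le_of_norm_hasDerivWithin_le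
      (fun u hu => (hb u (hS.trans_le hu.1)).hasDerivWithinAt)
      (fun u hu => (hC₂ u hu).trans ((le_max_right _ _).trans (le_max_left _ _))) hs ht
  have hmain : ∀ s ∈ Icc 0 T, ∀ t ∈ Icc 0 T, s ≤ t →
      |glue S a b t - glue S a b s| ≤ C * |t - s| := by
    intro s hs t ht hst
    rcases le_total t S with h | h
    · exact hin s ⟨hs.1, hst.trans h⟩ t ⟨ht.1, h⟩
    rcases le_total S s with h' | h'
    · exact hout s ⟨h', hs.2⟩ t ⟨h, ht.2⟩
    have h1 := hin s ⟨hs.1, h'⟩ S ⟨hS.le, le_rfl⟩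
    have h2 := hout S ⟨le_rfl, h.trans ht.2⟩ t ⟨h, ht.2⟩
    rw [abs_of_nonneg (sub_nonneg.2 h')] at h1
    rw [abs_of_nonneg (sub_nonneg.2 h)] at h2
    rw [abs_of_nonneg (sub_nonneg.2 hst)]
    have := abs_sub_le (glue S a b t) (glue S a b S) (glue S a b s)
    linarith
  refine ⟨C, le_max_right _ _, fun s hs t ht => ?_⟩
  rcases le_total s t with h | h
  · exact hmain s hs t ht h
  · rw [abs_sub_comm, abs_sub_comm t s]; exact hmain t ht s hs h

theorem ae_norm_sq_ne (S : ℝ) : ∀ᵐ x : Space3, ‖x‖ ^ 2 ≠ S := by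
  have h : (volume : Measure Space3) (Metric.sphere 0 (√S)) = 0 :=
    Measure.addHaar_sphere _ _ _
  rw [ae_iff]
  refine measure_mono_null (fun x hx => ?_) h
  simp only [ne_eq, not_not, mem_ofPred_eq] at hx
  rw [mem_sphere_zero_iff_norm, ← hx, Real.sqrt_sq (norm_nonneg x)]

theorem hasDerivAt_norm_sq_line (x : Space3) (i : Fin 3) :
    HasDerivAt (fun t : ℝ => ‖x + t • (EuclideanSpace.single i 1 : Space3)‖ ^ 2) (2 * x i) 0 := by
  have : (fun t : ℝ => ‖x + t • (EuclideanSpace.single i 1 : Space3)‖ ^ 2)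
      = fun t => ‖x‖ ^ 2 + 2 * (t * x i) + t ^ 2 := by
    funext t
    rw [norm_add_sq_real, norm_smul, inner_smul_right, EuclideanSpace.inner_single_right]
    simp
  rw [this]
  have h := ((((hasDerivAt_id (0 : ℝ)).mul_const (x i)).const_mul 2).const_add (‖x‖ ^ 2)).add
    (hasDerivAt_pow 2 (0 : ℝ))
  convert! h using 1
  simp

/-- Integration by parts for a radial function which is continuous, and continuously
differentiable on either side of a sphere. -/
theorem integral_glue_mul_pd {S : ℝ} {a b a' b' : ℝ → ℝ} (hS : 0 < S)
    (ha : ∀ s, HasDerivAt a (a' s) s) (hb : ∀ s, 0 < s → HasDerivAt b (b' s) s)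
    (ca : Continuous a') (cb : ContinuousOn b' (Ioi 0)) (hab : a S = b S)
    {f : Space3 → ℝ} (hf : IsTest f) (i : Fin 3) :
    ∫ x, glue S a b (‖x‖ ^ 2) * pd i f x
      = -∫ x, 2 * glue S a' b' (‖x‖ ^ 2) * (x i * f x) := by
  obtain ⟨r₁, hr₁, hr₁'⟩ := hf.exists_radius
  obtain ⟨r₂, hr₂, hr₂'⟩ := (hf.pd i).exists_radius
  set r := max r₁ r₂
  have hr0 : 0 < r := lt_max_of_lt_left hr₁
  have hr : ∀ x, r ≤ ‖x‖ → f x = 0 := fun x hx => hr₁' x ((le_max_left _ _).trans hx)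
  have h0 : ∀ x, r ≤ ‖x‖ → pd i f x = 0 := fun x hx => hr₂' x ((le_max_right _ _).trans hx)
  obtain ⟨C, hC0, hC⟩ := exists_lipschitzOnWith_glue hS ha hb ca cb hab ((r + 1) ^ 2)
  -- truncating the radius makes the function globally Lipschitz
  set g : Space3 → ℝ := fun x => glue S a b ((min ‖x‖ (r + 1)) ^ 2) with hg
  have hgl : LipschitzWith (Real.toNNReal (C * (2 * (r + 1)))) g := by
    refine LipschitzWith.of_dist_le_mul fun x y => ?_
    rw [Real.coe_toNNReal _ (by positivity), Real.dist_eq, hg]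
    have hm : ∀ z : Space3, 0 ≤ min ‖z‖ (r + 1) := fun z => le_min (norm_nonneg z) (by positivity)
    have hmem : ∀ z : Space3, (min ‖z‖ (r + 1)) ^ 2 ∈ Icc 0 ((r + 1) ^ 2) := fun z =>
      ⟨by positivity, pow_le_pow_left₀ (hm z) (min_le_right _ _) 2⟩
    refine (hC _ (hmem y) _ (hmem x)).trans ?_
    rw [mul_assoc]
    refine mul_le_mul_of_nonneg_left ?_ hC0
    rw [sq_sub_sq, abs_mul]
    refine mul_le_mul ?_ ?_ (abs_nonneg _) (by positivity)
    · rw [abs_of_nonneg (add_nonneg (hm x) (hm y))]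
      linarith [min_le_right ‖x‖ (r + 1), min_le_right ‖y‖ (r + 1)]
    · refine (abs_inf_sub_inf_le_abs _ _ _).trans ?_
      rw [dist_eq_norm]
      exact abs_norm_sub_norm_le x y
  obtain ⟨D, hD⟩ := ContDiff.lipschitzWith_of_hasCompactSupport hf.supp hf.smooth (by simp)
  have hint := hgl.integral_lineDeriv_mul_eq hD hf.supp (EuclideanSpace.single i 1)
    (μ := (volume : Measure Space3))
  have e1 : ∫ x, glue S a b (‖x‖ ^ 2) * pd i f x
      = -∫ x, lineDeriv ℝ f x (-EuclideanSpace.single i 1) * g x := by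
    rw [← integral_neg]
    refine integral_congr_ae (.of_forall fun x => ?_)
    have hl : lineDeriv ℝ f x (-EuclideanSpace.single i 1) = -pd i f x := by
      rw [(hf.differentiable x).lineDeriv_eq_fderiv, map_neg]; rfl
    simp only [hl]
    rcases le_or_gt r ‖x‖ with h | h
    · simp [h0 x h]
    · rw [hg]; simp only
      rw [min_eq_left (by linarith)]; ring
  rw [e1, ← hint]
  congr 1
  refine integral_congr_ae ?_
  filter_upwards [ae_norm_sq_ne S] with x hx
  rcases le_or_gt r ‖x‖ with h | h
  · simp [hr x h]
  have hd : HasLineDerivAt ℝ g (glue S a' b' (‖x‖ ^ 2) * (2 * x i)) x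
      (EuclideanSpace.single i 1) := by
    unfold HasLineDerivAt
    have hglue : HasDerivAt (glue S a b) (glue S a' b' (‖x‖ ^ 2))
        (‖x + (0 : ℝ) • (EuclideanSpace.single i 1 : Space3)‖ ^ 2) := by
      simp only [zero_smul, add_zero]
      rcases lt_or_gt_of_ne hx with h1 | h1
      · rw [glue_of_le _ _ h1.le]
        refine (ha _).congr_of_eventuallyEq ?_
        filter_upwards [Iio_mem_nhds h1] with s hs
        exact glue_of_le _ _ (le_of_lt hs)
      · rw [glue_of_lt _ _ h1]
        refine (hb _ (hS.trans h1)).congr_of_eventuallyEq ?_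
        filter_upwards [Ioi_mem_nhds h1] with s hs
        exact glue_of_lt _ _ hs
    refine (hglue.comp (0 : ℝ) (hasDerivAt_norm_sq_line x i)).congr_of_eventuallyEq ?_
    have hcont : Continuous fun t : ℝ => ‖x + t • (EuclideanSpace.single i 1 : Space3)‖ := by
      fun_prop
    have : ∀ᶠ t : ℝ in 𝓝 0, ‖x + t • (EuclideanSpace.single i 1 : Space3)‖ < r + 1 :=
      hcont.continuousAt.eventually_lt continuousAt_const (by simpa using by linarith)
    filter_upwards [this] with t ht
    simp only [hg, Function.comp]
    rw [min_eq_left ht.le]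
  simp only [hd.lineDeriv]
  ring

/-! ### The Stokes flow of a ball -/

/-- `s ↦ s ^ (-n / 2)`. -/
noncomputable def invSqrtPow (n : ℕ) (s : ℝ) : ℝ := ((√s) ^ n)⁻¹

theorem hasDerivAt_invSqrtPow (n : ℕ) {s : ℝ} (hs : 0 < s) :
    HasDerivAt (invSqrtPow n) (-(n / 2) * invSqrtPow (n + 2) s) s := by
  have h1 : √s ≠ 0 := (Real.sqrt_pos.2 hs).ne'
  have h := ((Real.hasDerivAt_sqrt hs.ne').pow n).inv (pow_ne_zero n h1)
  unfold invSqrtPow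
  convert! h using 1
  rcases n with _ | n
  · simp
  · simp only [Pi.pow_apply, Nat.add_sub_cancel]
    field_simp
    ring

theorem continuousOn_invSqrtPow (n : ℕ) : ContinuousOn (invSqrtPow n) (Ioi 0) := fun _ hs =>
  (hasDerivAt_invSqrtPow n hs).continuousAt.continuousWithinAt

theorem invSqrtPow_norm (n : ℕ) (x : Space3) : invSqrtPow n (‖x‖ ^ 2) = (‖x‖ ^ n)⁻¹ := by
  rw [invSqrtPow, Real.sqrt_sq (norm_nonneg x)]

theorem invSqrtPow_sq (n : ℕ) {R : ℝ} (hR : 0 < R) : invSqrtPow n (R ^ 2) = (R ^ n)⁻¹ := by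
  rw [invSqrtPow, Real.sqrt_sq hR.le]

/-- The radial biharmonic potential of `1_{B(0,R)}`, as a function of `s = |x|²`. -/
noncomputable def dropPsi (R : ℝ) : ℝ → ℝ := glue (R ^ 2)
  (fun s => -R ^ 2 / 12 * s + s ^ 2 / 120)
  (fun s => -R ^ 3 / 6 * √s - R ^ 5 / 30 * invSqrtPow 1 s + R ^ 4 / 8)

/-- Twice the derivative of `dropPsi`. -/
noncomputable def dropA (R : ℝ) : ℝ → ℝ := glue (R ^ 2)
  (fun s => -R ^ 2 / 6 + s / 30)
  (fun s => -R ^ 3 / 6 * invSqrtPow 1 s + R ^ 5 / 30 * invSqrtPow 3 s)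

/-- Twice the derivative of `dropA`. -/
noncomputable def dropD (R : ℝ) : ℝ → ℝ := glue (R ^ 2)
  (fun _ => 1 / 15)
  (fun s => R ^ 3 / 6 * invSqrtPow 3 s - R ^ 5 / 10 * invSqrtPow 5 s)

/-- The Newtonian potential of `1_{B(0,R)}`, the Laplacian of `dropPsi`. -/
noncomputable def dropV (R : ℝ) : ℝ → ℝ := glue (R ^ 2)
  (fun s => s / 6 - R ^ 2 / 2)
  (fun s => -R ^ 3 / 3 * invSqrtPow 1 s)

/-- Twice the derivative of `dropV`. -/
noncomputable def dropB (R : ℝ) : ℝ → ℝ := glue (R ^ 2)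
  (fun _ => 1 / 3)
  (fun s => R ^ 3 / 3 * invSqrtPow 3 s)

/-- The velocity of the Stokes flow generated by the density `1_{B(0,R)}`. -/
noncomputable def dropVel (R : ℝ) (x : Space3) : Space3 :=
  (dropV R (‖x‖ ^ 2) - dropA R (‖x‖ ^ 2)) • e₃ - (dropD R (‖x‖ ^ 2) * x 2) • x

/-- The pressure of the Stokes flow generated by the density `1_{B(0,R)}`. -/
noncomputable def dropPressure (R : ℝ) (x : Space3) : ℝ := -(dropB R (‖x‖ ^ 2) * x 2)

theorem continuous_dropPsi {R : ℝ} (hR : 0 < R) : Continuous (dropPsi R) := by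
  refine continuous_glue (by positivity) (by fun_prop) ?_ ?_
  · have := continuousOn_invSqrtPow 1
    exact (((Real.continuous_sqrt.const_mul _).continuousOn).sub (this.const_mul _)).add
      continuousOn_const
  · simp only [invSqrtPow_sq _ hR, Real.sqrt_sq hR.le]; field_simp; ring

theorem continuous_dropA {R : ℝ} (hR : 0 < R) : Continuous (dropA R) := by
  refine continuous_glue (by positivity) (by fun_prop)
    (((continuousOn_invSqrtPow 1).const_mul _).add ((continuousOn_invSqrtPow 3).const_mul _)) ?_
  simp only [invSqrtPow_sq _ hR]; field_simp

theorem continuous_dropD {R : ℝ} (hR : 0 < R) : Continuous (dropD R) := by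
  refine continuous_glue (by positivity) (by fun_prop)
    (((continuousOn_invSqrtPow 3).const_mul _).sub ((continuousOn_invSqrtPow 5).const_mul _)) ?_
  simp only [invSqrtPow_sq _ hR]; field_simp; norm_num

theorem continuous_dropV {R : ℝ} (hR : 0 < R) : Continuous (dropV R) := by
  refine continuous_glue (by positivity) (by fun_prop)
    ((continuousOn_invSqrtPow 1).const_mul _) ?_
  simp only [invSqrtPow_sq _ hR]; field_simp; ring

theorem continuous_dropB {R : ℝ} (hR : 0 < R) : Continuous (dropB R) := by
  refine continuous_glue (by positivity) (by fun_prop)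
    ((continuousOn_invSqrtPow 3).const_mul _) ?_
  simp only [invSqrtPow_sq _ hR]; field_simp

theorem integral_dropPsi_pd {R : ℝ} (hR : 0 < R) {f : Space3 → ℝ} (hf : IsTest f) (i : Fin 3) :
    ∫ x, dropPsi R (‖x‖ ^ 2) * pd i f x = -∫ x, dropA R (‖x‖ ^ 2) * (x i * f x) := by
  have h := integral_glue_mul_pd (S := R ^ 2) (a := fun s => -R ^ 2 / 12 * s + s ^ 2 / 120)
    (b := fun s => -R ^ 3 / 6 * √s - R ^ 5 / 30 * invSqrtPow 1 s + R ^ 4 / 8)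
    (a' := fun s => -R ^ 2 / 12 + s / 60)
    (b' := fun s => -R ^ 3 / 12 * invSqrtPow 1 s + R ^ 5 / 60 * invSqrtPow 3 s)
    (by positivity) ?_ ?_ (by fun_prop)
    (((continuousOn_invSqrtPow 1).const_mul _).add ((continuousOn_invSqrtPow 3).const_mul _))
    (by simp only [invSqrtPow_sq _ hR, Real.sqrt_sq hR.le]; field_simp; ring) hf i
  · unfold dropPsi
    rw [h]
    congr 2
    funext x
    congr 1
    unfold dropA glue
    split_ifs <;> ring
  · intro s
    have := ((hasDerivAt_id s).const_mul (-R ^ 2 / 12)).add ((hasDerivAt_pow 2 s).div_const 120)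
    convert! this using 1
    norm_num; ring
  · intro s hs
    have := (((Real.hasDerivAt_sqrt hs.ne').const_mul (-R ^ 3 / 6)).sub
      ((hasDerivAt_invSqrtPow 1 hs).const_mul (R ^ 5 / 30))).add_const (R ^ 4 / 8)
    convert! this using 1
    simp only [invSqrtPow]
    have := (Real.sqrt_pos.2 hs).ne'
    push_cast
    field_simp
    ring

theorem integral_dropA_pd {R : ℝ} (hR : 0 < R) {f : Space3 → ℝ} (hf : IsTest f) (i : Fin 3) :
    ∫ x, dropA R (‖x‖ ^ 2) * pd i f x = -∫ x, dropD R (‖x‖ ^ 2) * (x i * f x) := by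
  have h := integral_glue_mul_pd (S := R ^ 2) (a := fun s => -R ^ 2 / 6 + s / 30)
    (b := fun s => -R ^ 3 / 6 * invSqrtPow 1 s + R ^ 5 / 30 * invSqrtPow 3 s)
    (a' := fun _ => 1 / 30)
    (b' := fun s => R ^ 3 / 12 * invSqrtPow 3 s - R ^ 5 / 20 * invSqrtPow 5 s)
    (by positivity) ?_ ?_ (by fun_prop)
    (((continuousOn_invSqrtPow 3).const_mul _).sub ((continuousOn_invSqrtPow 5).const_mul _))
    (by simp only [invSqrtPow_sq _ hR]; field_simp) hf i
  · unfold dropA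
    rw [h]
    congr 2
    funext x
    congr 1
    unfold dropD glue
    split_ifs <;> ring
  · intro s
    simpa using ((hasDerivAt_id s).div_const 30).const_add (-R ^ 2 / 6)
  · intro s hs
    have := ((hasDerivAt_invSqrtPow 1 hs).const_mul (-R ^ 3 / 6)).add
      ((hasDerivAt_invSqrtPow 3 hs).const_mul (R ^ 5 / 30))
    convert! this using 1
    push_cast; ring

theorem integral_dropV_pd {R : ℝ} (hR : 0 < R) {f : Space3 → ℝ} (hf : IsTest f) (i : Fin 3) :
    ∫ x, dropV R (‖x‖ ^ 2) * pd i f x = -∫ x, dropB R (‖x‖ ^ 2) * (x i * f x) := by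
  have h := integral_glue_mul_pd (S := R ^ 2) (a := fun s => s / 6 - R ^ 2 / 2)
    (b := fun s => -R ^ 3 / 3 * invSqrtPow 1 s)
    (a' := fun _ => 1 / 6) (b' := fun s => R ^ 3 / 6 * invSqrtPow 3 s)
    (by positivity) ?_ ?_ (by fun_prop) ((continuousOn_invSqrtPow 3).const_mul _)
    (by simp only [invSqrtPow_sq _ hR]; field_simp; ring) hf i
  · unfold dropV
    rw [h]
    congr 2
    funext x
    congr 1
    unfold dropB glue
    split_ifs <;> ring
  · intro s
    simpa using ((hasDerivAt_id s).div_const 6).sub_const (R ^ 2 / 2)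
  · intro s hs
    have := (hasDerivAt_invSqrtPow 1 hs).const_mul (-R ^ 3 / 3)
    convert! this using 1
    push_cast; ring

/-- The derivative of `dropB` jumps across the sphere. -/
theorem integral_dropB_pd {R : ℝ} (hR : 0 < R) {f : Space3 → ℝ} (hf : IsTest f) (i : Fin 3) :
    ∫ x, dropB R (‖x‖ ^ 2) * pd i f x = -∫ x, 2 * glue (R ^ 2) (fun _ => 0)
      (fun s => -R ^ 3 / 2 * invSqrtPow 5 s) (‖x‖ ^ 2) * (x i * f x) := by
  refine integral_glue_mul_pd (by positivity) (fun s => hasDerivAt_const _ _) ?_ (by fun_prop)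
    ((continuousOn_invSqrtPow 5).const_mul _)
    (by simp only [invSqrtPow_sq _ hR]; field_simp) hf i
  intro s hs
  have := (hasDerivAt_invSqrtPow 3 hs).const_mul (R ^ 3 / 3)
  convert! this using 1
  push_cast; ring

theorem dropV_eq {R : ℝ} (hR : 0 < R) (x : Space3) :
    dropV R (‖x‖ ^ 2) = 3 * dropA R (‖x‖ ^ 2) + dropD R (‖x‖ ^ 2) * ‖x‖ ^ 2 := by
  unfold dropV dropA dropD
  rcases le_or_gt (‖x‖ ^ 2) (R ^ 2) with h | h
  · simp only [glue_of_le _ _ h]; ring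
  · simp only [glue_of_lt _ _ h, invSqrtPow_norm]
    have : ‖x‖ ≠ 0 := by
      rintro h0; rw [h0] at h; nlinarith [sq_nonneg R]
    field_simp; ring

theorem norm_sq_eq (x : Space3) : ‖x‖ ^ 2 = ∑ i, x i * x i := by
  rw [EuclideanSpace.norm_sq_eq]
  simp [sq]

theorem contDiff_coord (i : Fin 3) : ContDiff ℝ ∞ (fun x : Space3 => x i) :=
  (EuclideanSpace.proj i : Space3 →L[ℝ] ℝ).contDiff

theorem IsTest.coord_mul {f : Space3 → ℝ} (hf : IsTest f) (i : Fin 3) :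
    IsTest (fun x => x i * f x) := hf.mul_left (contDiff_coord i)

theorem pd_coord_mul {f : Space3 → ℝ} (hf : IsTest f) (i j : Fin 3) (x : Space3) :
    pd i (fun y => y j * f y) x = x j * pd i f x + (if i = j then 1 else 0) * f x := by
  rw [pd_mul ((contDiff_coord j).differentiable (by simp)) hf.differentiable, pd_coord]

theorem locallyIntegrable_radial {h : ℝ → ℝ} (hh : Continuous h) :
    LocallyIntegrable (fun x : Space3 => h (‖x‖ ^ 2)) volume :=
  (hh.comp (by fun_prop)).locallyIntegrable

theorem integral_dropPsi_pd_pd {R : ℝ} (hR : 0 < R) {f : Space3 → ℝ} (hf : IsTest f) (i j : Fin 3) :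
    ∫ x, dropPsi R (‖x‖ ^ 2) * pd i (pd j f) x
      = ∫ x, ((if i = j then 1 else 0) * dropA R (‖x‖ ^ 2)
          + dropD R (‖x‖ ^ 2) * (x i * x j)) * f x := by
  have hA := locallyIntegrable_radial (continuous_dropA hR)
  have hD := locallyIntegrable_radial (continuous_dropD hR)
  rw [integral_dropPsi_pd hR (hf.pd j)]
  have h1 : ∀ x : Space3, dropA R (‖x‖ ^ 2) * (x i * pd j f x)
      = dropA R (‖x‖ ^ 2) * pd j (fun y => y i * f y) x
        - dropA R (‖x‖ ^ 2) * ((if i = j then 1 else 0) * f x) := by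
    intro x
    rw [pd_coord_mul hf]
    simp only [eq_comm (a := j) (b := i)]
    ring
  simp only [h1]
  rw [integral_sub ((hf.coord_mul i).pd j |>.integrable_mul hA)
    ((hf.const_mul _).integrable_mul hA), integral_dropA_pd hR (hf.coord_mul i), neg_sub,
    sub_neg_eq_add, ← integral_add ((hf.const_mul _).integrable_mul hA)
    (((hf.coord_mul i).coord_mul j).integrable_mul hD)]
  congr 1; funext x; ring

theorem integral_dropPsi_lap {R : ℝ} (hR : 0 < R) {f : Space3 → ℝ} (hf : IsTest f) :
    ∫ x, dropPsi R (‖x‖ ^ 2) * lap f x = ∫ x, dropV R (‖x‖ ^ 2) * f x := by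
  have hP := locallyIntegrable_radial (continuous_dropPsi hR)
  have hA := locallyIntegrable_radial (continuous_dropA hR)
  have hD := locallyIntegrable_radial (continuous_dropD hR)
  unfold lap
  simp only [Finset.mul_sum]
  rw [integral_finsetSum _ fun i _ => ((hf.pd i).pd i).integrable_mul hP]
  simp only [integral_dropPsi_pd_pd hR hf]
  rw [← integral_finsetSum]
  · congr 1; funext x
    rw [dropV_eq hR, norm_sq_eq]
    simp only [Fin.sum_univ_three, if_true]
    ring
  · intro i _
    have := (hf.integrable_mul hA).add (((hf.coord_mul i).coord_mul i).integrable_mul hD)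
    refine this.congr (.of_forall fun x => ?_)
    simp only [Pi.add_apply, if_true]; ring

/-- The source of the flow: the distributional Laplacian of `dropV` is `1_{B(0,R)}`. The first
derivatives of `dropV` are continuous, and only the second ones jump across the sphere. -/
theorem integral_dropV_lap {R : ℝ} (hR : 0 < R) {f : Space3 → ℝ} (hf : IsTest f) :
    ∫ x, dropV R (‖x‖ ^ 2) * lap f x
      = ∫ x, (Metric.ball (0 : Space3) R).indicator (fun _ => 1) x * f x := by
  have hV := locallyIntegrable_radial (continuous_dropV hR)
  have hB := locallyIntegrable_radial (continuous_dropB hR)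
  have hB' : LocallyIntegrable (fun x : Space3 => glue (R ^ 2) (fun _ => 0)
      (fun s => -R ^ 3 / 2 * invSqrtPow 5 s) (‖x‖ ^ 2)) volume :=
    locallyIntegrable_glue (by positivity) (by fun_prop)
      ((continuousOn_invSqrtPow 5).const_mul _)
  unfold lap
  simp only [Finset.mul_sum]
  rw [integral_finsetSum _ fun i _ => ((hf.pd i).pd i).integrable_mul hV]
  have key : ∀ i : Fin 3, ∫ x, dropV R (‖x‖ ^ 2) * pd i (pd i f) x
      = ∫ x, (glue (R ^ 2) (fun _ => 0) (fun s => -R ^ 3 / 2 * invSqrtPow 5 s) (‖x‖ ^ 2)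
        * (2 * (x i * (x i * f x))) + dropB R (‖x‖ ^ 2) * f x) := by
    intro i
    rw [integral_dropV_pd hR (hf.pd i)]
    have h1 : ∀ x : Space3, dropB R (‖x‖ ^ 2) * (x i * pd i f x)
        = dropB R (‖x‖ ^ 2) * pd i (fun y => y i * f y) x - dropB R (‖x‖ ^ 2) * f x := by
      intro x
      rw [pd_coord_mul hf, if_pos rfl]; ring
    simp only [h1]
    rw [integral_sub ((hf.coord_mul i).pd i |>.integrable_mul hB) (hf.integrable_mul hB),
      integral_dropB_pd hR (hf.coord_mul i), neg_sub, sub_neg_eq_add, add_comm, ← integral_add]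
    · congr 1; funext x; ring
    · refine ((((hf.coord_mul i).coord_mul i).const_mul 2).integrable_mul hB').congr
        (.of_forall fun x => ?_)
      simp only; ring
    · exact hf.integrable_mul hB
  simp only [key]
  have hint : ∀ i : Fin 3, Integrable fun x : Space3 =>
      glue (R ^ 2) (fun _ => 0) (fun s => -R ^ 3 / 2 * invSqrtPow 5 s) (‖x‖ ^ 2)
        * (2 * (x i * (x i * f x))) + dropB R (‖x‖ ^ 2) * f x := fun i =>
    ((((hf.coord_mul i).coord_mul i).const_mul 2).integrable_mul hB').add (hf.integrable_mul hB)
  rw [← integral_finsetSum _ fun i _ => hint i]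
  refine integral_congr_ae ?_
  filter_upwards [ae_norm_sq_ne (R ^ 2)] with x hx
  have hsum : ∀ c d : ℝ, ∑ i : Fin 3, (c * (2 * (x i * (x i * f x))) + d * f x)
      = (2 * c * ‖x‖ ^ 2 + 3 * d) * f x := by
    intro c d
    rw [norm_sq_eq]
    simp only [Fin.sum_univ_three]; ring
  rw [hsum]
  congr 1
  unfold dropB
  rcases lt_or_gt_of_ne hx with h | h
  · simp only [glue_of_le _ _ h.le]
    rw [indicator_of_mem (by simpa using (abs_lt_of_sq_lt_sq h hR.le).trans_le' (le_abs_self _))]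
    norm_num
  · simp only [glue_of_lt _ _ h, invSqrtPow_norm]
    have h' : R < ‖x‖ := lt_of_pow_lt_pow_left₀ 2 (norm_nonneg x) h
    rw [indicator_of_notMem (by simpa using h'.le)]
    have : ‖x‖ ≠ 0 := (hR.trans h').ne'
    field_simp; ring

theorem continuous_dropVel {R : ℝ} (hR : 0 < R) : Continuous (dropVel R) := by
  unfold dropVel
  have h1 : Continuous fun x : Space3 => dropV R (‖x‖ ^ 2) :=
    (continuous_dropV hR).comp (by fun_prop)
  have h2 : Continuous fun x : Space3 => dropA R (‖x‖ ^ 2) :=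
    (continuous_dropA hR).comp (by fun_prop)
  have h3 : Continuous fun x : Space3 => dropD R (‖x‖ ^ 2) :=
    (continuous_dropD hR).comp (by fun_prop)
  fun_prop

theorem continuous_dropPressure {R : ℝ} (hR : 0 < R) : Continuous (dropPressure R) := by
  unfold dropPressure
  have h1 : Continuous fun x : Space3 => dropB R (‖x‖ ^ 2) :=
    (continuous_dropB hR).comp (by fun_prop)
  fun_prop

theorem dropVel_apply (R : ℝ) (x : Space3) (k : Fin 3) :
    dropVel R x k = (if k = 2 then 1 else 0) * (dropV R (‖x‖ ^ 2) - dropA R (‖x‖ ^ 2))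
      - dropD R (‖x‖ ^ 2) * (x k * x 2) := by
  simp [dropVel, e₃]
  ring

/-- The components of the velocity are `δₖ₃ V - ∂ₖ∂₃Ψ`, in the sense of distributions. -/
theorem integral_dropVel_mul {R : ℝ} (hR : 0 < R) {f : Space3 → ℝ} (hf : IsTest f) (k : Fin 3) :
    ∫ x, dropVel R x k * f x = (if k = 2 then 1 else 0) * (∫ x, dropV R (‖x‖ ^ 2) * f x)
      - ∫ x, dropPsi R (‖x‖ ^ 2) * pd k (pd 2 f) x := by
  have hV := locallyIntegrable_radial (continuous_dropV hR)
  have hA := locallyIntegrable_radial (continuous_dropA hR)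
  have hD := locallyIntegrable_radial (continuous_dropD hR)
  rw [integral_dropPsi_pd_pd hR hf, ← integral_const_mul, ← integral_sub]
  · congr 1; funext x; rw [dropVel_apply]; ring
  · exact (hf.integrable_mul hV).const_mul _
  · have := ((hf.const_mul (if k = 2 then 1 else 0)).integrable_mul hA).add
      (((hf.coord_mul 2).coord_mul k).integrable_mul hD)
    refine this.congr (.of_forall fun x => ?_)
    simp only [Pi.add_apply]; ring

theorem lap_pd {f : Space3 → ℝ} (hf : IsTest f) (j : Fin 3) :
    lap (pd j f) = pd j (lap f) := by
  funext x
  unfold lap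
  rw [pd_sum _ fun i _ => ((hf.pd i).pd i).differentiable]
  refine Finset.sum_congr rfl fun i _ => ?_
  rw [pd_comm hf.smooth i j, pd_comm (hf.pd i).smooth i j]

theorem locallyIntegrable_dropVel_apply {R : ℝ} (hR : 0 < R) (k : Fin 3) :
    LocallyIntegrable (fun x => dropVel R x k) volume := by
  have : Continuous fun x => dropVel R x k := by
    have := continuous_dropVel hR
    fun_prop
  exact this.locallyIntegrable

theorem dropVel_incompressible {R : ℝ} (hR : 0 < R) {φ : Space3 → ℝ} (hφ : IsTest φ) :
    ∫ x, fderiv ℝ φ x (dropVel R x) = 0 := by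
  simp only [fderiv_eq_sum_pd]
  rw [integral_finsetSum _ fun i _ =>
    (hφ.pd i).integrable_mul (locallyIntegrable_dropVel_apply hR i)]
  simp only [integral_dropVel_mul hR (hφ.pd _)]
  rw [Finset.sum_sub_distrib]
  simp only [ite_mul, one_mul, zero_mul, Finset.sum_ite_eq', Finset.mem_univ, if_true]
  rw [← integral_dropPsi_lap hR (hφ.pd 2)]
  unfold lap
  simp only [Finset.mul_sum]
  rw [integral_finsetSum _ fun i _ => (((hφ.pd 2).pd i).pd i).integrable_mul
    (locallyIntegrable_radial (continuous_dropPsi hR)), sub_eq_zero]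
  refine Finset.sum_congr rfl fun i _ => ?_
  rw [pd_comm hφ.smooth i 2]

/-- The weak Stokes equation for the ball. With `u = V e₃ - ∇∂₃Ψ`, `ΔΨ = V`, `ΔV = 1_{B(0,R)}` and
`∂₃V` as the opposite of the pressure, this is a sum of the previous distributional identities. -/
theorem dropVel_momentum {R : ℝ} (hR : 0 < R) {ψ : Fin 3 → Space3 → ℝ} (hψ : ∀ k, IsTest (ψ k)) :
    -(∫ x, ∑ k, dropVel R x k * lap (ψ k) x) - ∫ x, dropPressure R x * ∑ i, pd i (ψ i) x
      = -∫ x, (Metric.ball (0 : Space3) R).indicator (fun _ => 1) x * ψ 2 x := by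
  have hP := locallyIntegrable_radial (continuous_dropPsi hR)
  have hdiv : IsTest (fun x => ∑ i, pd i (ψ i) x) := IsTest.sum _ fun i _ => (hψ i).pd i
  rw [integral_finsetSum _ fun k _ =>
    (hψ k).lap.integrable_mul (locallyIntegrable_dropVel_apply hR k)]
  simp only [integral_dropVel_mul hR (hψ _).lap]
  rw [Finset.sum_sub_distrib]
  simp only [ite_mul, one_mul, zero_mul, Finset.sum_ite_eq', Finset.mem_univ, if_true]
  rw [integral_dropV_lap hR (hψ 2)]
  have h1 : ∑ k, ∫ x, dropPsi R (‖x‖ ^ 2) * pd k (pd 2 (lap (ψ k))) x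
      = ∫ x, dropPressure R x * ∑ i, pd i (ψ i) x := by
    rw [← integral_finsetSum _ fun k _ => (((hψ k).lap.pd 2).pd k).integrable_mul hP]
    have h2 : ∀ x, ∑ k, dropPsi R (‖x‖ ^ 2) * pd k (pd 2 (lap (ψ k))) x
        = dropPsi R (‖x‖ ^ 2) * lap (pd 2 (fun x => ∑ i, pd i (ψ i) x)) x := by
      intro x
      rw [← Finset.mul_sum, lap_pd hdiv]
      congr 1
      have h3 : lap (fun x => ∑ i, pd i (ψ i) x) = fun x => ∑ k, pd k (lap (ψ k)) x := by
        funext y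
        unfold lap
        have : ∀ i : Fin 3, pd i (fun x => ∑ k, pd k (ψ k) x) = fun x => ∑ k, pd i (pd k (ψ k)) x :=
          fun i => by funext z; exact pd_sum _ (fun k _ => ((hψ k).pd k).differentiable) i z
        simp only [this]
        have h4 : ∀ i : Fin 3, pd i (fun x => ∑ k, pd i (pd k (ψ k)) x) y
            = ∑ k, pd i (pd i (pd k (ψ k))) y :=
          fun i => pd_sum _ (fun k _ => (((hψ k).pd k).pd i).differentiable) i y
        simp only [h4]
        rw [Finset.sum_comm]
        refine Finset.sum_congr rfl fun k _ => ?_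
        have := congrFun (lap_pd (hψ k) k) y
        unfold lap at this
        exact this
      rw [h3, pd_sum _ fun k _ => ((hψ k).lap.pd k).differentiable]
      refine Finset.sum_congr rfl fun k _ => ?_
      rw [pd_comm (hψ k).lap.smooth k 2]
    simp only [h2]
    rw [integral_dropPsi_lap hR (hdiv.pd 2), integral_dropV_pd hR hdiv, ← integral_neg]
    congr 1; funext x; unfold dropPressure; ring
  rw [h1]; ring

/-! ### The Oseen kernel -/

/-- The constant `1 / (6 |B(0,1)|)`, that is `1 / (8π)`. -/
noncomputable def oseenConst : ℝ := (6 * volume.real (Metric.ball (0 : Space3) 1))⁻¹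

theorem volume_unitBall_pos : 0 < volume.real (Metric.ball (0 : Space3) 1) :=
  ENNReal.toReal_pos (Metric.measure_ball_pos _ _ one_pos).ne' measure_ball_lt_top.ne

theorem oseenConst_pos : 0 < oseenConst := by
  have := volume_unitBall_pos
  unfold oseenConst; positivity

/-- The velocity generated by a unit point mass at the origin under the force `-e₃`. -/
noncomputable def oseen (x : Space3) : Space3 :=
  (-oseenConst) • ((‖x‖)⁻¹ • e₃ + (x 2 * (‖x‖ ^ 3)⁻¹) • x)

theorem norm_e₃ : ‖e₃‖ = 1 := by simp [e₃]

theorem abs_coord_le (x : Space3) (i : Fin 3) : |x i| ≤ ‖x‖ := PiLp.norm_apply_le x i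

theorem measurable_oseen : Measurable oseen := by
  unfold oseen
  have : Measurable fun x : Space3 => x 2 := (contDiff_coord 2).continuous.measurable
  fun_prop

theorem norm_oseen_le (x : Space3) : ‖oseen x‖ ≤ 2 * oseenConst * ‖x‖⁻¹ := by
  rcases eq_or_ne x 0 with rfl | hx
  · simp [oseen]
  have hx' : 0 < ‖x‖ := norm_pos_iff.2 hx
  unfold oseen
  rw [norm_smul, norm_neg, Real.norm_of_nonneg oseenConst_pos.le, mul_comm 2 oseenConst, mul_assoc]
  refine mul_le_mul_of_nonneg_left ?_ oseenConst_pos.le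
  refine (norm_add_le _ _).trans ?_
  rw [norm_smul, norm_smul, norm_e₃, norm_mul, norm_inv, norm_inv, norm_norm, norm_pow, norm_norm]
  have h2 : ‖x 2‖ * (‖x‖ ^ 3)⁻¹ * ‖x‖ ≤ ‖x‖ * (‖x‖ ^ 3)⁻¹ * ‖x‖ := by
    gcongr; exact abs_coord_le x 2
  have h3 : ‖x‖ * (‖x‖ ^ 3)⁻¹ * ‖x‖ = ‖x‖⁻¹ := by field_simp
  linarith

theorem abs_inv_norm_sub_le {x y : Space3} (hx : x ≠ 0) (hy : y ≠ 0) :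
    |‖x‖⁻¹ - ‖y‖⁻¹| ≤ ‖x - y‖ * (‖x‖⁻¹ * ‖y‖⁻¹) := by
  have hx' : 0 < ‖x‖ := norm_pos_iff.2 hx
  have hy' : 0 < ‖y‖ := norm_pos_iff.2 hy
  have : ‖x‖⁻¹ - ‖y‖⁻¹ = (‖y‖ - ‖x‖) * (‖x‖⁻¹ * ‖y‖⁻¹) := by field_simp
  rw [this, abs_mul, abs_of_pos (by positivity : 0 < ‖x‖⁻¹ * ‖y‖⁻¹), norm_sub_rev]
  gcongr
  exact abs_norm_sub_norm_le y x

/-- The right-hand side, with `x - y` and `x' - y` in place of `x` and `y`, is integrable in `y` against a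
bounded density; this makes the velocity Lipschitz. -/
theorem norm_oseen_sub_le (x y : Space3) :
    ‖oseen x - oseen y‖ ≤ 3 * oseenConst * (‖x - y‖ * ((‖x‖ ^ 2)⁻¹ + (‖y‖ ^ 2)⁻¹)) := by
  have hκ := oseenConst_pos
  -- the degenerate cases, where `oseen 0 = 0` by convention
  have hdeg : ∀ z : Space3, ‖oseen z‖ ≤ 3 * oseenConst * (‖z‖ * (‖z‖ ^ 2)⁻¹) := by
    intro z
    rcases eq_or_ne z 0 with rfl | hz
    · simp [oseen]
    have hz' : 0 < ‖z‖ := norm_pos_iff.2 hz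
    refine (norm_oseen_le z).trans ?_
    rw [show ‖z‖ * (‖z‖ ^ 2)⁻¹ = ‖z‖⁻¹ by field_simp]
    gcongr; norm_num
  have h0 : oseen 0 = 0 := by simp [oseen]
  rcases eq_or_ne x 0 with rfl | hx
  · simpa [h0] using hdeg y
  rcases eq_or_ne y 0 with rfl | hy
  · simpa [h0] using hdeg x
  have hx' : 0 < ‖x‖ := norm_pos_iff.2 hx
  have hy' : 0 < ‖y‖ := norm_pos_iff.2 hy
  set q : ℝ := ‖x‖⁻¹ * ‖y‖⁻¹ with hq
  have hq0 : 0 < q := by positivity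
  set x' : Space3 := ‖x‖⁻¹ • x with hx'def
  set y' : Space3 := ‖y‖⁻¹ • y with hy'def
  have nx : ‖x'‖ = 1 := by rw [hx'def, norm_smul, norm_inv, norm_norm]; field_simp
  have ny : ‖y'‖ = 1 := by rw [hy'def, norm_smul, norm_inv, norm_norm]; field_simp
  have hI := abs_inv_norm_sub_le hx hy
  have hdir : ‖x' - y'‖ ≤ 2 * (‖x - y‖ * ‖x‖⁻¹) := by
    have : x' - y' = ‖x‖⁻¹ • (x - y) + (‖x‖⁻¹ - ‖y‖⁻¹) • y := by
      rw [hx'def, hy'def, smul_sub, sub_smul]; abel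
    rw [this]
    refine (norm_add_le _ _).trans ?_
    rw [norm_smul, norm_smul, norm_inv, norm_norm, Real.norm_eq_abs]
    have h1 : |‖x‖⁻¹ - ‖y‖⁻¹| * ‖y‖ ≤ ‖x - y‖ * (‖x‖⁻¹ * ‖y‖⁻¹) * ‖y‖ := by gcongr
    have h2 : ‖x - y‖ * (‖x‖⁻¹ * ‖y‖⁻¹) * ‖y‖ = ‖x - y‖ * ‖x‖⁻¹ := by field_simp
    linarith
  have hform : ∀ z : Space3, z ≠ 0 → oseen z
      = (-oseenConst) • (‖z‖⁻¹ • (e₃ + ((‖z‖⁻¹ • z) 2) • (‖z‖⁻¹ • z))) := by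
    intro z hz
    have hz' : 0 < ‖z‖ := norm_pos_iff.2 hz
    unfold oseen
    congr 1
    rw [smul_add, smul_smul, smul_smul]
    congr 2
    simp only [PiLp.smul_apply, smul_eq_mul]
    field_simp
  have hdiff : oseen x - oseen y = (-oseenConst) • ((‖x‖⁻¹ - ‖y‖⁻¹) • (e₃ + x' 2 • x')
      + ‖y‖⁻¹ • ((x' 2 - y' 2) • x' + y' 2 • (x' - y'))) := by
    rw [hform x hx, hform y hy, ← smul_sub]
    congr 1
    simp only [sub_smul, smul_sub, smul_add]
    abel
  rw [hdiff, norm_smul, norm_neg, Real.norm_of_nonneg hκ.le]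
  have hn1 : ‖e₃ + x' 2 • x'‖ ≤ 2 := by
    refine (norm_add_le _ _).trans ?_
    rw [norm_e₃, norm_smul, nx, Real.norm_eq_abs]
    have := abs_coord_le x' 2
    linarith
  have hn2 : ‖(x' 2 - y' 2) • x' + y' 2 • (x' - y')‖ ≤ 2 * ‖x' - y'‖ := by
    refine (norm_add_le _ _).trans ?_
    rw [norm_smul _ x', norm_smul _ (x' - y'), nx, Real.norm_eq_abs, Real.norm_eq_abs]
    have h1 := abs_coord_le (x' - y') 2
    have h2 := abs_coord_le y' 2
    rw [PiLp.sub_apply] at h1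
    rw [ny] at h2
    nlinarith [norm_nonneg (x' - y')]
  have htot : ‖(‖x‖⁻¹ - ‖y‖⁻¹) • (e₃ + x' 2 • x')
      + ‖y‖⁻¹ • ((x' 2 - y' 2) • x' + y' 2 • (x' - y'))‖ ≤ 6 * (‖x - y‖ * q) := by
    refine (norm_add_le _ _).trans ?_
    rw [norm_smul, norm_smul, norm_inv, norm_norm, Real.norm_eq_abs]
    have h1 : |‖x‖⁻¹ - ‖y‖⁻¹| * ‖e₃ + x' 2 • x'‖ ≤ ‖x - y‖ * q * 2 := by gcongr
    have h2 : ‖y‖⁻¹ * ‖(x' 2 - y' 2) • x' + y' 2 • (x' - y')‖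
        ≤ ‖y‖⁻¹ * (2 * (2 * (‖x - y‖ * ‖x‖⁻¹))) := by gcongr; linarith
    have h3 : ‖y‖⁻¹ * (2 * (2 * (‖x - y‖ * ‖x‖⁻¹))) = 4 * (‖x - y‖ * q) := by rw [hq]; ring
    linarith
  have hq2 : 2 * q ≤ (‖x‖ ^ 2)⁻¹ + (‖y‖ ^ 2)⁻¹ := by
    rw [hq, ← inv_pow, ← inv_pow]
    nlinarith [sq_nonneg (‖x‖⁻¹ - ‖y‖⁻¹)]
  have h5 : 6 * (‖x - y‖ * q) ≤ 3 * (‖x - y‖ * ((‖x‖ ^ 2)⁻¹ + (‖y‖ ^ 2)⁻¹)) := by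
    have := mul_le_mul_of_nonneg_left hq2 (norm_nonneg (x - y))
    linarith
  calc oseenConst * _ ≤ oseenConst * (6 * (‖x - y‖ * q)) := by gcongr
    _ ≤ oseenConst * (3 * (‖x - y‖ * ((‖x‖ ^ 2)⁻¹ + (‖y‖ ^ 2)⁻¹))) := by gcongr
    _ = _ := by ring

/-! ### Riesz potentials of bounded integrable densities -/

/-- `ρ` is integrable, with `|ρ| ≤ M` almost everywhere and `∫ |ρ| ≤ M`. -/
structure BddDensity (M : ℝ) (ρ : Space3 → ℝ) : Prop where
  integrable : Integrable ρ
  bound : ∀ᵐ x, |ρ x| ≤ M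
  mass : ∫ x, |ρ x| ≤ M

theorem BddDensity.nonneg {M : ℝ} {ρ : Space3 → ℝ} (h : BddDensity M ρ) : 0 ≤ M :=
  (integral_nonneg fun _ => abs_nonneg _).trans h.mass

theorem integrableOn_inv_norm_pow {n : ℕ} (hn : n ≤ 2) (r : ℝ) :
    IntegrableOn (fun x : Space3 => (‖x‖ ^ n)⁻¹) (Metric.ball 0 r) := by
  have h := integrableOn_fun_norm_addHaar (volume : Measure Space3)
    (f := fun y => (y ^ n)⁻¹) (r := r)
  rw [h]
  have hc : IntegrableOn (fun y : ℝ => y ^ (2 - n)) (Ioo 0 r) :=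
    ((continuous_pow _).integrableOn_Icc (a := 0) (b := r)).mono_set Ioo_subset_Icc_self
  refine hc.congr_fun (fun y hy => ?_) measurableSet_Ioo
  have hy' : y ≠ 0 := hy.1.ne'
  rw [finrank_euclideanSpace_fin, smul_eq_mul]
  field_simp
  rw [← pow_add]; congr 1; omega

/-- `∫ |x|⁻ⁿ` over the unit ball, plus one. -/
noncomputable def rieszConst (n : ℕ) : ℝ :=
  (∫ x in Metric.ball (0 : Space3) 1, (‖x‖ ^ n)⁻¹) + 1

theorem rieszConst_pos (n : ℕ) : 0 < rieszConst n := by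
  unfold rieszConst
  have : 0 ≤ ∫ x in Metric.ball (0 : Space3) 1, (‖x‖ ^ n)⁻¹ :=
    integral_nonneg fun _ => by positivity
  linarith

/-- The singularity is integrable: the unit ball around `x` is controlled by the bound on the density,
and its complement by the mass. -/
theorem BddDensity.riesz {M : ℝ} {ρ : Space3 → ℝ} (h : BddDensity M ρ) {n : ℕ} (hn : n ≤ 2)
    (x : Space3) : Integrable (fun y => |ρ y| * (‖x - y‖ ^ n)⁻¹) ∧
      ∫ y, |ρ y| * (‖x - y‖ ^ n)⁻¹ ≤ rieszConst n * M := by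
  set k : Space3 → ℝ := (Metric.ball (0 : Space3) 1).indicator fun z => (‖z‖ ^ n)⁻¹ with hk
  have hkint : Integrable k :=
    (integrable_indicator_iff measurableSet_ball).2 (integrableOn_inv_norm_pow hn 1)
  have hkx : Integrable fun y => k (x - y) := hkint.comp_sub_left x
  have hG : Integrable fun y => M * k (x - y) + |ρ y| := (hkx.const_mul M).add h.integrable.abs
  have hle : ∀ᵐ y, |ρ y| * (‖x - y‖ ^ n)⁻¹ ≤ M * k (x - y) + |ρ y| := by
    filter_upwards [h.bound] with y hy
    by_cases hb : x - y ∈ Metric.ball (0 : Space3) 1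
    · rw [hk, indicator_of_mem hb]
      have : |ρ y| * (‖x - y‖ ^ n)⁻¹ ≤ M * (‖x - y‖ ^ n)⁻¹ := by gcongr
      linarith [abs_nonneg (ρ y)]
    · rw [hk, indicator_of_notMem hb, mul_zero, zero_add]
      rw [mem_ball_zero_iff, not_lt] at hb
      exact mul_le_of_le_one_right (abs_nonneg _) (inv_le_one_of_one_le₀ (one_le_pow₀ hb))
  have hmeas : AEStronglyMeasurable (fun y => |ρ y| * (‖x - y‖ ^ n)⁻¹) volume :=
    h.integrable.abs.aestronglyMeasurable.mul (by fun_prop : Measurable fun y : Space3 =>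
      (‖x - y‖ ^ n)⁻¹).aestronglyMeasurable
  have hint : Integrable fun y => |ρ y| * (‖x - y‖ ^ n)⁻¹ := by
    refine hG.mono' hmeas ?_
    filter_upwards [hle] with y hy
    rwa [Real.norm_of_nonneg (by positivity)]
  refine ⟨hint, (integral_mono_ae hint hG hle).trans ?_⟩
  rw [integral_add (hkx.const_mul M) h.integrable.abs, integral_const_mul,
    integral_sub_left_eq_self k volume x, hk, integral_indicator measurableSet_ball]
  have := h.mass
  unfold rieszConst
  linarith

/-- The velocity `u` of the Stokes flow generated by the density `ρ`. -/
noncomputable def stokesVel (ρ : Space3 → ℝ) (x : Space3) : Space3 :=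
  ∫ y, ρ y • oseen (x - y)

namespace BddDensity

variable {M : ℝ} {ρ : Space3 → ℝ}

theorem integrable_smul_oseen (h : BddDensity M ρ) (x : Space3) :
    Integrable fun y => ρ y • oseen (x - y) := by
  refine (((h.riesz one_le_two x).1).const_mul (2 * oseenConst)).mono'
    (h.integrable.aestronglyMeasurable.smul
      (measurable_oseen.comp (by fun_prop : Measurable fun y => x - y)).aestronglyMeasurable)
    (.of_forall fun y => ?_)
  rw [norm_smul, Real.norm_eq_abs, pow_one]
  have := mul_le_mul_of_nonneg_left (norm_oseen_le (x - y)) (abs_nonneg (ρ y))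
  linarith

theorem norm_stokesVel_le_potential (h : BddDensity M ρ) (x : Space3) :
    ‖stokesVel ρ x‖ ≤ 2 * oseenConst * ∫ y, |ρ y| * ‖x - y‖⁻¹ := by
  have h1 := (h.riesz one_le_two x).1
  simp only [pow_one] at h1
  rw [← integral_const_mul]
  refine norm_integral_le_of_norm_le (h1.const_mul _) (.of_forall fun y => ?_)
  rw [norm_smul, Real.norm_eq_abs]
  have := mul_le_mul_of_nonneg_left (norm_oseen_le (x - y)) (abs_nonneg (ρ y))
  linarith

theorem norm_stokesVel_le (h : BddDensity M ρ) (x : Space3) :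
    ‖stokesVel ρ x‖ ≤ 2 * oseenConst * (rieszConst 1 * M) := by
  refine (h.norm_stokesVel_le_potential x).trans ?_
  have := (h.riesz one_le_two x).2
  simp only [pow_one] at this
  have := oseenConst_pos
  gcongr

theorem norm_stokesVel_sub_le (h : BddDensity M ρ) (x x' : Space3) :
    ‖stokesVel ρ x - stokesVel ρ x'‖ ≤ 6 * oseenConst * (rieszConst 2 * M) * ‖x - x'‖ := by
  have h1 := h.riesz le_rfl x
  have h2 := h.riesz le_rfl x'
  have hκ := oseenConst_pos
  unfold stokesVel
  rw [← integral_sub (h.integrable_smul_oseen x) (h.integrable_smul_oseen x')]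
  refine (norm_integral_le_of_norm_le ((h1.1.add h2.1).const_mul (3 * oseenConst * ‖x - x'‖))
    (.of_forall fun y => ?_)).trans ?_
  · rw [← smul_sub, norm_smul, Real.norm_eq_abs]
    have := mul_le_mul_of_nonneg_left (norm_oseen_sub_le (x - y) (x' - y)) (abs_nonneg (ρ y))
    rw [sub_sub_sub_cancel_right] at this
    simp only [Pi.add_apply]
    linarith
  · rw [integral_const_mul]
    simp only [Pi.add_apply]
    rw [integral_add h1.1 h2.1]
    have := add_le_add h1.2 h2.2
    calc _ ≤ 3 * oseenConst * ‖x - x'‖ * (rieszConst 2 * M + rieszConst 2 * M) := by gcongr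
      _ = _ := by ring

theorem continuous_stokesVel (h : BddDensity M ρ) : Continuous (stokesVel ρ) := by
  refine (LipschitzWith.of_dist_le_mul (K := Real.toNNReal (6 * oseenConst * (rieszConst 2 * M)))
    fun x y => ?_).continuous
  have h1 := oseenConst_pos
  have h2 := rieszConst_pos 2
  have h3 := h.nonneg
  rw [Real.coe_toNNReal _ (by positivity), dist_eq_norm, dist_eq_norm]
  exact h.norm_stokesVel_sub_le x y

theorem stokesVel_apply (h : BddDensity M ρ) (x : Space3) (k : Fin 3) :
    stokesVel ρ x k = ∫ y, ρ y * oseen (x - y) k :=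
  ((EuclideanSpace.proj k : Space3 →L[ℝ] ℝ).integral_comp_comm (h.integrable_smul_oseen x)).symm

theorem stokesVel_sub {M' : ℝ} {ρ' : Space3 → ℝ} (h : BddDensity M ρ) (h' : BddDensity M' ρ')
    (x : Space3) : stokesVel (fun y => ρ y - ρ' y) x = stokesVel ρ x - stokesVel ρ' x := by
  unfold stokesVel
  rw [← integral_sub (h.integrable_smul_oseen x) (h'.integrable_smul_oseen x)]
  simp only [sub_smul]

theorem sub {M' : ℝ} {ρ' : Space3 → ℝ} (h : BddDensity M ρ) (h' : BddDensity M' ρ') :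
    BddDensity (M + M') (fun y => ρ y - ρ' y) where
  integrable := h.integrable.sub h'.integrable
  bound := by
    filter_upwards [h.bound, h'.bound] with x h1 h2
    exact (abs_sub _ _).trans (add_le_add h1 h2)
  mass := by
    refine (integral_mono (h.integrable.sub h'.integrable).abs
      (h.integrable.abs.add h'.integrable.abs) fun x => abs_sub _ _).trans ?_
    simp only [Pi.add_apply]
    rw [integral_add h.integrable.abs h'.integrable.abs]
    exact add_le_add h.mass h'.mass

end BddDensity

theorem BddDensity.tendsto_stokesVel {M : ℝ} {ρ : Space3 → ℝ} (h : BddDensity M ρ) :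
    Tendsto (stokesVel ρ) (cocompact Space3) (𝓝 0) := by
  have hκ := oseenConst_pos
  have hC := rieszConst_pos 2
  have hM := h.nonneg
  -- near the singularity `|z|⁻¹ ≤ δ |z|⁻²`; away from it the kernel is bounded and decays
  have hker : ∀ δ : ℝ, 0 < δ → ∀ z : Space3, ‖z‖⁻¹ ≤ δ * (‖z‖ ^ 2)⁻¹ + (max δ ‖z‖)⁻¹ := by
    intro δ hδ z
    rcases le_total ‖z‖ δ with hz | hz
    · rcases eq_or_ne z 0 with rfl | hz0
      · simp [hδ.le]
      have hz' : 0 < ‖z‖ := norm_pos_iff.2 hz0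
      have : ‖z‖⁻¹ ≤ δ * (‖z‖ ^ 2)⁻¹ := by
        rw [← div_eq_mul_inv, le_div_iff₀ (by positivity)]
        rw [pow_two, inv_mul_cancel_left₀ hz'.ne']; exact hz
      have h2 : 0 ≤ (max δ ‖z‖)⁻¹ := by positivity
      linarith
    · rw [max_eq_right hz]
      have : 0 ≤ δ * (‖z‖ ^ 2)⁻¹ := by positivity
      linarith
  have hfarint : ∀ δ : ℝ, 0 < δ → ∀ x : Space3, Integrable fun y => |ρ y| * (max δ ‖x - y‖)⁻¹ := by
    intro δ hδ x
    refine (h.integrable.abs.mul_const δ⁻¹).mono' (h.integrable.abs.aestronglyMeasurable.mul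
      (by fun_prop : Measurable fun y : Space3 => (max δ ‖x - y‖)⁻¹).aestronglyMeasurable)
      (.of_forall fun y => ?_)
    rw [norm_mul, norm_inv, Real.norm_eq_abs, abs_abs, Real.norm_of_nonneg (by positivity)]
    gcongr; exact le_max_left _ _
  have hfar : ∀ δ : ℝ, 0 < δ → Tendsto (fun x => ∫ y, |ρ y| * (max δ ‖x - y‖)⁻¹)
      (cocompact Space3) (𝓝 0) := by
    intro δ hδ
    have : (cocompact Space3).IsCountablyGenerated := by
      rw [← Metric.cobounded_eq_cocompact, ← comap_norm_atTop]; infer_instance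
    have : Tendsto (fun x => ∫ y, |ρ y| * (max δ ‖x - y‖)⁻¹)
        (cocompact Space3) (𝓝 (∫ y : Space3, (0 : ℝ))) := by
      refine tendsto_integral_filter_of_dominated_convergence (fun y => |ρ y| * δ⁻¹)
        (.of_forall fun x => (hfarint δ hδ x).aestronglyMeasurable)
        (.of_forall fun x => .of_forall fun y => ?_) (h.integrable.abs.mul_const _)
        (.of_forall fun y => ?_)
      · rw [norm_mul, norm_inv, Real.norm_eq_abs, abs_abs, Real.norm_of_nonneg (by positivity)]
        gcongr; exact le_max_left _ _
      · have h1 : Tendsto (fun x : Space3 => ‖x - y‖) (cocompact Space3) atTop :=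
          tendsto_norm_cocompact_atTop.comp
            ((Homeomorph.subRight y).isClosedEmbedding.tendsto_cocompact)
        have h2 : Tendsto (fun x : Space3 => (max δ ‖x - y‖)⁻¹) (cocompact Space3) (𝓝 0) :=
          tendsto_inv_atTop_zero.comp (tendsto_atTop_mono (fun x => le_max_right _ _) h1)
        simpa using h2.const_mul |ρ y|
    simpa using this
  rw [tendsto_zero_iff_norm_tendsto_zero, Metric.tendsto_nhds]
  intro ε hε
  set δ : ℝ := ε / (4 * oseenConst * (rieszConst 2 * M + 1)) with hδ
  have hδ0 : 0 < δ := by positivity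
  filter_upwards [(Metric.tendsto_nhds.1 (hfar δ hδ0)) (ε / (4 * oseenConst)) (by positivity)]
    with x hx
  rw [dist_zero_right, Real.norm_eq_abs] at hx
  rw [dist_zero_right, norm_norm]
  have h2 := h.riesz le_rfl x
  have hpot : ∫ y, |ρ y| * ‖x - y‖⁻¹
      ≤ δ * (rieszConst 2 * M) + ∫ y, |ρ y| * (max δ ‖x - y‖)⁻¹ := by
    have h1 := (h.riesz one_le_two x).1
    simp only [pow_one] at h1
    have hmono := integral_mono h1 ((h2.1.const_mul δ).add (hfarint δ hδ0 x)) (fun y => by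
      have := mul_le_mul_of_nonneg_left (hker δ hδ0 (x - y)) (abs_nonneg (ρ y))
      simp only [Pi.add_apply]; linarith)
    simp only [Pi.add_apply] at hmono
    rw [integral_add (h2.1.const_mul δ) (hfarint δ hδ0 x), integral_const_mul] at hmono
    have := mul_le_mul_of_nonneg_left h2.2 hδ0.le
    linarith
  have hδM : δ * (rieszConst 2 * M) < ε / (4 * oseenConst) := by
    have : δ * (rieszConst 2 * M + 1) = ε / (4 * oseenConst) := by rw [hδ]; field_simp
    linarith
  calc ‖stokesVel ρ x‖ ≤ 2 * oseenConst * ∫ y, |ρ y| * ‖x - y‖⁻¹ :=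
        h.norm_stokesVel_le_potential x
    _ < 2 * oseenConst * (ε / (4 * oseenConst) + ε / (4 * oseenConst)) := by
        have := (abs_lt.1 hx).2
        gcongr
        linarith
    _ = ε := by field_simp; norm_num

/-! ### The Oseen kernel is the fundamental solution -/

theorem volume_ball_real {R : ℝ} (hR : 0 < R) (x : Space3) :
    volume.real (Metric.ball x R) = R ^ 3 * volume.real (Metric.ball (0 : Space3) 1) := by
  rw [Measure.real, Measure.addHaar_ball volume x hR.le, ENNReal.toReal_mul,
    ENNReal.toReal_ofReal (by positivity), finrank_euclideanSpace_fin]; rfl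

/-- A bound, per unit volume of the ball, which does not depend on the radius and which dominates the
limit of vanishing radius. -/
theorem norm_dropVel_le {R : ℝ} (hR : 0 < R) {x : Space3} (hx : x ≠ 0) :
    ‖dropVel R x‖ ≤ R ^ 3 * ‖x‖⁻¹ := by
  have hx' : 0 < ‖x‖ := norm_pos_iff.2 hx
  have hbound : ‖dropVel R x‖ ≤ |dropV R (‖x‖ ^ 2)| + |dropA R (‖x‖ ^ 2)|
      + |dropD R (‖x‖ ^ 2)| * ‖x‖ ^ 2 := by
    unfold dropVel
    refine (norm_sub_le _ _).trans ?_
    rw [norm_smul, norm_smul, norm_e₃, mul_one, norm_mul, Real.norm_eq_abs, Real.norm_eq_abs,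
      Real.norm_eq_abs]
    have h1 := abs_sub (dropV R (‖x‖ ^ 2)) (dropA R (‖x‖ ^ 2))
    have h2 : |dropD R (‖x‖ ^ 2)| * |x 2| * ‖x‖ ≤ |dropD R (‖x‖ ^ 2)| * ‖x‖ * ‖x‖ := by
      gcongr; exact abs_coord_le x 2
    nlinarith
  refine hbound.trans ?_
  rcases le_or_gt (‖x‖ ^ 2) (R ^ 2) with h | h
  · have hxR : ‖x‖ ≤ R := le_of_sq_le_sq h hR.le
    simp only [dropV, dropA, dropD, glue_of_le _ _ h]
    have h1 : |‖x‖ ^ 2 / 6 - R ^ 2 / 2| ≤ R ^ 2 / 2 := by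
      rw [abs_le]; constructor <;> nlinarith [sq_nonneg ‖x‖]
    have h2 : |-R ^ 2 / 6 + ‖x‖ ^ 2 / 30| ≤ R ^ 2 / 6 := by
      rw [abs_le]; constructor <;> nlinarith [sq_nonneg ‖x‖]
    have h3 : |(1 / 15 : ℝ)| * ‖x‖ ^ 2 ≤ R ^ 2 / 15 := by
      rw [abs_of_pos (by norm_num)]; linarith
    have h4 : R ^ 2 ≤ R ^ 3 * ‖x‖⁻¹ := by
      rw [← div_eq_mul_inv, le_div_iff₀ hx']; nlinarith [sq_nonneg R]
    nlinarith [sq_nonneg R]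
  · have hxR : R < ‖x‖ := lt_of_pow_lt_pow_left₀ 2 hx'.le h
    simp only [dropV, dropA, dropD, glue_of_lt _ _ h, invSqrtPow_norm]
    set q := R ^ 3 * ‖x‖⁻¹ with hq
    have hq0 : 0 < q := by positivity
    have h5 : R ^ 5 * (‖x‖ ^ 3)⁻¹ ≤ q := by
      rw [hq, ← div_eq_mul_inv, ← div_eq_mul_inv, div_le_div_iff₀ (by positivity) hx']
      have : R ^ 2 * ‖x‖ ≤ ‖x‖ ^ 2 * ‖x‖ := by gcongr
      nlinarith [pow_pos hR 3]
    have h50 : 0 < R ^ 5 * (‖x‖ ^ 3)⁻¹ := by positivity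
    have h1 : |-R ^ 3 / 3 * (‖x‖ ^ 1)⁻¹| ≤ q / 3 := by
      rw [pow_one, abs_le]; constructor <;> linarith
    have h2 : |-R ^ 3 / 6 * (‖x‖ ^ 1)⁻¹ + R ^ 5 / 30 * (‖x‖ ^ 3)⁻¹| ≤ q / 5 := by
      rw [pow_one, abs_le]; constructor <;> linarith
    have h3 : |R ^ 3 / 6 * (‖x‖ ^ 3)⁻¹ - R ^ 5 / 10 * (‖x‖ ^ 5)⁻¹| * ‖x‖ ^ 2 ≤ 4 / 15 * q := by
      rw [← abs_of_pos (by positivity : 0 < ‖x‖ ^ 2), ← abs_mul]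
      have : (R ^ 3 / 6 * (‖x‖ ^ 3)⁻¹ - R ^ 5 / 10 * (‖x‖ ^ 5)⁻¹) * ‖x‖ ^ 2
          = q / 6 - R ^ 5 * (‖x‖ ^ 3)⁻¹ / 10 := by rw [hq]; field_simp
      rw [this, abs_le]; constructor <;> linarith
    linarith

/-- As the radius tends to `0`, the flow of a ball of unit mass tends to the Oseen kernel. -/
theorem tendsto_dropVel {r : ℕ → ℝ} (hr0 : ∀ n, 0 < r n) (hr : Tendsto r atTop (𝓝 0))
    {x : Space3} (hx : x ≠ 0) :
    Tendsto (fun n => (volume.real (Metric.ball (0 : Space3) (r n)))⁻¹ • dropVel (r n) x) atTop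
      (𝓝 (oseen x)) := by
  have hx' : 0 < ‖x‖ := norm_pos_iff.2 hx
  have hv := volume_unitBall_pos
  have hev : ∀ᶠ n in atTop, r n < ‖x‖ := hr.eventually_lt_const hx'
  have hlim : Tendsto (fun n => (-oseenConst) •
      ((‖x‖⁻¹ + r n ^ 2 * ((1 / 5) * (‖x‖ ^ 3)⁻¹)) • e₃
        + (x 2 * ((‖x‖ ^ 3)⁻¹ - r n ^ 2 * ((3 / 5) * (‖x‖ ^ 5)⁻¹))) • x)) atTop (𝓝 (oseen x)) := by
    have hc : Continuous fun R : ℝ => (-oseenConst) •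
      ((‖x‖⁻¹ + R ^ 2 * ((1 / 5) * (‖x‖ ^ 3)⁻¹)) • e₃
        + (x 2 * ((‖x‖ ^ 3)⁻¹ - R ^ 2 * ((3 / 5) * (‖x‖ ^ 5)⁻¹))) • x) := by fun_prop
    have := (hc.tendsto 0).comp hr
    simpa [oseen, Function.comp_def] using this
  refine hlim.congr' ?_
  filter_upwards [hev] with n hn
  have hn0 := hr0 n
  have h : r n ^ 2 < ‖x‖ ^ 2 := by gcongr
  rw [volume_ball_real hn0]
  unfold dropVel
  simp only [dropV, dropA, dropD, glue_of_lt _ _ h, invSqrtPow_norm]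
  rw [smul_sub, smul_smul, smul_smul, smul_add, smul_smul, smul_smul]
  unfold oseenConst
  have comb : ∀ a b c d : ℝ, a = c → b = -d → a • e₃ + b • x = c • e₃ - d • x := by
    rintro a b c d rfl rfl; rw [neg_smul, sub_eq_add_neg]
  refine comb _ _ _ _ ?_ ?_
  · field_simp; ring
  · field_simp; ring

theorem integrable_oseen_mul {f : Space3 → ℝ} (hf : IsTest f) (k : Fin 3) :
    Integrable fun x => oseen x k * f x := by
  have := volume_unitBall_pos
  refine hf.integrable_mul (u := fun x => oseen x k) ?_
  have hm : Measurable fun x => oseen x k :=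
    (contDiff_coord k).continuous.measurable.comp measurable_oseen
  intro x
  refine ⟨Metric.ball 0 (‖x‖ + 1), Metric.isOpen_ball.mem_nhds (by simp), ?_⟩
  have h1 := (integrableOn_inv_norm_pow (n := 1) one_le_two (‖x‖ + 1)).const_mul (2 * oseenConst)
  refine h1.mono' hm.aestronglyMeasurable (.of_forall fun y => ?_)
  rw [pow_one]
  exact (abs_coord_le _ k).trans (norm_oseen_le y)

theorem tendsto_integral_dropVel {r : ℕ → ℝ} (hr0 : ∀ n, 0 < r n) (hr : Tendsto r atTop (𝓝 0))
    {f : Fin 3 → Space3 → ℝ} (hf : ∀ k, IsTest (f k)) :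
    Tendsto (fun n => (volume.real (Metric.ball (0 : Space3) (r n)))⁻¹
      * ∫ x, ∑ k, dropVel (r n) x k * f k x) atTop (𝓝 (∫ x, ∑ k, oseen x k * f k x)) := by
  have hv := volume_unitBall_pos
  simp only [← integral_const_mul]
  have hnorm : ∀ k, Integrable fun x : Space3 => ‖x‖⁻¹ * |f k x| := by
    intro k
    have hli : LocallyIntegrable (fun x : Space3 => ‖x‖⁻¹) volume := by
      intro x
      refine ⟨Metric.ball 0 (‖x‖ + 1), Metric.isOpen_ball.mem_nhds (by simp), ?_⟩
      simpa using integrableOn_inv_norm_pow (n := 1) one_le_two (‖x‖ + 1)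
    have := ((hf k).integrable_mul hli).abs
    refine this.congr (.of_forall fun x => ?_)
    simp only
    rw [abs_mul, abs_of_nonneg (by positivity : 0 ≤ ‖x‖⁻¹)]
  have hae : ∀ᵐ x : Space3, x ≠ 0 := by simp [ae_iff]
  refine tendsto_integral_of_dominated_convergence
    (fun x => (volume.real (Metric.ball (0 : Space3) 1))⁻¹ * ∑ k, ‖x‖⁻¹ * |f k x|) (fun n => ?_)
    ((integrable_finsetSum _ fun k _ => hnorm k).const_mul _) (fun n => ?_) ?_
  · have h1 := continuous_dropVel (hr0 n)
    have h2 := fun k => (hf k).continuous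
    exact (by fun_prop : Continuous fun x => (volume.real (Metric.ball (0 : Space3) (r n)))⁻¹
      * ∑ k, dropVel (r n) x k * f k x).aestronglyMeasurable
  · filter_upwards [hae] with x hx
    have hn0 := hr0 n
    rw [norm_mul, Real.norm_of_nonneg (by positivity), volume_ball_real hn0, mul_inv,
      mul_comm (r n ^ 3)⁻¹, mul_assoc]
    refine mul_le_mul_of_nonneg_left ?_ (by positivity)
    rw [inv_mul_le_iff₀ (by positivity), Finset.mul_sum]
    refine (norm_sum_le _ _).trans (Finset.sum_le_sum fun k _ => ?_)
    rw [norm_mul, Real.norm_eq_abs, Real.norm_eq_abs, ← mul_assoc]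
    gcongr
    exact (abs_coord_le _ k).trans (norm_dropVel_le hn0 hx)
  · filter_upwards [hae] with x hx
    have h1 := tendsto_dropVel hr0 hr hx
    have h2 : Continuous fun v : Space3 => ∑ k, v k * f k x := by fun_prop
    have h3 := (h2.tendsto (oseen x)).comp h1
    refine h3.congr fun n => ?_
    simp only [Function.comp, PiLp.smul_apply, smul_eq_mul, Finset.mul_sum, mul_assoc]

theorem tendsto_ball_average {r : ℕ → ℝ} (hr0 : ∀ n, 0 < r n) (hr : Tendsto r atTop (𝓝 0))
    {f : Space3 → ℝ} (hf : IsTest f) :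
    Tendsto (fun n => (volume.real (Metric.ball (0 : Space3) (r n)))⁻¹
      * ∫ x, (Metric.ball (0 : Space3) (r n)).indicator (fun _ => 1) x * f x) atTop (𝓝 (f 0)) := by
  obtain ⟨D, hD⟩ := ContDiff.lipschitzWith_of_hasCompactSupport hf.supp hf.smooth (by simp)
  rw [tendsto_iff_dist_tendsto_zero]
  have hlim : Tendsto (fun n => (D : ℝ) * r n) atTop (𝓝 0) := by simpa using hr.const_mul (D : ℝ)
  refine squeeze_zero (fun _ => dist_nonneg) (fun n => ?_) hlim
  have hn0 := hr0 n
  have hvol : 0 < volume.real (Metric.ball (0 : Space3) (r n)) := by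
    rw [volume_ball_real hn0]; have := volume_unitBall_pos; positivity
  have e1 : ∫ x, (Metric.ball (0 : Space3) (r n)).indicator (fun _ => 1) x * f x
      = ∫ x in Metric.ball (0 : Space3) (r n), f x := by
    rw [← integral_indicator measurableSet_ball]
    congr 1; funext x
    by_cases hx : x ∈ Metric.ball (0 : Space3) (r n) <;> simp [hx]
  have e2 : f 0 = (volume.real (Metric.ball (0 : Space3) (r n)))⁻¹
      * ∫ x in Metric.ball (0 : Space3) (r n), f 0 := by
    rw [setIntegral_const, smul_eq_mul]; field_simp
  have hfin : volume (Metric.ball (0 : Space3) (r n)) < ⊤ := measure_ball_lt_top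
  rw [Real.dist_eq, e1]
  conv_lhs => rw [e2]
  rw [← mul_sub, ← integral_sub hf.integrable.integrableOn (integrableOn_const hfin.ne), abs_mul,
    abs_of_pos (by positivity), inv_mul_le_iff₀ hvol, mul_comm]
  rw [← Real.norm_eq_abs]
  refine norm_setIntegral_le_of_norm_le_const hfin fun x hx => ?_
  have := hD.dist_le_mul x 0
  rw [dist_eq_norm] at this
  refine this.trans ?_
  have := (Metric.mem_ball.1 hx).le
  gcongr

/-- The Oseen kernel solves the Stokes problem with a Dirac mass, tested against divergence-free
fields. -/
theorem oseen_momentum {ψ : Fin 3 → Space3 → ℝ} (hψ : ∀ k, IsTest (ψ k))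
    (hdiv : ∀ x, ∑ i, pd i (ψ i) x = 0) :
    ∫ x, ∑ k, oseen x k * lap (ψ k) x = ψ 2 0 := by
  have hr0 : ∀ n : ℕ, (0 : ℝ) < 1 / ((n : ℝ) + 1) := fun n => by positivity
  have hr := tendsto_one_div_add_atTop_nhds_zero_nat (𝕜 := ℝ)
  refine tendsto_nhds_unique (tendsto_integral_dropVel hr0 hr fun k => (hψ k).lap) ?_
  refine (tendsto_ball_average hr0 hr (hψ 2)).congr fun n => ?_
  have := dropVel_momentum (hr0 n) hψ
  simp only [hdiv, mul_zero, integral_zero, sub_zero, neg_inj] at this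
  rw [this]

theorem oseen_incompressible {φ : Space3 → ℝ} (hφ : IsTest φ) :
    ∫ x, ∑ k, oseen x k * pd k φ x = 0 := by
  have hr0 : ∀ n : ℕ, (0 : ℝ) < 1 / ((n : ℝ) + 1) := fun n => by positivity
  have hr := tendsto_one_div_add_atTop_nhds_zero_nat (𝕜 := ℝ)
  refine tendsto_nhds_unique (tendsto_integral_dropVel hr0 hr fun k => hφ.pd k) ?_
  refine tendsto_const_nhds.congr fun n => ?_
  have := dropVel_incompressible (hr0 n) hφ
  simp only [fderiv_eq_sum_pd] at this
  rw [this, mul_zero]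

namespace BddDensity

variable {M : ℝ} {ρ : Space3 → ℝ}

/-- Fubini's theorem, which reduces weak equations for the potential to those for the kernel. -/
theorem integral_stokesVel_mul (h : BddDensity M ρ) {f : Fin 3 → Space3 → ℝ}
    (hf : ∀ k, IsTest (f k)) :
    ∫ x, ∑ k, stokesVel ρ x k * f k x
      = ∫ y, ρ y * ∫ x, ∑ k, oseen x k * f k (x + y) := by
  have hmeas : ∀ k, AEStronglyMeasurable (fun z : Space3 × Space3 =>
      ρ z.2 * oseen (z.1 - z.2) k * f k z.1) (volume.prod volume) := by
    intro k
    have h1 : Measurable fun z : Space3 × Space3 => oseen (z.1 - z.2) k :=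
      (contDiff_coord k).continuous.measurable.comp (measurable_oseen.comp (by fun_prop))
    exact (h.integrable.aestronglyMeasurable.comp_snd.mul h1.aestronglyMeasurable).mul
      ((hf k).continuous.comp continuous_fst).aestronglyMeasurable
  have hint1 : ∀ (k) (x : Space3), Integrable fun y => ρ y * oseen (x - y) k := fun k x =>
    (EuclideanSpace.proj k : Space3 →L[ℝ] ℝ).integrable_comp (h.integrable_smul_oseen x)
  have hprod : ∀ k, Integrable (fun z : Space3 × Space3 =>
      ρ z.2 * oseen (z.1 - z.2) k * f k z.1) (volume.prod volume) := by
    intro k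
    rw [integrable_prod_iff (hmeas k)]
    refine ⟨.of_forall fun x => (hint1 k x).mul_const (f k x), ?_⟩
    refine ((hf k).integrable.abs.const_mul (2 * oseenConst * (rieszConst 1 * M))).mono'
      (hmeas k).norm.integral_prod_right' (.of_forall fun x => ?_)
    have h1 := h.riesz one_le_two x
    rw [Real.norm_of_nonneg (integral_nonneg fun _ => norm_nonneg _)]
    simp only [norm_mul, Real.norm_eq_abs]
    rw [integral_mul_const]
    refine mul_le_mul_of_nonneg_right ?_ (abs_nonneg _)
    have hκ := oseenConst_pos
    refine le_trans ?_ (mul_le_mul_of_nonneg_left h1.2 (by positivity))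
    rw [← integral_const_mul]
    refine integral_mono ?_ (h1.1.const_mul _) fun y => ?_
    · simpa only [abs_mul] using (hint1 k x).abs
    · have := mul_le_mul_of_nonneg_left ((abs_coord_le _ k).trans (norm_oseen_le (x - y)))
        (abs_nonneg (ρ y))
      simp only [pow_one]
      linarith
  have hcomp : ∀ k, Integrable fun x => stokesVel ρ x k * f k x := by
    intro k
    refine ((hprod k).integral_prod_left).congr (.of_forall fun x => ?_)
    simp only
    rw [integral_mul_const, h.stokesVel_apply]
  rw [integral_finsetSum _ fun k _ => hcomp k]
  have hk : ∀ k, ∫ x, stokesVel ρ x k * f k x = ∫ y, ρ y * ∫ x, oseen x k * f k (x + y) := by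
    intro k
    have e1 : ∀ x, stokesVel ρ x k * f k x = ∫ y, ρ y * oseen (x - y) k * f k x := by
      intro x; rw [integral_mul_const, h.stokesVel_apply]
    simp only [e1]
    rw [integral_integral_swap (hprod k)]
    congr 1; funext y
    rw [← integral_const_mul, ← integral_add_right_eq_self _ y]
    congr 1; funext x
    rw [add_sub_cancel_right]; ring
  have hsw : ∀ k, Integrable fun y => ρ y * ∫ x, oseen x k * f k (x + y) := by
    intro k
    refine ((hprod k).integral_prod_right).congr (.of_forall fun y => ?_)
    simp only
    rw [← integral_const_mul, ← integral_add_right_eq_self _ y]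
    congr 1; funext x
    rw [add_sub_cancel_right]; ring
  simp only [hk]
  rw [← integral_finsetSum _ fun k _ => hsw k]
  congr 1; funext y
  rw [← Finset.mul_sum, integral_finsetSum _ fun k _ =>
    integrable_oseen_mul ((hf k).comp_add_right y) k]

theorem stokesVel_momentum (h : BddDensity M ρ) {ψ : Fin 3 → Space3 → ℝ} (hψ : ∀ k, IsTest (ψ k))
    (hdiv : ∀ x, ∑ i, pd i (ψ i) x = 0) :
    ∫ x, ∑ k, stokesVel ρ x k * lap (ψ k) x = ∫ y, ρ y * ψ 2 y := by
  rw [h.integral_stokesVel_mul fun k => (hψ k).lap]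
  congr 1; funext y
  have := oseen_momentum (ψ := fun k x => ψ k (x + y)) (fun k => (hψ k).comp_add_right y)
    (fun x => by simpa only [pd_comp_add_right] using hdiv (x + y))
  simp only [lap_comp_add_right, zero_add] at this
  rw [this]

theorem stokesVel_incompressible (h : BddDensity M ρ) {φ : Space3 → ℝ} (hφ : IsTest φ) :
    ∫ x, fderiv ℝ φ x (stokesVel ρ x) = 0 := by
  simp only [fderiv_eq_sum_pd]
  rw [h.integral_stokesVel_mul fun k => hφ.pd k]
  have : ∀ y, ∫ x, ∑ k, oseen x k * pd k φ (x + y) = 0 := by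
    intro y
    have := oseen_incompressible (hφ.comp_add_right y)
    simpa only [pd_comp_add_right] using this
  simp [this]

end BddDensity

/-! ### Uniqueness for the Stokes problem -/

theorem deriv_deriv_nonpos_of_isLocalMax {g : ℝ → ℝ} {t : ℝ} (h : IsLocalMax g t)
    (hc : ContinuousAt g t) : deriv (deriv g) t ≤ 0 := by
  by_contra! hpos
  have hmin := isLocalMin_of_deriv_deriv_pos hpos h.deriv_eq_zero hc
  have hconst : g =ᶠ[𝓝 t] fun _ => g t := by
    filter_upwards [h, hmin] with s h1 h2 using le_antisymm h1 h2
  have h2 := hconst.deriv.deriv_eq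
  simp only [deriv_const'] at h2
  rw [h2] at hpos
  simp at hpos

theorem hasDerivAt_line {f : Space3 → ℝ} (hf : Differentiable ℝ f) (x : Space3) (i : Fin 3)
    (t : ℝ) : HasDerivAt (fun s : ℝ => f (x + s • (EuclideanSpace.single i 1 : Space3)))
      (pd i f (x + t • (EuclideanSpace.single i 1 : Space3))) t := by
  have h1 : HasDerivAt (fun s : ℝ => x + s • (EuclideanSpace.single i 1 : Space3))
      (EuclideanSpace.single i 1) t := by
    simpa using ((hasDerivAt_id t).smul_const (EuclideanSpace.single i 1 : Space3)).const_add x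
  exact (hf _).hasFDerivAt.comp_hasDerivAt t h1

/-- Maximum principle: a harmonic function which tends to zero at infinity is nonpositive. -/
theorem nonpos_of_harmonic {H : Space3 → ℝ} (hH : ContDiff ℝ ∞ H) (hlap : ∀ x, lap H x = 0)
    (hlim : Tendsto H (cocompact Space3) (𝓝 0)) (x₀ : Space3) : H x₀ ≤ 0 := by
  by_contra! hm
  set m := H x₀
  obtain ⟨L, hL⟩ : ∃ L : ℝ, ∀ x : Space3, L ≤ ‖x‖ → H x < m / 2 := by
    have h1 := hlim.eventually_lt_const (half_pos hm)
    rw [← Metric.cobounded_eq_cocompact, ← comap_norm_atTop, eventually_comap] at h1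
    obtain ⟨L, hL⟩ := eventually_atTop.1 h1
    exact ⟨L, fun x hx => hL _ hx x rfl⟩
  set L' := max L (‖x₀‖ + 1)
  have hL'0 : 0 < L' := lt_of_lt_of_le (by positivity) (le_max_right _ _)
  -- a small multiple of `|x|²` makes the function strictly subharmonic
  set δ := m / (4 * L' ^ 2) with hδ
  have hδ0 : 0 < δ := by positivity
  set G : Space3 → ℝ := fun x => H x + δ * ‖x‖ ^ 2 with hG
  have hGc : Continuous G := hH.continuous.add (by fun_prop)
  obtain ⟨x₁, hx₁, hmax⟩ := (isCompact_closedBall (0 : Space3) L').exists_isMaxOn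
    ⟨0, by simp [hL'0.le]⟩ hGc.continuousOn
  have hx₀ : x₀ ∈ Metric.closedBall (0 : Space3) L' := by
    rw [mem_closedBall_zero_iff]; linarith [le_max_right L (‖x₀‖ + 1)]
  have hge : m ≤ G x₁ := by
    refine le_trans ?_ (hmax hx₀)
    have : 0 ≤ δ * ‖x₀‖ ^ 2 := by positivity
    simp only [hG]; linarith
  have hint : ‖x₁‖ < L' := by
    refine lt_of_le_of_ne (mem_closedBall_zero_iff.1 hx₁) fun heq => ?_
    have h1 := hL x₁ (heq ▸ le_max_left _ _)
    have h2 : δ * ‖x₁‖ ^ 2 = m / 4 := by rw [heq, hδ]; field_simp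
    simp only [hG] at hge
    linarith
  have hloc : IsLocalMax G x₁ :=
    hmax.isLocalMax (mem_of_superset (Metric.isOpen_ball.mem_nhds (mem_ball_zero_iff.2 hint))
      Metric.ball_subset_closedBall)
  have hsec : ∀ i : Fin 3, pd i (pd i H) x₁ + 2 * δ ≤ 0 := by
    intro i
    set e : Space3 := EuclideanSpace.single i 1
    have hcurve : Continuous fun s : ℝ => x₁ + s • e := by fun_prop
    have hl : IsLocalMax (fun s : ℝ => G (x₁ + s • e)) 0 := by
      have := hcurve.continuousAt (x := 0)
      refine IsLocalMax.comp_continuous (f := G) (g := fun s : ℝ => x₁ + s • e) ?_ this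
      simpa using hloc
    have hd1 : deriv (fun s : ℝ => G (x₁ + s • e))
        = fun s => pd i H (x₁ + s • e) + δ * (2 * x₁ i + 2 * s) := by
      funext s
      have h1 := hasDerivAt_line (hH.differentiable (by simp)) x₁ i s
      have h2 : HasDerivAt (fun s : ℝ => ‖x₁ + s • e‖ ^ 2) (2 * x₁ i + 2 * s) s := by
        have hexp : (fun s : ℝ => ‖x₁ + s • e‖ ^ 2) = fun s => ‖x₁‖ ^ 2 + 2 * (s * x₁ i) + s ^ 2 := by
          funext t
          rw [norm_add_sq_real, norm_smul, inner_smul_right, EuclideanSpace.inner_single_right]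
          simp [e]
        rw [hexp]
        have h := ((((hasDerivAt_id s).mul_const (x₁ i)).const_mul 2).const_add (‖x₁‖ ^ 2)).add
          (hasDerivAt_pow 2 s)
        convert! h using 1
        simp
      exact (h1.add (h2.const_mul δ)).deriv
    have hd2 : deriv (deriv (fun s : ℝ => G (x₁ + s • e))) 0 = pd i (pd i H) x₁ + 2 * δ := by
      rw [hd1]
      have h1 := hasDerivAt_line ((contDiff_pd hH i).differentiable (by simp)) x₁ i 0
      have h2 : HasDerivAt (fun s : ℝ => δ * (2 * x₁ i + 2 * s)) (δ * 2) 0 := by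
        simpa using (((hasDerivAt_id (0 : ℝ)).const_mul 2).const_add (2 * x₁ i)).const_mul δ
      have h3 := (h1.add h2).deriv
      simp only [zero_smul, add_zero] at h3
      rw [mul_comm 2 δ, ← h3]
      rfl
    rw [← hd2]
    exact deriv_deriv_nonpos_of_isLocalMax hl (hGc.comp hcurve).continuousAt
  have hsum := hlap x₁
  unfold lap at hsum
  simp only [Fin.sum_univ_three] at hsum
  have h0 := hsec 0
  have h1 := hsec 1
  have h2 := hsec 2
  linarith

theorem eq_zero_of_harmonic {H : Space3 → ℝ} (hH : ContDiff ℝ ∞ H) (hlap : ∀ x, lap H x = 0)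
    (hlim : Tendsto H (cocompact Space3) (𝓝 0)) (x : Space3) : H x = 0 := by
  refine le_antisymm (nonpos_of_harmonic hH hlap hlim x) ?_
  have hpd : ∀ (i : Fin 3) (f : Space3 → ℝ), pd i (fun y => -f y) = fun y => -pd i f y := by
    intro i f; funext y; unfold pd; rw [fderiv_fun_neg]; rfl
  have := nonpos_of_harmonic hH.neg (fun y => by
    have h := hlap y
    unfold lap at h ⊢
    simp only [hpd, Finset.sum_neg_distrib, h, neg_zero]) (by simpa using hlim.neg) x
  linarith

/-- The convolution of a locally integrable function with a test function. -/
noncomputable def smear (z φ : Space3 → ℝ) (x : Space3) : ℝ := ∫ y, z y * φ (x - y)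

theorem smear_eq_convolution (z φ : Space3 → ℝ) :
    smear z φ = convolution z φ (ContinuousLinearMap.mul ℝ ℝ) volume := rfl

theorem contDiff_smear {z φ : Space3 → ℝ} (hz : LocallyIntegrable z volume) (hφ : IsTest φ) :
    ContDiff ℝ ∞ (smear z φ) := by
  rw [smear_eq_convolution]
  exact hφ.supp.contDiff_convolution_right _ hz hφ.smooth

theorem fderiv_smear {z φ : Space3 → ℝ} (hz : LocallyIntegrable z volume) (hφ : IsTest φ)
    (x v : Space3) : fderiv ℝ (smear z φ) x v = ∫ y, z y * fderiv ℝ φ (x - y) v := by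
  rw [smear_eq_convolution]
  have h := hφ.supp.hasFDerivAt_convolution_right (ContinuousLinearMap.mul ℝ ℝ) hz
    (hφ.smooth.of_le (by simp)) x
  rw [h.fderiv, convolution_precompR_apply (ContinuousLinearMap.mul ℝ ℝ) hz
    (hφ.supp.fderiv (𝕜 := ℝ)) (hφ.smooth.continuous_fderiv (by simp))]
  rfl

theorem pd_smear {z φ : Space3 → ℝ} (hz : LocallyIntegrable z volume) (hφ : IsTest φ)
    (i : Fin 3) : pd i (smear z φ) = smear z (pd i φ) := by
  funext x
  exact fderiv_smear hz hφ x _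

theorem lap_smear {z φ : Space3 → ℝ} (hz : LocallyIntegrable z volume) (hφ : IsTest φ) :
    lap (smear z φ) = smear z (lap φ) := by
  funext x
  unfold lap
  simp only [pd_smear hz hφ, pd_smear hz (hφ.pd _)]
  unfold smear
  simp only [Finset.mul_sum]
  rw [integral_finsetSum]
  intro i _
  have := (((hφ.pd i).pd i).comp_sub_left x).integrable_mul hz
  exact this

theorem tendsto_smear {z φ : Space3 → ℝ} (hφ : IsTest φ)
    (hz0 : Tendsto z (cocompact Space3 ⊓ ae volume) (𝓝 0)) :
    Tendsto (smear z φ) (cocompact Space3) (𝓝 0) := by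
  obtain ⟨r, hr0, hr⟩ := hφ.exists_radius
  rw [Metric.tendsto_nhds]
  intro ε hε
  set I := ∫ y, |φ y| with hI
  have hI0 : 0 ≤ I := integral_nonneg fun _ => abs_nonneg _
  set δ := ε / (I + 1) with hδ
  have hδ0 : 0 < δ := by positivity
  have h1 := (Metric.tendsto_nhds.1 hz0) δ hδ0
  obtain ⟨s, hs, t, ht, hst⟩ := eventually_iff.1 h1 |> mem_inf_iff.1
  have hs' : ∀ᶠ x in cocompact Space3, x ∈ s := hs
  rw [← Metric.cobounded_eq_cocompact, ← comap_norm_atTop, eventually_comap] at hs'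
  obtain ⟨L, hL⟩ := eventually_atTop.1 hs'
  have hz : ∀ᵐ y : Space3, L ≤ ‖y‖ → |z y| ≤ δ := by
    filter_upwards [ht] with y hy hLy
    have : y ∈ s ∩ t := ⟨hL _ hLy y rfl, hy⟩
    rw [← hst] at this
    have h2 : dist (z y) 0 < δ := this
    rw [dist_zero_right, Real.norm_eq_abs] at h2
    exact h2.le
  have hcob : ∀ᶠ x in cocompact Space3, L + r ≤ ‖x‖ :=
    tendsto_norm_cocompact_atTop.eventually_ge_atTop _
  filter_upwards [hcob] with x hx
  rw [dist_zero_right]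
  have hint : Integrable fun y => δ * |φ (x - y)| := (hφ.integrable.comp_sub_left x).abs.const_mul δ
  have hle : ‖smear z φ x‖ ≤ ∫ y, δ * |φ (x - y)| := by
    refine norm_integral_le_of_norm_le hint ?_
    filter_upwards [hz] with y hy
    rw [norm_mul, Real.norm_eq_abs, Real.norm_eq_abs]
    rcases le_or_gt r ‖x - y‖ with h | h
    · simp [hr _ h]
    · refine mul_le_mul_of_nonneg_right (hy ?_) (abs_nonneg _)
      have := norm_sub_norm_le x y
      linarith
  refine hle.trans_lt ?_
  rw [integral_const_mul, integral_sub_left_eq_self (fun y => |φ y|) volume x, ← hI, hδ,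
    div_mul_eq_mul_div, div_lt_iff₀ (by positivity)]
  nlinarith

theorem lap_comp_sub_left {f : Space3 → ℝ} (hf : IsTest f) (x y : Space3) :
    lap (fun z => f (x - z)) y = lap f (x - y) := by
  unfold lap
  refine Finset.sum_congr rfl fun i _ => ?_
  have h1 : pd i (fun z => f (x - z)) = fun z => -pd i f (x - z) := by
    funext z; exact pd_comp_sub_left hf.differentiable i x z
  have h2 : pd i (fun z => -pd i f (x - z)) y = -pd i (fun z => pd i f (x - z)) y := by
    unfold pd; rw [fderiv_fun_neg]; rfl
  rw [h1, h2, pd_comp_sub_left (hf.pd i).differentiable, neg_neg]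

/-- A biharmonic distribution given by a locally integrable function tending to zero at infinity
vanishes: its mollifications are smooth and biharmonic, so the maximum principle applies to their
Laplacians, and then to themselves. -/
theorem ae_eq_zero_of_biharmonic {z : Space3 → ℝ} (hz : LocallyIntegrable z volume)
    (hz0 : Tendsto z (cocompact Space3 ⊓ ae volume) (𝓝 0))
    (hbi : ∀ f, IsTest f → ∫ x, z x * lap (lap f) x = 0) : ∀ᵐ x, z x = 0 := by
  refine ae_eq_zero_of_integral_contDiff_smul_eq_zero hz fun g hg hgs => ?_
  have hφ : IsTest fun y => g (0 - y) := IsTest.comp_sub_left ⟨hg, hgs⟩ 0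
  set φ : Space3 → ℝ := fun y => g (0 - y)
  have h2 : ∀ x, lap (smear z (lap φ)) x = 0 := by
    intro x
    rw [lap_smear hz hφ.lap]
    have := hbi _ (hφ.comp_sub_left x)
    have h3 : lap (fun y => φ (x - y)) = fun y => lap φ (x - y) := by
      funext y; exact lap_comp_sub_left hφ x y
    rw [h3] at this
    simp only [lap_comp_sub_left hφ.lap] at this
    exact this
  have h1 : ∀ x, lap (smear z φ) x = 0 := by
    intro x
    rw [lap_smear hz hφ]
    exact eq_zero_of_harmonic (contDiff_smear hz hφ.lap) h2 (tendsto_smear hφ.lap hz0) x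
  have h0 := eq_zero_of_harmonic (contDiff_smear hz hφ) h1 (tendsto_smear hφ hz0) 0
  rw [← h0]
  unfold smear
  congr 1; funext y
  simp [φ, mul_comm]

/-- A weak solution of the homogeneous Stokes problem which vanishes at infinity is zero: testing with
the divergence-free fields `Δf eⱼ - ∇∂ⱼf` shows that its components are biharmonic. -/
theorem ae_eq_zero_of_homogeneous_stokes {z : Space3 → Space3} (hz : LocallyIntegrable z volume)
    (hz0 : Tendsto z (cocompact Space3 ⊓ ae volume) (𝓝 0))
    (hmom : ∀ ψ : Fin 3 → Space3 → ℝ, (∀ k, IsTest (ψ k)) → (∀ x, ∑ i, pd i (ψ i) x = 0) →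
      ∫ x, ∑ k, z x k * lap (ψ k) x = 0)
    (hinc : ∀ φ, IsTest φ → ∫ x, fderiv ℝ φ x (z x) = 0) : ∀ᵐ x, z x = 0 := by
  have hzj : ∀ j, LocallyIntegrable (fun x => z x j) volume := fun j x =>
    let ⟨s, hs, hi⟩ := hz x
    ⟨s, hs, (EuclideanSpace.proj j : Space3 →L[ℝ] ℝ).integrable_comp hi⟩
  have hcomp : ∀ j : Fin 3, ∀ᵐ x, z x j = 0 := by
    intro j
    refine ae_eq_zero_of_biharmonic (hzj j) ?_ fun f hf => ?_
    · have : Continuous fun v : Space3 => v j := by fun_prop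
      simpa [Function.comp_def] using (this.tendsto 0).comp hz0
    -- the divergence-free field `Δf eⱼ - ∇∂ⱼf`
    set ψ : Fin 3 → Space3 → ℝ := fun k x => (if k = j then 1 else 0) * lap f x - pd k (pd j f) x
    have hψ : ∀ k, IsTest (ψ k) := fun k => (hf.lap.const_mul _).sub ((hf.pd j).pd k)
    have hdiv : ∀ x, ∑ i, pd i (ψ i) x = 0 := by
      intro x
      have : ∀ i, pd i (ψ i) x = (if i = j then 1 else 0) * pd i (lap f) x
          - pd i (pd i (pd j f)) x := by
        intro i
        rw [pd_sub (hf.lap.const_mul _).differentiable ((hf.pd j).pd i).differentiable,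
          pd_const_mul hf.lap.differentiable]
      simp only [this, Finset.sum_sub_distrib, ite_mul, one_mul, zero_mul, Finset.sum_ite_eq',
        Finset.mem_univ, if_true]
      rw [← lap_pd hf j]
      exact sub_self _
    have hlap : ∀ k x, lap (ψ k) x = (if k = j then 1 else 0) * lap (lap f) x
        - pd k (pd j (lap f)) x := by
      intro k x
      have h1 : ∀ i, pd i (ψ k) = fun x => (if k = j then 1 else 0) * pd i (lap f) x
          - pd i (pd k (pd j f)) x := by
        intro i; funext y
        rw [pd_sub (hf.lap.const_mul _).differentiable ((hf.pd j).pd k).differentiable,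
          pd_const_mul hf.lap.differentiable]
      rw [← lap_pd hf j, ← lap_pd (hf.pd j) k]
      unfold lap
      rw [Finset.mul_sum, ← Finset.sum_sub_distrib]
      refine Finset.sum_congr rfl fun i _ => ?_
      rw [h1, pd_sub ((hf.lap.pd i).const_mul _).differentiable
        (((hf.pd j).pd k).pd i).differentiable, pd_const_mul (hf.lap.pd i).differentiable]
      rfl
    have h1 := hmom ψ hψ hdiv
    have h2 := hinc _ (hf.lap.pd j)
    simp only [fderiv_eq_sum_pd] at h2
    have h3 : ∀ x, ∑ k, z x k * lap (ψ k) x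
        = z x j * lap (lap f) x - ∑ k, z x k * pd k (pd j (lap f)) x := by
      intro x
      simp only [hlap, mul_sub, Finset.sum_sub_distrib]
      congr 1
      simp
    simp only [h3] at h1
    rw [integral_sub (hf.lap.lap.integrable_mul (hzj j)) (integrable_finsetSum _ fun k _ =>
      ((hf.lap.pd j).pd k).integrable_mul (hzj k)), h2, sub_zero] at h1
    exact h1
  filter_upwards [hcomp 0, hcomp 1, hcomp 2] with x h0 h1 h2
  ext k
  fin_cases k
  · exact h0
  · exact h1
  · exact h2

/-- The velocity of a solution of the Stokes problem is the Oseen potential of its density. -/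
theorem IsStokesSolution.velocity_eq {ρ : Space3 → ℝ} {u : Space3 → Space3} {p : Space3 → ℝ}
    (hs : IsStokesSolution ρ u p) {M : ℝ} (hρ : BddDensity M ρ) :
    ∀ᵐ x, u x = stokesVel ρ x := by
  have hK : LocallyIntegrable (stokesVel ρ) volume := hρ.continuous_stokesVel.locallyIntegrable
  have hu := hs.locallyIntegrable_velocity
  have hcoord : ∀ {v : Space3 → Space3}, LocallyIntegrable v volume →
      ∀ j, LocallyIntegrable (fun x => v x j) volume := fun hv j x =>
    let ⟨s, hs, hi⟩ := hv x
    ⟨s, hs, (EuclideanSpace.proj j : Space3 →L[ℝ] ℝ).integrable_comp hi⟩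
  have := ae_eq_zero_of_homogeneous_stokes (z := fun x => u x - stokesVel ρ x) (hu.sub hK) ?_ ?_ ?_
  · filter_upwards [this] with x hx using sub_eq_zero.1 hx
  · simpa using hs.tendsto_zero.sub (hρ.tendsto_stokesVel.mono_left inf_le_left)
  · intro ψ hψ hdiv
    have h1 := hs.momentum_coord hψ
    simp only [hdiv, mul_zero, integral_zero, sub_zero, neg_inj] at h1
    have h2 := hρ.stokesVel_momentum hψ hdiv
    simp only [PiLp.sub_apply, sub_mul, Finset.sum_sub_distrib]
    rw [integral_sub (integrable_finsetSum _ fun k _ => (hψ k).lap.integrable_mul (hcoord hu k))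
      (integrable_finsetSum _ fun k _ => (hψ k).lap.integrable_mul (hcoord hK k)), h1, h2, sub_self]
  · intro φ hφ
    have h1 := hs.incompressible_fderiv hφ
    have h2 := hρ.stokesVel_incompressible hφ
    simp only [fderiv_eq_sum_pd] at h1 h2 ⊢
    simp only [PiLp.sub_apply, sub_mul, Finset.sum_sub_distrib]
    rw [integral_sub (integrable_finsetSum _ fun k _ => (hφ.pd k).integrable_mul (hcoord hu k))
      (integrable_finsetSum _ fun k _ => (hφ.pd k).integrable_mul (hcoord hK k)), h1, h2, sub_self]

/-! ### The translating ball is a solution -/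

/-- The volume of the ball of radius `R`. -/
noncomputable def ballVol (R : ℝ) : ℝ := volume.real (Metric.ball (0 : Space3) R)

/-- The velocity of the Stokes flow generated by `ballDensity R`. -/
noncomputable def ballVel (R : ℝ) (x : Space3) : Space3 := (ballVol R)⁻¹ • dropVel R x

/-- The pressure of the Stokes flow generated by `ballDensity R`. -/
noncomputable def ballPressure (R : ℝ) (x : Space3) : ℝ := (ballVol R)⁻¹ * dropPressure R x

/-- The velocity at which the ball of radius `R` falls. -/
noncomputable def fallVel (R : ℝ) : Space3 := (-(4 / 15) * R ^ 2 * (ballVol R)⁻¹) • e₃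

theorem ballVol_pos {R : ℝ} (hR : 0 < R) : 0 < ballVol R := by
  have := volume_unitBall_pos
  unfold ballVol; rw [volume_ball_real hR]; positivity

theorem ballDensity_eq (R : ℝ) (x : Space3) : ballDensity R x
    = (ballVol R)⁻¹ * (Metric.ball (0 : Space3) R).indicator (fun _ => 1) x := by
  unfold ballDensity ballVol
  by_cases hx : x ∈ Metric.ball (0 : Space3) R <;> simp [hx]

theorem ballDensity_of_norm_lt {R : ℝ} {x : Space3} (hx : ‖x‖ < R) :
    ballDensity R x = (ballVol R)⁻¹ := by
  rw [ballDensity_eq, indicator_of_mem (by simpa using hx), mul_one]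

theorem ballDensity_of_le_norm {R : ℝ} {x : Space3} (hx : R ≤ ‖x‖) : ballDensity R x = 0 := by
  rw [ballDensity_eq, indicator_of_notMem (by simpa using hx), mul_zero]

theorem measurable_ballDensity (R : ℝ) : Measurable (ballDensity R) :=
  measurable_const.indicator measurableSet_ball

theorem ballDensity_nonneg {R : ℝ} (hR : 0 < R) (x : Space3) : 0 ≤ ballDensity R x := by
  have := ballVol_pos hR
  rw [ballDensity_eq]
  refine mul_nonneg (by positivity) (indicator_nonneg (fun _ _ => zero_le_one) _)

theorem ballDensity_le {R : ℝ} (hR : 0 < R) (x : Space3) : ballDensity R x ≤ (ballVol R)⁻¹ := by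
  have := ballVol_pos hR
  rcases lt_or_ge ‖x‖ R with h | h
  · rw [ballDensity_of_norm_lt h]
  · rw [ballDensity_of_le_norm h]; positivity

theorem integrable_ballDensity (R : ℝ) : Integrable (ballDensity R) :=
  (integrable_indicator_iff measurableSet_ball).2 (integrableOn_const measure_ball_lt_top.ne)

theorem integral_ballDensity {R : ℝ} (hR : 0 < R) : ∫ x, ballDensity R x = 1 := by
  have := ballVol_pos hR
  unfold ballDensity
  rw [integral_indicator measurableSet_ball, setIntegral_const, smul_eq_mul]
  exact mul_inv_cancel₀ this.ne'

theorem bddDensity_ballDensity {R : ℝ} (hR : 0 < R) :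
    BddDensity (max (ballVol R)⁻¹ 1) (ballDensity R) where
  integrable := integrable_ballDensity R
  bound := .of_forall fun x => by
    rw [abs_of_nonneg (ballDensity_nonneg hR x)]
    exact (ballDensity_le hR x).trans (le_max_left _ _)
  mass := by
    simp only [abs_of_nonneg (ballDensity_nonneg hR _)]
    rw [integral_ballDensity hR]; exact le_max_right _ _

theorem continuous_ballVel {R : ℝ} (hR : 0 < R) : Continuous (ballVel R) :=
  (continuous_dropVel hR).const_smul (ballVol R)⁻¹

theorem tendsto_ballVel {R : ℝ} (hR : 0 < R) : Tendsto (ballVel R) (cocompact Space3) (𝓝 0) := by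
  have h1 : Tendsto (fun x : Space3 => (ballVol R)⁻¹ * (R ^ 3 * ‖x‖⁻¹)) (cocompact Space3) (𝓝 0) := by
    simpa using ((tendsto_inv_atTop_zero.comp (tendsto_norm_cocompact_atTop (E := Space3))).const_mul
      (R ^ 3)).const_mul (ballVol R)⁻¹
  have hv := ballVol_pos hR
  refine squeeze_zero_norm' ?_ h1
  have h2 : ∀ᶠ x : Space3 in cocompact Space3, 1 ≤ ‖x‖ :=
    tendsto_norm_cocompact_atTop.eventually_ge_atTop 1
  filter_upwards [h2] with x hx
  have hx0 : x ≠ 0 := by rintro rfl; simp at hx; linarith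
  unfold ballVel
  rw [norm_smul, Real.norm_of_nonneg (by positivity)]
  gcongr
  exact norm_dropVel_le hR hx0

theorem isStokesSolution_ball {R : ℝ} (hR : 0 < R) (a : Space3) :
    IsStokesSolution (fun x => ballDensity R (x - a)) (fun x => ballVel R (x - a))
      (fun x => ballPressure R (x - a)) where
  locallyIntegrable_velocity :=
    ((continuous_ballVel hR).comp (by fun_prop : Continuous fun x => x - a)).locallyIntegrable
  locallyIntegrable_pressure :=
    (((continuous_dropPressure hR).const_mul _).comp
      (by fun_prop : Continuous fun x => x - a)).locallyIntegrable
  momentum := by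
    intro ψ hψ hψs
    simp only [inner_eq_sum (ballVel _ _), laplacian_apply (hψ.of_le two_le_infty),
      divergence_eq_sum_pd (hψ.differentiable (by simp)), inner_e₃]
    have ht : ∀ k, IsTest (fun x => ψ (x + a) k) := fun k =>
      (isTest_component hψ hψs k).comp_add_right a
    have h := dropVel_momentum hR ht
    have e1 : ∫ x, ∑ k, ballVel R (x - a) k * lap (fun y => ψ y k) x
        = (ballVol R)⁻¹ * ∫ x, ∑ k, dropVel R x k * lap (fun x => ψ (x + a) k) x := by
      rw [← integral_add_right_eq_self _ a, ← integral_const_mul]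
      congr 1; funext x
      rw [Finset.mul_sum]
      refine Finset.sum_congr rfl fun k _ => ?_
      rw [add_sub_cancel_right, ← lap_comp_add_right]
      simp only [ballVel, PiLp.smul_apply, smul_eq_mul]; ring
    have e2 : ∫ x, ballPressure R (x - a) * ∑ i, pd i (fun y => ψ y i) x
        = (ballVol R)⁻¹ * ∫ x, dropPressure R x * ∑ i, pd i (fun x => ψ (x + a) i) x := by
      rw [← integral_add_right_eq_self _ a, ← integral_const_mul]
      congr 1; funext x
      rw [add_sub_cancel_right]
      have hp : ∀ i, pd i (fun x => ψ (x + a) i) x = pd i (fun y => ψ y i) (x + a) :=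
        fun i => pd_comp_add_right (fun y => ψ y i) i x a
      simp only [hp, ballPressure, mul_assoc]
    have e3 : ∫ x, ballDensity R (x - a) * ψ x 2
        = (ballVol R)⁻¹ * ∫ x, (Metric.ball (0 : Space3) R).indicator (fun _ => 1) x
          * ψ (x + a) 2 := by
      rw [← integral_add_right_eq_self _ a, ← integral_const_mul]
      congr 1; funext x
      rw [add_sub_cancel_right, ballDensity_eq, mul_assoc]
    rw [e1, e2, e3, ← mul_neg, ← mul_sub, h, mul_neg]
  incompressible := by
    intro φ hφ hφs
    simp only [inner_gradient_eq]
    have h := dropVel_incompressible hR (IsTest.comp_add_right ⟨hφ, hφs⟩ a)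
    rw [← integral_add_right_eq_self _ a]
    simp only [add_sub_cancel_right, ballVel, map_smul, smul_eq_mul]
    rw [integral_const_mul]
    simp only [fderiv_comp_add_right] at h
    rw [h, mul_zero]
  tendsto_zero := by
    have h : Tendsto (fun x : Space3 => x - a) (cocompact Space3) (cocompact Space3) :=
      (Homeomorph.subRight a).isClosedEmbedding.tendsto_cocompact
    exact ((tendsto_ballVel hR).comp h).mono_left inf_le_left

theorem ballVel_eq_stokesVel {R : ℝ} (hR : 0 < R) (x : Space3) :
    ballVel R x = stokesVel (ballDensity R) x := by
  have h := (isStokesSolution_ball hR 0)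
  simp only [sub_zero] at h
  exact congrFun ((Continuous.ae_eq_iff_eq volume (continuous_ballVel hR)
    (bddDensity_ballDensity hR).continuous_stokesVel).1
    (h.velocity_eq (bddDensity_ballDensity hR))) x

/-- Inside the ball, the velocity relative to the falling ball. -/
theorem ballVel_sub_fallVel {R : ℝ} {x : Space3} (hx : ‖x‖ ^ 2 ≤ R ^ 2) :
    ballVel R x - fallVel R
      = ((ballVol R)⁻¹ / 15) • ((2 * ‖x‖ ^ 2 - R ^ 2) • e₃ - x 2 • x) := by
  unfold ballVel fallVel dropVel dropV dropA dropD
  simp only [glue_of_le _ _ hx]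
  rw [smul_sub, smul_sub, smul_smul, smul_smul, smul_smul, smul_smul, sub_right_comm, ← sub_smul]
  congr 2 <;> ring

/-- The relative velocity is divergence free in the ball and tangent to its boundary; it is the
curl of a multiple of `(|x|² - R²) e₃ × x`, which vanishes on the sphere. -/
theorem integral_ballDensity_relVel {R : ℝ} (hR : 0 < R) {φ : Space3 → ℝ} (hφ : IsTest φ) :
    ∫ x, ballDensity R x * fderiv ℝ φ x (ballVel R x - fallVel R) = 0 := by
  set S := R ^ 2 with hS
  have hS0 : 0 < S := by positivity
  set g : Space3 → ℝ := fun x => glue S (fun s => s - S) (fun _ => 0) (‖x‖ ^ 2) with hg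
  set o : Space3 → ℝ := fun x => glue S (fun _ => 1) (fun _ => 0) (‖x‖ ^ 2) with ho
  have hgi : LocallyIntegrable g volume :=
    locallyIntegrable_glue hS0 (by fun_prop) continuousOn_const
  have hoi : LocallyIntegrable o volume :=
    locallyIntegrable_glue hS0 (by fun_prop) continuousOn_const
  have hibp : ∀ {f : Space3 → ℝ}, IsTest f → ∀ i : Fin 3,
      ∫ x, o x * (x i * f x) = -(1 / 2) * ∫ x, g x * pd i f x := by
    intro f hf i
    have := integral_glue_mul_pd (S := S) (a := fun s => s - S) (b := fun _ => 0)
      (a' := fun _ => 1) (b' := fun _ => 0) hS0 (fun s => (hasDerivAt_id s).sub_const S)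
      (fun s _ => hasDerivAt_const s 0) (by fun_prop) continuousOn_const (by simp) hf i
    rw [this]
    simp only [mul_assoc]
    rw [integral_const_mul]; ring
  have hae : ∀ᵐ x : Space3, ballDensity R x * fderiv ℝ φ x (ballVel R x - fallVel R)
      = ((ballVol R)⁻¹ * ((ballVol R)⁻¹ / 15)) * (g x * pd 2 φ x + o x * (x 0 * (x 0 * pd 2 φ x))
        + o x * (x 1 * (x 1 * pd 2 φ x)) - o x * (x 2 * (x 0 * pd 0 φ x))
        - o x * (x 2 * (x 1 * pd 1 φ x))) := by
    filter_upwards [ae_norm_sq_ne S] with x hx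
    rcases lt_or_gt_of_ne hx with h | h
    · have hR' : ‖x‖ < R := lt_of_pow_lt_pow_left₀ 2 hR.le h
      rw [ballDensity_of_norm_lt hR', ballVel_sub_fallVel h.le, hg, ho]
      simp only [glue_of_le _ _ h.le]
      rw [fderiv_eq_sum_pd]
      simp only [Fin.sum_univ_three, PiLp.smul_apply, PiLp.sub_apply, smul_eq_mul]
      have h0 : e₃ 0 = 0 := by simp [e₃]
      have h1 : e₃ 1 = 0 := by simp [e₃]
      have h2 : e₃ 2 = 1 := by simp [e₃]
      have hn := norm_sq_eq x
      simp only [Fin.sum_univ_three] at hn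
      rw [h0, h1, h2, hn, ← hS]
      ring
    · have hR' : R < ‖x‖ := lt_of_pow_lt_pow_left₀ 2 (norm_nonneg x) h
      rw [ballDensity_of_le_norm hR'.le, hg, ho]
      simp only [glue_of_lt _ _ h]
      ring
  rw [integral_congr_ae hae, integral_const_mul]
  have i1 := (hφ.pd 2).integrable_mul hgi
  have i2 := (((hφ.pd 2).coord_mul 0).coord_mul 0).integrable_mul hoi
  have i3 := (((hφ.pd 2).coord_mul 1).coord_mul 1).integrable_mul hoi
  have i4 := (((hφ.pd 0).coord_mul 0).coord_mul 2).integrable_mul hoi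
  have i5 := (((hφ.pd 1).coord_mul 1).coord_mul 2).integrable_mul hoi
  have i12 := i1.fun_add i2
  have i13 := i12.fun_add i3
  have i14 := i13.sub' i4
  rw [integral_sub i14 i5, integral_sub i13 i4, integral_add i12 i3, integral_add i1 i2,
    hibp ((hφ.pd 2).coord_mul 0) 0, hibp ((hφ.pd 2).coord_mul 1) 1,
    hibp ((hφ.pd 0).coord_mul 0) 2, hibp ((hφ.pd 1).coord_mul 1) 2]
  simp only [pd_coord_mul (hφ.pd _)]
  have n1 : ¬ (2 : Fin 3) = 0 := by decide
  have n2 : ¬ (2 : Fin 3) = 1 := by decide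
  simp only [if_true, n1, n2, if_false, zero_mul, add_zero, one_mul, mul_add]
  have j1 := ((((hφ.pd 2).pd 0).coord_mul 0)).integrable_mul hgi
  have j2 := ((((hφ.pd 2).pd 1).coord_mul 1)).integrable_mul hgi
  rw [integral_add j1 i1, integral_add j2 i1, pd_comm hφ.smooth 2 0, pd_comm hφ.smooth 2 1]
  ring

/-- The space-time shear `(t, x) ↦ (t, x + t v)`, which passes to the frame moving with
velocity `v`. -/
noncomputable def shear (v : Space3) : (ℝ × Space3) ≃ₜ (ℝ × Space3) where
  toFun z := (z.1, z.2 + z.1 • v)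
  invFun z := (z.1, z.2 - z.1 • v)
  left_inv z := by simp
  right_inv z := by simp
  continuous_toFun := by fun_prop
  continuous_invFun := by fun_prop

theorem shear_apply (v : Space3) (z : ℝ × Space3) : shear v z = (z.1, z.2 + z.1 • v) := rfl

theorem contDiff_shear (v : Space3) : ContDiff ℝ ∞ (shear v) := by
  have : (shear v : ℝ × Space3 → ℝ × Space3) = fun z => (z.1, z.2 + z.1 • v) := rfl
  rw [this]; fun_prop

theorem fderiv_comp_shear {φ : ℝ × Space3 → ℝ} (hφ : Differentiable ℝ φ) (v : Space3)
    (z w : ℝ × Space3) : fderiv ℝ (fun z => φ (shear v z)) z w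
      = fderiv ℝ φ (shear v z) (w.1, w.2 + w.1 • v) := by
  have hs : HasFDerivAt (fun z : ℝ × Space3 => (z.1, z.2 + z.1 • v))
      ((ContinuousLinearMap.fst ℝ ℝ Space3).prod (ContinuousLinearMap.snd ℝ ℝ Space3
        + (ContinuousLinearMap.fst ℝ ℝ Space3).smulRight v)) z :=
    hasFDerivAt_fst.prodMk (hasFDerivAt_snd.add (hasFDerivAt_fst.smul_const v))
  have h := ((hφ (shear v z)).hasFDerivAt.comp z hs).fderiv
  have h' : fderiv ℝ (fun z => φ (shear v z)) z = _ := h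
  rw [h']
  simp

theorem HasCompactSupport.slice_right {φ : ℝ × Space3 → ℝ} (hs : HasCompactSupport φ) (t : ℝ) :
    HasCompactSupport (fun x => φ (t, x)) :=
  HasCompactSupport.of_support_subset_isCompact (hs.isCompact.image continuous_snd)
    fun x hx => ⟨(t, x), subset_tsupport φ hx, rfl⟩

theorem HasCompactSupport.slice_left {φ : ℝ × Space3 → ℝ} (hs : HasCompactSupport φ)
    (x : Space3) : HasCompactSupport (fun t => φ (t, x)) :=
  HasCompactSupport.of_support_subset_isCompact (hs.isCompact.image continuous_fst)
    fun t ht => ⟨(t, x), subset_tsupport φ ht, rfl⟩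

theorem isTest_slice {φ : ℝ × Space3 → ℝ} (hφ : ContDiff ℝ ∞ φ) (hs : HasCompactSupport φ)
    (t : ℝ) : IsTest (fun x => φ (t, x)) where
  smooth := hφ.comp (contDiff_const.prodMk contDiff_id)
  supp := hs.slice_right t

theorem fderiv_slice {φ : ℝ × Space3 → ℝ} (hφ : Differentiable ℝ φ) (t : ℝ) (x w : Space3) :
    fderiv ℝ (fun x => φ (t, x)) x w = fderiv ℝ φ (t, x) (0, w) := by
  have hs : HasFDerivAt (fun x : Space3 => (t, x)) (ContinuousLinearMap.inr ℝ ℝ Space3) x :=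
    (hasFDerivAt_const t x).prodMk (hasFDerivAt_id x)
  have h' : fderiv ℝ (fun x => φ (t, x)) x = _ := ((hφ (t, x)).hasFDerivAt.comp x hs).fderiv
  rw [h']; simp

theorem translatingPatch_eq {R : ℝ} (hR : 0 < R) (t : ℝ) (x : Space3) :
    translatingPatch R t x = ballDensity R (x - t • fallVel R) := by
  have hv := volume_unitBall_pos
  have hV : ballVol R = R ^ 3 * ballVol 1 := volume_ball_real hR 0
  have harg : (1 / R) • x - (t / (volume.real (Metric.ball (0 : Space3) 1) * R ^ 2)) •
      (-(4 / 15 : ℝ) • e₃) = (1 / R) • (x - t • fallVel R) := by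
    unfold fallVel
    rw [smul_sub, smul_smul, smul_smul, smul_smul, hV]
    congr 2
    unfold ballVol
    field_simp
  unfold translatingPatch
  rw [harg]
  have hn : ‖(1 / R) • (x - t • fallVel R)‖ = ‖x - t • fallVel R‖ / R := by
    rw [norm_smul, Real.norm_of_nonneg (by positivity)]; ring
  rcases lt_or_ge ‖x - t • fallVel R‖ R with h | h
  · rw [ballDensity_of_norm_lt h, ballDensity_of_norm_lt (by rw [hn, div_lt_one hR]; exact h), hV,
      mul_inv]
    ring
  · rw [ballDensity_of_le_norm h, ballDensity_of_le_norm (by rw [hn, le_div_iff₀ hR]; linarith),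
      mul_zero]

theorem volume_restrict_positiveTimes :
    (volume : Measure (ℝ × Space3)).restrict positiveTimes
      = ((volume : Measure ℝ).restrict (Ioi 0)).prod (volume : Measure Space3) := by
  rw [positiveTimes, Measure.volume_eq_prod, ← Measure.prod_restrict, Measure.restrict_univ]

theorem integral_positiveTimes {F : ℝ × Space3 → ℝ}
    (hF : Integrable F ((volume : Measure (ℝ × Space3)).restrict positiveTimes)) :
    ∫ z in positiveTimes, F z = ∫ t in Ioi (0 : ℝ), ∫ x, F (t, x) := by
  rw [volume_restrict_positiveTimes] at hF ⊢
  exact integral_prod F hF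

/-- After passage to the moving frame, the time derivative integrates to the initial datum, and the
spatial part vanishes since the relative velocity is tangent to the ball. -/
theorem translatingPatch_transport {R : ℝ} (hR : 0 < R) {φ : ℝ × Space3 → ℝ}
    (hφ : ContDiff ℝ ∞ φ) (hφs : HasCompactSupport φ) :
    (∫ z in positiveTimes, translatingPatch R z.1 z.2
        * fderiv ℝ φ z (1, ballVel R (z.2 - z.1 • fallVel R)))
      + ∫ x, ballDensity R x * φ (0, x) = 0 := by
  set v := fallVel R
  set φ' : ℝ × Space3 → ℝ := fun z => φ (shear v z)
  have hφ' : ContDiff ℝ ∞ φ' := hφ.comp (contDiff_shear v)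
  have hφs' : HasCompactSupport φ' := hφs.comp_homeomorph (shear v)
  have hd : Differentiable ℝ φ := hφ.differentiable (by simp)
  have hd' : Differentiable ℝ φ' := hφ'.differentiable (by simp)
  -- every continuous compactly supported function times a bounded density is integrable
  have hbdd : ∀ {D G : ℝ × Space3 → ℝ}, Measurable D → (∀ z, |D z| ≤ (ballVol R)⁻¹) →
      Continuous G → HasCompactSupport G → Integrable fun z => D z * G z := by
    intro D G hD hD' hG hGs
    exact (hG.integrable_of_hasCompactSupport hGs).bdd_mul hD.aestronglyMeasurable
      (.of_forall hD')
  have habs : ∀ x, |ballDensity R x| ≤ (ballVol R)⁻¹ := fun x => by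
    rw [abs_of_nonneg (ballDensity_nonneg hR x)]; exact ballDensity_le hR x
  have hcV := continuous_ballVel hR
  have hfs : ∀ {ψ : ℝ × Space3 → ℝ} (u : ℝ × Space3 → ℝ × Space3), ContDiff ℝ ∞ ψ →
      HasCompactSupport ψ → Continuous u → Continuous (fun z => fderiv ℝ ψ z (u z)) ∧
        HasCompactSupport (fun z => fderiv ℝ ψ z (u z)) := by
    intro ψ u hψ hψs hu
    refine ⟨(hψ.continuous_fderiv (by simp)).clm_apply hu, ?_⟩
    refine (hψs.fderiv (𝕜 := ℝ)).mono fun z hz => ?_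
    rw [Function.mem_support] at hz ⊢
    intro h0; apply hz; rw [h0]; rfl
  have h1 := hfs (fun z => ((1 : ℝ), ballVel R (z.2 - z.1 • v))) hφ hφs (by fun_prop)
  have hF : Integrable fun z : ℝ × Space3 => translatingPatch R z.1 z.2
      * fderiv ℝ φ z (1, ballVel R (z.2 - z.1 • v)) := by
    refine hbdd ?_ (fun z => by rw [translatingPatch_eq hR]; exact habs _) h1.1 h1.2
    simp only [translatingPatch_eq hR]
    exact (measurable_ballDensity R).comp (by fun_prop)
  rw [integral_positiveTimes hF.restrict]
  have hslice : ∀ t, ∫ x, translatingPatch R t x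
      * fderiv ℝ φ (t, x) (1, ballVel R (x - t • v))
        = ∫ x, ballDensity R x * fderiv ℝ φ' (t, x) (1, 0) := by
    intro t
    rw [← integral_add_right_eq_self _ (t • v)]
    have hk := integral_ballDensity_relVel hR (isTest_slice hφ' hφs' t)
    have e : ∀ x, translatingPatch R t (x + t • v)
        * fderiv ℝ φ (t, x + t • v) (1, ballVel R (x + t • v - t • v))
        = ballDensity R x * fderiv ℝ φ' (t, x) (1, 0)
          + ballDensity R x * fderiv ℝ (fun x => φ' (t, x)) x (ballVel R x - v) := by
      intro x
      rw [translatingPatch_eq hR, add_sub_cancel_right, fderiv_slice hd', ← mul_add, ← map_add,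
        fderiv_comp_shear hd, shear_apply]
      simp
    simp only [e]
    have hc1 := hfs (fun _ => ((1 : ℝ), (0 : Space3))) hφ' hφs' continuous_const
    have hc2 := hfs (fun z => ((0 : ℝ), ballVel R z.2 - v)) hφ' hφs' (by fun_prop)
    have hb : ∀ {G : ℝ × Space3 → ℝ}, Continuous G → HasCompactSupport G →
        Integrable fun x => ballDensity R x * G (t, x) := by
      intro G hG hGs
      exact ((hG.comp (by fun_prop : Continuous fun x : Space3 => (t, x))).integrable_of_hasCompactSupport
        (hGs.slice_right t)).bdd_mul
          (measurable_ballDensity R).aestronglyMeasurable (.of_forall habs)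
    rw [integral_add (hb hc1.1 hc1.2), hk, add_zero]
    simp only [fderiv_slice hd']
    exact hb hc2.1 hc2.2
  simp only [hslice]
  have hc1 := hfs (fun _ => ((1 : ℝ), (0 : Space3))) hφ' hφs' continuous_const
  have hF' : Integrable (fun z : ℝ × Space3 => ballDensity R z.2 * fderiv ℝ φ' z (1, 0)) :=
    hbdd ((measurable_ballDensity R).comp measurable_snd) (fun z => habs _) hc1.1 hc1.2
  have hF'' : Integrable (fun z : ℝ × Space3 => ballDensity R z.2 * fderiv ℝ φ' z (1, 0))
      (((volume : Measure ℝ).restrict (Ioi 0)).prod (volume : Measure Space3)) := by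
    rw [← volume_restrict_positiveTimes]; exact hF'.restrict
  rw [integral_integral_swap hF'']
  have htime : ∀ x, ∫ t in Ioi (0 : ℝ), ballDensity R x * fderiv ℝ φ' (t, x) (1, 0)
      = -(ballDensity R x * φ (0, x)) := by
    intro x
    have hder : ∀ t, deriv (fun t => φ' (t, x)) t = fderiv ℝ φ' (t, x) (1, 0) := by
      intro t
      have hs : HasDerivAt (fun t : ℝ => (t, x)) (1, 0) t :=
        (hasDerivAt_id t).prodMk (hasDerivAt_const t x)
      exact ((hd' (t, x)).hasFDerivAt.comp_hasDerivAt t hs).deriv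
    have hC : ContDiff ℝ 1 (fun t => φ' (t, x)) :=
      (hφ'.comp (contDiff_id.prodMk contDiff_const)).of_le (by simp)
    have := HasCompactSupport.integral_Ioi_deriv_eq hC (hφs'.slice_left x) 0
    simp only [hder] at this
    rw [integral_const_mul, this]
    simp [φ', shear_apply]
  simp only [htime]
  rw [integral_neg, neg_add_cancel]

/-- The translating patch, with the translated velocity and pressure of the ball, is a solution. -/
theorem isTransportStokesSolution_translatingPatch {R : ℝ} (hR : 0 < R) :
    IsTransportStokesSolution (ballDensity R) (translatingPatch R)
      (fun t x => ballVel R (x - t • fallVel R)) (fun t x => ballPressure R (x - t • fallVel R)) where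
  aestronglyMeasurable_density := by
    simp only [translatingPatch_eq hR]
    exact ((measurable_ballDensity R).comp (by fun_prop :
      Measurable fun z : ℝ × Space3 => z.2 - z.1 • fallVel R)).aestronglyMeasurable
  bounded_density := by
    intro T _
    have hb := bddDensity_ballDensity hR
    refine ⟨Real.toNNReal (max (ballVol R)⁻¹ 1), .of_forall fun t => ⟨?_, ?_⟩⟩
    · have hi : Integrable (translatingPatch R t) := by
        have h1 := hb.integrable.comp_sub_right (t • fallVel R)
        refine h1.congr (.of_forall fun x => ?_)
        exact (translatingPatch_eq hR t x).symm
      rw [eLpNorm_one_eq_lintegral_enorm, ← ofReal_integral_norm_eq_lintegral_enorm hi]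
      refine ENNReal.ofReal_le_ofReal ?_
      simp only [translatingPatch_eq hR]
      rw [integral_sub_right_eq_self (fun x => ‖ballDensity R x‖)]
      exact hb.mass
    · refine (eLpNormEssSup_le_of_ae_bound (C := max (ballVol R)⁻¹ 1) (.of_forall fun x => ?_))
      rw [translatingPatch_eq hR, Real.norm_of_nonneg (ballDensity_nonneg hR _)]
      exact (ballDensity_le hR _).trans (le_max_left _ _)
  locallyIntegrable_velocity :=
    ((continuous_ballVel hR).comp (by fun_prop :
      Continuous fun z : ℝ × Space3 => z.2 - z.1 • fallVel R)).locallyIntegrable.locallyIntegrableOn _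
  stokes := .of_forall fun t => by
    simpa only [← translatingPatch_eq hR] using isStokesSolution_ball hR (t • fallVel R)
  transport := fun φ hφ hφs => translatingPatch_transport hR hφ hφs

/-! ### The weak transport equation, integrated in time -/

theorem locallyIntegrable_of_bound {E : Type*} [TopologicalSpace E] [MeasurableSpace E]
    {μ : Measure E} [IsLocallyFiniteMeasure μ] {f : E → ℝ} {C : ℝ} (hf : Measurable f)
    (hC : ∀ x, |f x| ≤ C) : LocallyIntegrable f μ :=
  (locallyIntegrable_const C).mono hf.aestronglyMeasurable (.of_forall fun x => by
    rw [Real.norm_eq_abs, Real.norm_eq_abs]; exact (hC x).trans (le_abs_self C))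

theorem intervalIntegrable_of_bound {f : ℝ → ℝ} {C : ℝ} (hf : Measurable f)
    (hC : ∀ x, |f x| ≤ C) (a b : ℝ) : IntervalIntegrable f volume a b :=
  intervalIntegrable_iff.mpr
    (((locallyIntegrable_of_bound hf hC).integrableOn_isCompact isCompact_uIcc).mono_set
      uIoc_subset_uIcc)

/-- A distributional identity `∂ₜ a = b`, `a(0) = A₀` on `[0, T)` holds in integrated form. -/
theorem ae_eq_add_integral_of_weak {T : ℝ} (hT : 0 < T) {a b : ℝ → ℝ} {A₀ C : ℝ}
    (ha : Measurable a) (hb : Measurable b) (haC : ∀ t, |a t| ≤ C) (hbC : ∀ t, |b t| ≤ C)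
    (h : ∀ χ : ℝ → ℝ, ContDiff ℝ ∞ χ → HasCompactSupport χ → tsupport χ ⊆ Iio T →
      (∫ t in Ioi (0 : ℝ), (deriv χ t * a t + χ t * b t)) + χ 0 * A₀ = 0) :
    ∀ᵐ t ∂(volume.restrict (Ioo 0 T)), a t = A₀ + ∫ s in (0 : ℝ)..t, b s := by
  set B : ℝ → ℝ := fun t => ∫ s in (0 : ℝ)..t, b s with hB
  have hbi := intervalIntegrable_of_bound hb hbC
  have hai := intervalIntegrable_of_bound ha haC
  have hBc : Continuous B := intervalIntegral.continuous_primitive hbi 0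
  have hc : LocallyIntegrable (fun t => a t - A₀ - B t) volume :=
    ((locallyIntegrable_of_bound ha haC).sub (locallyIntegrable_const A₀)).sub hBc.locallyIntegrable
  have key := isOpen_Ioo.ae_eq_zero_of_integral_contDiff_smul_eq_zero
    (U := Ioo 0 T) (hc.locallyIntegrableOn _) ?_
  · rw [ae_restrict_iff' measurableSet_Ioo]
    filter_upwards [key] with t ht htm
    have := ht htm
    linarith
  intro θ hθ hθs hθT
  have hθc := hθ.continuous
  -- `Θ` is the primitive of `θ` which vanishes near `T`
  set Θ : ℝ → ℝ := fun t => (∫ s in (0 : ℝ)..t, θ s) - ∫ s in (0 : ℝ)..T, θ s with hΘ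
  have hΘd : ∀ t, HasDerivAt Θ (θ t) t := fun t =>
    (intervalIntegral.integral_hasDerivAt_right (hθc.intervalIntegrable _ _)
      (hθc.stronglyMeasurableAtFilter _ _) hθc.continuousAt).sub_const _
  have hΘderiv : deriv Θ = θ := funext fun t => (hΘd t).deriv
  have hΘs : ContDiff ℝ ∞ Θ := by
    rw [contDiff_infty_iff_deriv, hΘderiv]
    exact ⟨fun t => (hΘd t).differentiableAt, hθ⟩
  obtain ⟨T', hT'0, hT', hT's⟩ : ∃ T', 0 ≤ T' ∧ T' < T ∧ ∀ t, T' ≤ t → θ t = 0 := by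
    rcases (tsupport θ).eq_empty_or_nonempty with he | hne
    · refine ⟨0, le_rfl, hT, fun t _ => ?_⟩
      by_contra h0
      have := subset_tsupport θ h0
      rw [he] at this; exact this
    · obtain ⟨m, hm, hmax⟩ := hθs.isCompact.exists_isMaxOn hne continuousOn_id
      refine ⟨(m + T) / 2, by linarith [(hθT hm).1], by linarith [(hθT hm).2], fun t ht => ?_⟩
      by_contra h0
      have h1 : t ≤ m := hmax (subset_tsupport θ h0)
      linarith [(hθT hm).2]
  have hΘ0 : ∀ t, T' ≤ t → Θ t = 0 := by
    intro t ht
    have : ∫ s in T..t, θ s = 0 := by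
      rw [intervalIntegral.integral_congr (g := fun _ => 0)]
      · simp
      · intro s hs
        refine hT's s ?_
        have := (le_min hT'.le ht)
        exact this.trans hs.1
    simp only [hΘ]
    rw [intervalIntegral.integral_interval_sub_left (hθc.intervalIntegrable _ _)
      (hθc.intervalIntegrable _ _), this]
  -- `Θ` is constant for negative times; the cutoff `κ` makes it compactly supported there
  let κ : ContDiffBump (0 : ℝ) := ⟨T + 1, T + 2, by linarith, by linarith⟩
  have hκ : ∀ t ∈ Icc (-1) (T + 1), κ t = 1 := fun t ht =>
    κ.one_of_mem_closedBall (by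
      rw [mem_closedBall_zero_iff, Real.norm_eq_abs, abs_le]
      have h1 : κ.rIn = T + 1 := rfl
      exact ⟨by linarith [ht.1], by linarith [ht.2]⟩)
  set χ : ℝ → ℝ := fun t => κ t * Θ t with hχ
  have hχΘ : ∀ t, -1 ≤ t → χ t = Θ t := by
    intro t ht
    rcases le_or_gt t (T + 1) with h1 | h1
    · simp only [hχ]; rw [hκ t ⟨ht, h1⟩, one_mul]
    · simp only [hχ]; rw [hΘ0 t (by linarith), mul_zero]
  have hχT : tsupport χ ⊆ Iio T := by
    have h1 : tsupport χ ⊆ Iic T' := by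
      refine closure_minimal (fun t ht => ?_) isClosed_Iic
      by_contra hlt
      rw [mem_Iic, not_le] at hlt
      exact ht (by simp only [hχ]; rw [hΘ0 t hlt.le, mul_zero])
    exact fun t ht => (h1 ht).trans_lt hT'
  have hw := h χ (κ.contDiff.mul hΘs) (κ.hasCompactSupport.mul_right) hχT
  have hderiv : ∀ t, 0 < t → deriv χ t = θ t := by
    intro t ht
    have : χ =ᶠ[𝓝 t] Θ := by
      filter_upwards [Ioi_mem_nhds (show -1 < t by linarith)] with s hs
      exact hχΘ s (le_of_lt hs)
    rw [this.deriv_eq, hΘderiv]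
  have e1 : ∫ t in Ioi (0 : ℝ), (deriv χ t * a t + χ t * b t)
      = ∫ t in (0 : ℝ)..T, (θ t * a t + Θ t * b t) := by
    rw [intervalIntegral.integral_of_le hT.le, ← integral_indicator measurableSet_Ioi,
      ← integral_indicator measurableSet_Ioc]
    congr 1; funext t
    rcases le_or_gt t 0 with h0 | h0
    · rw [indicator_of_notMem (by simpa using h0), indicator_of_notMem (by simp [h0.not_gt])]
    · rw [indicator_of_mem (by simpa using h0), hderiv t h0, hχΘ t (by linarith)]
      rcases le_or_gt t T with h1 | h1
      · rw [indicator_of_mem (show t ∈ Ioc 0 T from ⟨h0, h1⟩)]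
      · rw [indicator_of_notMem (fun hm => h1.not_ge hm.2), hT's t (by linarith),
          hΘ0 t (by linarith)]
        simp
  have e2 : ∫ t in (0 : ℝ)..T, Θ t * b t = -∫ t in (0 : ℝ)..T, θ t * B t := by
    have hac1 : AbsolutelyContinuousOnInterval Θ 0 T :=
      (hΘs.contDiffOn.of_le (by simp)).absolutelyContinuousOnInterval
    have hac2 : AbsolutelyContinuousOnInterval B 0 T :=
      (hbi 0 T).absolutelyContinuousOnInterval_intervalIntegral (by simp)
    have := hac1.integral_mul_deriv_eq_deriv_mul hac2
    rw [hΘ0 T hT'.le, hΘderiv] at this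
    have hB0 : B 0 = 0 := intervalIntegral.integral_same
    rw [hB0] at this
    have e3 : ∫ t in (0 : ℝ)..T, Θ t * b t = ∫ t in (0 : ℝ)..T, Θ t * deriv B t := by
      refine intervalIntegral.integral_congr_ae ?_
      filter_upwards [(hbi 0 T).ae_hasDerivAt_integral] with t ht htm
      rw [(ht (uIoc_subset_uIcc htm) 0 (by simp)).deriv]
    rw [e3, this]; ring
  have hθa : IntervalIntegrable (fun t => θ t * a t) volume 0 T :=
    (hai 0 T).continuousOn_mul hθc.continuousOn
  have hΘb : IntervalIntegrable (fun t => Θ t * b t) volume 0 T :=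
    (hbi 0 T).continuousOn_mul hΘs.continuous.continuousOn
  have hΘ00 : χ 0 = -∫ t in (0 : ℝ)..T, θ t := by
    rw [hχΘ 0 (by norm_num)]; simp [hΘ]
  rw [e1, intervalIntegral.integral_add hθa hΘb, e2, hΘ00] at hw
  have e4 : ∫ t, θ t • (a t - A₀ - B t) = ∫ t in (0 : ℝ)..T, θ t * (a t - A₀ - B t) := by
    rw [intervalIntegral.integral_of_le hT.le, ← integral_indicator measurableSet_Ioc]
    congr 1; funext t
    by_cases ht : t ∈ Ioc 0 T
    · rw [indicator_of_mem ht]; rfl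
    · rw [indicator_of_notMem ht]
      have : θ t = 0 := by
        by_contra h0
        exact ht (Ioo_subset_Ioc_self (hθT (subset_tsupport θ h0)))
      simp [this]
  rw [e4]
  have hθA : IntervalIntegrable (fun t => θ t * A₀) volume 0 T :=
    (hθc.mul continuous_const).intervalIntegrable _ _
  have hθB : IntervalIntegrable (fun t => θ t * B t) volume 0 T :=
    (hθc.mul hBc).intervalIntegrable _ _
  simp only [mul_sub]
  rw [intervalIntegral.integral_sub (hθa.sub hθA) hθB, intervalIntegral.integral_sub hθa hθA,
    intervalIntegral.integral_mul_const]
  linarith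

/-- The transport equation `∂ₜτ + div (τ W) = 0`, `τ(0) = τ₀`, integrated in time against test
functions of the space variable, for almost every time in `(0, T)`. -/
def WeakTransport (T : ℝ) (W : ℝ → Space3 → Space3) (τ₀ : Space3 → ℝ) (τ : ℝ → Space3 → ℝ) : Prop :=
  ∀ ζ, IsTest ζ → ∀ᵐ t ∂((volume : Measure ℝ).restrict (Ioo 0 T)),
    ∫ x, τ t x * ζ x = (∫ x, τ₀ x * ζ x) + ∫ s in (0 : ℝ)..t, ∫ x, τ s x * fderiv ℝ ζ x (W s x)

/-- A jointly measurable family of densities with uniform bounds. -/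
structure BddFamily (M : ℝ) (τ : ℝ → Space3 → ℝ) : Prop where
  measurable : Measurable (fun z : ℝ × Space3 => τ z.1 z.2)
  bound : ∀ t x, |τ t x| ≤ M
  integrable : ∀ t, Integrable (τ t)
  mass : ∀ t, ∫ x, |τ t x| ≤ M

theorem BddFamily.bddDensity {M : ℝ} {τ : ℝ → Space3 → ℝ} (h : BddFamily M τ) (t : ℝ) :
    BddDensity M (τ t) := ⟨h.integrable t, .of_forall (h.bound t), h.mass t⟩

theorem BddFamily.measurable_stokesVel {M : ℝ} {τ : ℝ → Space3 → ℝ} (h : BddFamily M τ) :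
    Measurable (fun z : ℝ × Space3 => stokesVel (τ z.1) z.2) := by
  have h1 : Measurable fun w : (ℝ × Space3) × Space3 => τ w.1.1 w.2 :=
    h.measurable.comp (by fun_prop : Measurable fun w : (ℝ × Space3) × Space3 => (w.1.1, w.2))
  have h2 : Measurable fun w : (ℝ × Space3) × Space3 => oseen (w.1.2 - w.2) :=
    measurable_oseen.comp (by fun_prop)
  exact (h1.smul h2).stronglyMeasurable.integral_prod_right'.measurable

/-- A velocity field which is measurable, bounded, Lipschitz in space uniformly in time, and weakly
divergence free. -/
structure LipField (L : ℝ) (W : ℝ → Space3 → Space3) : Prop where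
  measurable : Measurable (fun z : ℝ × Space3 => W z.1 z.2)
  bound : ∀ t x, ‖W t x‖ ≤ L
  lipschitz : ∀ t x y, ‖W t x - W t y‖ ≤ L * ‖x - y‖
  incompressible : ∀ t φ, IsTest φ → ∫ x, fderiv ℝ φ x (W t x) = 0

theorem LipField.nonneg {L : ℝ} {W : ℝ → Space3 → Space3} (h : LipField L W) : 0 ≤ L :=
  (norm_nonneg _).trans (h.bound 0 0)

theorem LipField.continuous {L : ℝ} {W : ℝ → Space3 → Space3} (h : LipField L W) (t : ℝ) :
    Continuous (W t) :=
  (LipschitzWith.of_dist_le_mul (K := Real.toNNReal L) fun x y => by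
    rw [Real.coe_toNNReal _ h.nonneg, dist_eq_norm, dist_eq_norm]
    exact h.lipschitz t x y).continuous

theorem BddFamily.exists_lipField {M : ℝ} {τ : ℝ → Space3 → ℝ} (h : BddFamily M τ) (v : Space3) :
    ∃ L, LipField L (fun t x => stokesVel (τ t) x - v) := by
  set L₁ := 2 * oseenConst * (rieszConst 1 * M) + ‖v‖
  set L₂ := 6 * oseenConst * (rieszConst 2 * M)
  refine ⟨max L₁ L₂, h.measurable_stokesVel.sub_const v, fun t x => ?_, fun t x y => ?_,
    fun t φ hφ => ?_⟩
  · exact ((norm_sub_le _ _).trans (add_le_add_left ((h.bddDensity t).norm_stokesVel_le x) _)).trans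
      (le_max_left _ _)
  · rw [sub_sub_sub_cancel_right]
    exact ((h.bddDensity t).norm_stokesVel_sub_le x y).trans
      (mul_le_mul_of_nonneg_right (le_max_right _ _) (norm_nonneg _))
  · have hd := (h.bddDensity t)
    simp only [map_sub]
    have hc := hφ.smooth.continuous_fderiv (by simp)
    have hint : ∀ {u : Space3 → Space3}, Continuous u → Integrable fun x => fderiv ℝ φ x (u x) := by
      intro u hu
      refine (hc.clm_apply hu).integrable_of_hasCompactSupport
        ((hφ.supp.fderiv (𝕜 := ℝ)).mono fun z hz => ?_)
      rw [Function.mem_support] at hz ⊢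
      intro h0; apply hz; rw [h0]; rfl
    rw [integral_sub (hint hd.continuous_stokesVel) (hint continuous_const),
      hd.stokesVel_incompressible hφ, hφ.integral_fderiv, sub_zero]

/-! ### Passage to the moving frame -/

/-- On a bounded time interval, the density of a solution agrees at almost every time with an
everywhere defined, measurable, uniformly bounded family. -/
theorem IsTransportStokesSolution.exists_bddFamily {ρ₀ : Space3 → ℝ} {ρ : ℝ → Space3 → ℝ}
    {u : ℝ → Space3 → Space3} {p : ℝ → Space3 → ℝ} (h : IsTransportStokesSolution ρ₀ ρ u p)
    {T : ℝ} (hT : 0 < T) :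
    ∃ M τ, BddFamily M τ ∧ ∀ᵐ t ∂((volume : Measure ℝ).restrict (Ioo 0 T)), ρ t =ᵐ[volume] τ t := by
  obtain ⟨M, hM⟩ := h.bounded_density T hT
  have hMR : (0 : ℝ) ≤ M := M.2
  obtain ⟨g, hgm, hae⟩ := h.aestronglyMeasurable_density
  have hg : Measurable g := hgm.measurable
  have hρg : ∀ᵐ t ∂((volume : Measure ℝ).restrict (Ioi 0)), ∀ᵐ x : Space3, ρ t x = g (t, x) := by
    rw [volume_restrict_positiveTimes] at hae
    exact Measure.ae_ae_of_ae_prod hae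
  set c : ℝ × Space3 → ℝ := fun z => max (-(M : ℝ)) (min (M : ℝ) (g z)) with hc
  have hcm : Measurable c := measurable_const.max (measurable_const.min hg)
  have hcM : ∀ z, |c z| ≤ M := fun z => by
    rw [abs_le]; exact ⟨le_max_left _ _, max_le (by linarith) (min_le_left _ _)⟩
  set G : Set ℝ := {t | ∫⁻ x : Space3, ‖c (t, x)‖ₑ ≤ M} with hG
  have hGm : MeasurableSet G := by
    have : Measurable fun t => ∫⁻ x : Space3, ‖c (t, x)‖ₑ :=
      hcm.enorm.lintegral_prod_right'
    exact measurableSet_le this measurable_const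
  classical
  set τ : ℝ → Space3 → ℝ := fun t x => if t ∈ G then c (t, x) else 0 with hτ
  have hτm : Measurable fun z : ℝ × Space3 => τ z.1 z.2 :=
    Measurable.ite (measurable_fst hGm) hcm measurable_const
  have hτG : ∀ t, ∫⁻ x, ‖τ t x‖ₑ ≤ M := by
    intro t
    by_cases ht : t ∈ G
    · simp only [hτ, if_pos ht]; exact ht
    · simp [hτ, if_neg ht]
  have hτt : ∀ t, Measurable (τ t) := fun t => hτm.comp measurable_prodMk_left
  refine ⟨M, τ, ⟨hτm, fun t x => ?_, fun t => ?_, fun t => ?_⟩, ?_⟩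
  · by_cases ht : t ∈ G
    · simp only [hτ, if_pos ht]; exact hcM _
    · simp [hτ, if_neg ht, hMR]
  · exact ⟨(hτt t).aestronglyMeasurable, (hτG t).trans_lt ENNReal.coe_lt_top⟩
  · have := integral_norm_eq_lintegral_enorm (hτt t).aestronglyMeasurable (μ := volume)
    simp only [Real.norm_eq_abs] at this
    rw [this]
    exact ENNReal.toReal_le_of_le_ofReal hMR (by simpa using hτG t)
  · filter_upwards [hM, ae_restrict_of_ae_restrict_of_subset
      (fun t (ht : t ∈ Ioo 0 T) => ht.1) hρg] with t ht htg
    have hle : ∀ᵐ x, |ρ t x| ≤ M := by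
      have := (eLpNorm_exponent_top (f := ρ t) (μ := volume)) ▸ ht.2
      filter_upwards [ae_le_eLpNormEssSup (f := ρ t) (μ := volume)] with x hx
      have h2 := hx.trans this
      rw [← Real.norm_eq_abs, ← coe_nnnorm]
      exact_mod_cast (by simpa [enorm] using h2 : ‖ρ t x‖₊ ≤ M)
    have hce : ∀ᵐ x, ρ t x = c (t, x) := by
      filter_upwards [htg, hle] with x hx hx'
      rw [abs_le] at hx'
      simp only [hc]
      rw [← hx, min_eq_right hx'.2, max_eq_right hx'.1]
    have htG : t ∈ G := by
      have := ht.1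
      rw [eLpNorm_one_eq_lintegral_enorm] at this
      refine le_trans (le_of_eq (lintegral_congr_ae ?_)) this
      filter_upwards [hce] with x hx
      rw [hx]
    filter_upwards [hce] with x hx
    simp only [hτ, if_pos htG]; exact hx

theorem BddFamily.comp_shear {M : ℝ} {τ : ℝ → Space3 → ℝ} (h : BddFamily M τ) (v : Space3) :
    BddFamily M (fun t x => τ t (x + t • v)) where
  measurable := h.measurable.comp (contDiff_shear v).continuous.measurable
  bound t x := h.bound _ _
  integrable t := (h.integrable t).comp_add_right (t • v)
  mass t := by
    rw [integral_add_right_eq_self (fun x => |τ t x|) (t • v)]; exact h.mass t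

theorem stokesVel_comp_add_right (ρ : Space3 → ℝ) (a x : Space3) :
    stokesVel (fun y => ρ (y + a)) x = stokesVel ρ (x + a) := by
  unfold stokesVel
  rw [← integral_add_right_eq_self (fun y => ρ y • oseen (x + a - y)) a]
  congr 1; funext y
  rw [add_sub_add_right_eq_sub]

theorem stokesVel_congr {ρ ρ' : Space3 → ℝ} (h : ρ =ᵐ[volume] ρ') : stokesVel ρ = stokesVel ρ' := by
  funext x
  refine integral_congr_ae ?_
  filter_upwards [h] with y hy
  rw [hy]

theorem LipField.measurable_fderiv {L : ℝ} {W : ℝ → Space3 → Space3} (h : LipField L W)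
    {ζ : Space3 → ℝ} (hζ : IsTest ζ) :
    Measurable fun z : ℝ × Space3 => fderiv ℝ ζ z.2 (W z.1 z.2) := by
  have h1 : Continuous fun q : Space3 × Space3 => fderiv ℝ ζ q.1 q.2 :=
    ((hζ.smooth.continuous_fderiv (by simp)).comp continuous_fst).clm_apply continuous_snd
  exact h1.measurable.comp (measurable_snd.prodMk h.measurable)

/-- Bounded functions integrated against a bounded family are uniformly bounded in time. -/
theorem BddFamily.abs_integral_mul_le {M : ℝ} {τ : ℝ → Space3 → ℝ} (h : BddFamily M τ) (t : ℝ)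
    {F : Space3 → ℝ} {K : ℝ} (hF : ∀ x, |F x| ≤ K) : |∫ x, τ t x * F x| ≤ K * M := by
  have hK : 0 ≤ K := (abs_nonneg _).trans (hF 0)
  calc |∫ x, τ t x * F x| ≤ ∫ x, K * |τ t x| := by
        rw [← Real.norm_eq_abs]
        refine norm_integral_le_of_norm_le ((h.integrable t).abs.const_mul K) (.of_forall fun x => ?_)
        rw [Real.norm_eq_abs, abs_mul, mul_comm]
        exact mul_le_mul_of_nonneg_right (hF x) (abs_nonneg _)
    _ ≤ K * M := by
        rw [integral_const_mul]; exact mul_le_mul_of_nonneg_left (h.mass t) hK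

/-- In the frame moving with velocity `v`, the density of a solution is transported by its own
Oseen potential minus `v`. -/
theorem IsTransportStokesSolution.exists_weakTransport {ρ₀ : Space3 → ℝ} {ρ : ℝ → Space3 → ℝ}
    {u : ℝ → Space3 → Space3} {p : ℝ → Space3 → ℝ} (h : IsTransportStokesSolution ρ₀ ρ u p)
    {T : ℝ} (hT : 0 < T) (v : Space3) :
    ∃ M τ, BddFamily M τ ∧ WeakTransport T (fun t x => stokesVel (τ t) x - v) ρ₀ τ ∧
      ∀ᵐ t ∂((volume : Measure ℝ).restrict (Ioo 0 T)), ∀ᵐ x, ρ t (x + t • v) = τ t x := by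
  obtain ⟨M, τ', hτ', hρτ'⟩ := h.exists_bddFamily hT
  set τ : ℝ → Space3 → ℝ := fun t x => τ' t (x + t • v) with hτdef
  have hτ : BddFamily M τ := hτ'.comp_shear v
  have htr : ∀ᵐ t ∂((volume : Measure ℝ).restrict (Ioo 0 T)), ∀ᵐ x, ρ t (x + t • v) = τ t x := by
    filter_upwards [hρτ'] with t ht
    exact (measurePreserving_add_right volume (t • v)).quasiMeasurePreserving.ae ht
  refine ⟨M, τ, hτ, fun ζ hζ => ?_, htr⟩
  obtain ⟨L, hL⟩ := hτ.exists_lipField v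
  set W : ℝ → Space3 → Space3 := fun t x => stokesVel (τ t) x - v with hW
  obtain ⟨K, hK0, hK⟩ := hζ.exists_bound
  obtain ⟨K', hK'0, hK'⟩ := hζ.exists_fderiv_bound
  have hDW : ∀ t x, |fderiv ℝ ζ x (W t x)| ≤ K' * L := fun t x =>
    ((fderiv ℝ ζ x).le_opNorm _).trans
      (mul_le_mul (hK' x) (hL.bound t x) (norm_nonneg _) hK'0.le)
  have hM : 0 ≤ M := (hτ.bddDensity 0).nonneg
  have hvel : ∀ᵐ t ∂((volume : Measure ℝ).restrict (Ioo 0 T)),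
      ∀ᵐ x, u t (x + t • v) = stokesVel (τ t) x := by
    filter_upwards [hρτ', ae_restrict_of_ae_restrict_of_subset
      (fun t (ht : t ∈ Ioo 0 T) => ht.1) h.stokes] with t ht hs
    have hd := hτ'.bddDensity t
    have hρd : BddDensity M (ρ t) := ⟨hd.integrable.congr ht.symm,
      by filter_upwards [ht] with x hx; rw [hx]; exact hτ'.bound t x,
      by rw [integral_congr_ae (g := fun x => |τ' t x|)
          (by filter_upwards [ht] with x hx; rw [hx])]; exact hd.mass⟩
    have h1 := hs.velocity_eq hρd
    rw [stokesVel_congr ht] at h1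
    filter_upwards [(measurePreserving_add_right volume (t • v)).quasiMeasurePreserving.ae h1]
      with x hx
    rw [hx, hτdef, stokesVel_comp_add_right]
  refine ae_eq_add_integral_of_weak hT (C := max (K * M) (K' * L * M)) ?_ ?_
    (fun t => (hτ.abs_integral_mul_le t hK).trans (le_max_left _ _))
    (fun t => (hτ.abs_integral_mul_le t (hDW t)).trans (le_max_right _ _)) ?_
  · exact (hτ.measurable.mul
      (hζ.continuous.measurable.comp measurable_snd)).stronglyMeasurable.integral_prod_right'.measurable
  · exact (hτ.measurable.mul
      (hL.measurable_fderiv hζ)).stronglyMeasurable.integral_prod_right'.measurable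
  intro χ hχ hχs hχT
  -- the test function `χ(t) ζ(x - t v)`
  set φ' : ℝ × Space3 → ℝ := fun z => χ z.1 * ζ z.2 with hφ'
  have hφ's : ContDiff ℝ ∞ φ' := (hχ.comp contDiff_fst).mul (hζ.smooth.comp contDiff_snd)
  have hφ'c : HasCompactSupport φ' := by
    refine HasCompactSupport.of_support_subset_isCompact
      (hχs.isCompact.prod hζ.supp.isCompact) fun z hz => ?_
    exact ⟨subset_tsupport _ (left_ne_zero_of_mul hz), subset_tsupport _ (right_ne_zero_of_mul hz)⟩
  set φ : ℝ × Space3 → ℝ := fun z => φ' (shear (-v) z) with hφ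
  have hφs : ContDiff ℝ ∞ φ := hφ's.comp (contDiff_shear (-v))
  have hφc : HasCompactSupport φ := hφ'c.comp_homeomorph (shear (-v))
  have hder : ∀ t x w, fderiv ℝ φ (t, x + t • v) (1, w)
      = deriv χ t * ζ x + χ t * fderiv ℝ ζ x (w - v) := by
    intro t x w
    have hsh : shear (-v) (t, x + t • v) = (t, x) := by rw [shear_apply]; simp
    rw [hφ, fderiv_comp_shear (hφ's.differentiable (by simp)), hsh]
    have h1 : HasFDerivAt (fun z : ℝ × Space3 => χ z.1) _ (t, x) :=
      ((hχ.differentiable (by simp) t).hasDerivAt.hasFDerivAt).comp (t, x) hasFDerivAt_fst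
    have h2 : HasFDerivAt (fun z : ℝ × Space3 => ζ z.2) _ (t, x) :=
      (hζ.differentiable x).hasFDerivAt.comp (t, x) hasFDerivAt_snd
    have h3 : fderiv ℝ φ' (t, x) = _ := (h1.mul h2).fderiv
    rw [h3]
    simp [sub_eq_add_neg]
    ring
  have hχ0 : ∀ t, T ≤ t → χ t = 0 ∧ deriv χ t = 0 := fun t ht => by
    have hn : t ∉ tsupport χ := fun hm => (hχT hm).not_ge ht
    exact ⟨image_eq_zero_of_notMem_tsupport hn,
      by
        by_contra h0
        exact hn (support_deriv_subset (f := χ) h0)⟩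
  obtain ⟨K₁, hK₁⟩ := hφs.continuous_fderiv (by simp) |>.bounded_above_of_compact_support
    (hφc.fderiv (𝕜 := ℝ))
  have hK₁0 : 0 ≤ K₁ := (norm_nonneg _).trans (hK₁ 0)
  set F : ℝ × Space3 → ℝ := fun z => ρ z.1 z.2 * fderiv ℝ φ z (1, u z.1 z.2) with hF
  -- at almost every time, in the moving frame
  have hFt : ∀ᵐ t ∂((volume : Measure ℝ).restrict (Ioi 0)), ∀ᵐ x, F (t, x + t • v)
      = if t < T then τ t x * (deriv χ t * ζ x + χ t * fderiv ℝ ζ x (W t x)) else 0 := by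
    rw [ae_restrict_iff' measurableSet_Ioo] at htr hvel
    rw [ae_restrict_iff' measurableSet_Ioi]
    filter_upwards [htr, hvel] with t h1 h2 ht0
    rcases lt_or_ge t T with htT | htT
    · filter_upwards [h1 ⟨ht0, htT⟩, h2 ⟨ht0, htT⟩] with x hx1 hx2
      simp only [hF, if_pos htT]
      rw [hx1, hx2, hder]
    · filter_upwards with x
      simp only [hF, if_neg htT.not_gt]
      rw [hder, (hχ0 t htT).1, (hχ0 t htT).2]; ring
  have hτF : ∀ t {G : Space3 → ℝ} {C : ℝ}, Measurable G → (∀ x, |G x| ≤ C) →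
      Integrable fun x => τ t x * G x := fun t G C hG hC =>
    (hτ.integrable t).mul_bdd hG.aestronglyMeasurable (.of_forall hC)
  have hτζ : ∀ t, Integrable fun x => τ t x * ζ x := fun t => hτF t hζ.continuous.measurable hK
  have hDm : ∀ t, Measurable fun x => fderiv ℝ ζ x (W t x) := fun t =>
    (hL.measurable_fderiv hζ).comp measurable_prodMk_left
  have hτD : ∀ t, Integrable fun x => τ t x * fderiv ℝ ζ x (W t x) := fun t =>
    hτF t (hDm t) (hDW t)
  have hsl : ∀ t, Integrable fun x => τ t x * (deriv χ t * ζ x + χ t * fderiv ℝ ζ x (W t x)) := by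
    intro t
    refine (((hτζ t).const_mul (deriv χ t)).add ((hτD t).const_mul (χ t))).congr
      (.of_forall fun x => ?_)
    simp only [Pi.add_apply]; ring
  have hslice : ∀ᵐ t ∂((volume : Measure ℝ).restrict (Ioi 0)),
      Integrable (fun x => F (t, x)) := by
    filter_upwards [hFt] with t ht
    have h1 : Integrable fun x => F (t, x + t • v) := by
      split_ifs at ht
      · exact (hsl t).congr (by filter_upwards [ht] with x hx; exact hx.symm)
      · exact (integrable_zero _ _ _).congr (by filter_upwards [ht] with x hx; exact hx.symm)
    simpa using h1.comp_add_right (-(t • v))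
  have hFint : Integrable F ((volume : Measure (ℝ × Space3)).restrict positiveTimes) := by
    have hum : AEStronglyMeasurable (fun z : ℝ × Space3 => u z.1 z.2)
        (volume.restrict positiveTimes) :=
      h.locallyIntegrable_velocity.aestronglyMeasurable.mono_measure
        (Measure.restrict_mono (prod_mono Ioi_subset_Ici_self subset_rfl) le_rfl)
    have hFm : AEStronglyMeasurable F (volume.restrict positiveTimes) := by
      have hc : Continuous fun q : (ℝ × Space3) × Space3 => fderiv ℝ φ q.1 (1, q.2) :=
        ((hφs.continuous_fderiv (by simp)).comp continuous_fst).clm_apply (by fun_prop)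
      exact h.aestronglyMeasurable_density.mul
        (hc.comp_aestronglyMeasurable (aestronglyMeasurable_id.prodMk hum))
    rw [volume_restrict_positiveTimes] at hFm ⊢
    rw [integrable_prod_iff hFm]
    refine ⟨hslice, ?_⟩
    obtain ⟨k₁, hk₁⟩ := hχ.continuous.bounded_above_of_compact_support hχs
    obtain ⟨k₂, hk₂⟩ := (hχ.continuous_deriv (by simp)).bounded_above_of_compact_support hχs.deriv
    set C := (k₂ * K + k₁ * (K' * L)) with hC
    refine Integrable.mono' (g := (Ioo 0 T).indicator fun _ => C * M)
      ((integrable_indicator_iff measurableSet_Ioo).2 ?_).integrableOn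
      hFm.norm.integral_prod_right' ?_
    · exact integrableOn_const (by simp)
    filter_upwards [hFt, ae_restrict_mem measurableSet_Ioi] with t ht ht0
    rw [Real.norm_of_nonneg (integral_nonneg fun _ => norm_nonneg _),
      ← integral_add_right_eq_self (fun x => ‖F (t, x)‖) (t • v)]
    split_ifs at ht with htT
    · rw [indicator_of_mem (show t ∈ Ioo 0 T from ⟨ht0, htT⟩)]
      calc ∫ x, ‖F (t, x + t • v)‖ ≤ ∫ x, C * |τ t x| := by
            refine integral_mono_ae ?_ ((hτ.integrable t).abs.const_mul C) ?_
            · exact ((hsl t).congr (by filter_upwards [ht] with x hx; exact hx.symm)).norm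
            · filter_upwards [ht] with x hx
              simp only [hx, Real.norm_eq_abs]
              rw [abs_mul, mul_comm]
              refine mul_le_mul_of_nonneg_right ((abs_add_le _ _).trans ?_) (abs_nonneg _)
              rw [abs_mul, abs_mul]
              exact add_le_add (mul_le_mul (hk₂ t) (hK x) (abs_nonneg _)
                ((norm_nonneg _).trans (hk₂ t))) (mul_le_mul (hk₁ t) (hDW t x) (abs_nonneg _)
                ((norm_nonneg _).trans (hk₁ t)))
        _ ≤ C * M := by
            rw [integral_const_mul]
            exact mul_le_mul_of_nonneg_left (hτ.mass t)
              (add_nonneg (mul_nonneg ((norm_nonneg _).trans (hk₂ 0)) hK0.le)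
                (mul_nonneg ((norm_nonneg _).trans (hk₁ 0)) (mul_nonneg hK'0.le hL.nonneg)))
    · rw [indicator_of_notMem (fun hm => htT hm.2), integral_eq_zero_of_ae]
      filter_upwards [ht] with x hx
      simp [hx]
  have hw := h.transport φ hφs hφc
  have e0 : ∫ x, ρ₀ x * φ (0, x) = χ 0 * ∫ x, ρ₀ x * ζ x := by
    rw [← integral_const_mul]; congr 1; funext x
    simp only [hφ, hφ', shear_apply]; simp; ring
  rw [integral_positiveTimes hFint, e0] at hw
  refine Eq.trans (congrArg (· + χ 0 * ∫ x, ρ₀ x * ζ x) ?_) hw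
  refine integral_congr_ae ?_
  filter_upwards [hFt] with t ht
  rw [← integral_add_right_eq_self (fun x => F (t, x)) (t • v), integral_congr_ae ht]
  split_ifs with htT
  · rw [← integral_const_mul, ← integral_const_mul,
      ← integral_add ((hτζ t).const_mul _) ((hτD t).const_mul _)]
    congr 1; funext x; ring
  · simp [hχ0 t (not_lt.1 htT)]

/-! ### Renormalization -/

/-- The chain rule for a smooth function of the primitive of a bounded measurable function. -/
theorem comp_primitive_eq {β : ℝ → ℝ} (hβ : ContDiff ℝ ∞ β) {g : ℝ → ℝ} {C : ℝ}
    (hg : Measurable g) (hC : ∀ s, |g s| ≤ C) (A t : ℝ) :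
    β (A + ∫ s in (0 : ℝ)..t, g s)
      = β A + ∫ s in (0 : ℝ)..t, deriv β (A + ∫ r in (0 : ℝ)..s, g r) * g s := by
  have hgi := intervalIntegrable_of_bound hg hC
  set F : ℝ → ℝ := fun s => A + ∫ r in (0 : ℝ)..s, g r with hF
  have hFc : Continuous F := continuous_const.add (intervalIntegral.continuous_primitive hgi 0)
  have hFL : LipschitzOnWith (Real.toNNReal C) F (uIcc 0 t) := by
    refine LipschitzOnWith.of_dist_le_mul fun x _ y _ => ?_
    rw [Real.coe_toNNReal _ ((abs_nonneg _).trans (hC 0)), Real.dist_eq, Real.dist_eq]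
    have h1 : F x - F y = ∫ r in y..x, g r := by
      simp only [hF]
      rw [add_sub_add_left_eq_sub, intervalIntegral.integral_interval_sub_left (hgi _ _) (hgi _ _)]
    rw [h1]
    have h2 : ‖∫ r in y..x, g r‖ ≤ C * |x - y| :=
      intervalIntegral.norm_integral_le_of_norm_le_const fun r _ => hC r
    exact h2
  obtain ⟨a, b, hab⟩ : ∃ a b, F '' (uIcc 0 t) ⊆ Icc a b :=
    ⟨_, _, (isCompact_uIcc.image hFc).isBounded.subset_Icc_sInf_sSup⟩
  obtain ⟨K, hK⟩ := (hβ.of_le (m := 1) (by simp)).contDiffOn.exists_lipschitzOnWith (by decide)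
    (convex_Icc a b) isCompact_Icc
  have hac : AbsolutelyContinuousOnInterval (β ∘ F) 0 t :=
    (hK.comp hFL fun x hx => hab ⟨x, hx, rfl⟩).absolutelyContinuousOnInterval
  have h := hac.integral_deriv_eq_sub
  have hF0 : F 0 = A := by simp [hF]
  simp only [Function.comp_apply, hF0] at h
  refine (sub_eq_iff_eq_add'.1 h.symm).trans (congrArg (β A + ·) ?_)
  refine intervalIntegral.integral_congr_ae ?_
  filter_upwards [(hgi 0 t).ae_hasDerivAt_integral] with s hs hst
  have h1 : HasDerivAt F (g s) s := (hs (uIoc_subset_uIcc hst) 0 (by simp)).const_add A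
  have h2 := ((hβ.differentiable (by simp) (F s)).hasDerivAt.comp s h1).deriv
  exact h2

/-- The standard mollifier at scale `ε`, supported in the closed ball of radius `2 ε`. -/
noncomputable def mollifier (ε : ℝ) (x : Space3) : ℝ :=
  (ε ^ 3)⁻¹ * (⟨1, 2, one_pos, one_lt_two⟩ : ContDiffBump (0 : Space3)).normed volume (ε⁻¹ • x)

theorem isTest_mollifier {ε : ℝ} (hε : 0 < ε) : IsTest (mollifier ε) := by
  set b : ContDiffBump (0 : Space3) := ⟨1, 2, one_pos, one_lt_two⟩
  have hb : IsTest (b.normed volume) := ⟨b.contDiff_normed, b.hasCompactSupport_normed⟩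
  exact (hb.comp_homeomorph (Homeomorph.smulOfNeZero (ε⁻¹) (inv_pos.2 hε).ne')
    (show ContDiff ℝ ∞ fun x : Space3 => ε⁻¹ • x from contDiff_const_smul _)).const_mul _

theorem integral_mollifier {ε : ℝ} (hε : 0 < ε) : ∫ x, mollifier ε x = 1 := by
  unfold mollifier
  rw [integral_const_mul, Measure.integral_comp_inv_smul_of_nonneg _ _ hε.le,
    ContDiffBump.integral_normed]
  simp [hε.ne']

theorem exists_mollifier_bound : ∃ C : ℝ, 0 < C ∧ ∀ ε : ℝ, 0 < ε → ∀ x,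
    |mollifier ε x| ≤ C * (ε ^ 3)⁻¹ ∧ ‖fderiv ℝ (mollifier ε) x‖ ≤ C * (ε ^ 3)⁻¹ * ε⁻¹ ∧
      (2 * ε < ‖x‖ → mollifier ε x = 0 ∧ fderiv ℝ (mollifier ε) x = 0) := by
  set b : ContDiffBump (0 : Space3) := ⟨1, 2, one_pos, one_lt_two⟩ with hb'
  have hb : IsTest (b.normed volume) := ⟨b.contDiff_normed, b.hasCompactSupport_normed⟩
  obtain ⟨C₁, hC₁, h1⟩ := hb.exists_bound
  obtain ⟨C₂, hC₂, h2⟩ := hb.exists_fderiv_bound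
  refine ⟨C₁ + C₂, by positivity, fun ε hε x => ?_⟩
  have hε3 : 0 < (ε ^ 3)⁻¹ := by positivity
  have hd : fderiv ℝ (mollifier ε) x = ((ε ^ 3)⁻¹ * ε⁻¹) • fderiv ℝ (b.normed volume) (ε⁻¹ • x) := by
    have h3 : HasFDerivAt (fun y : Space3 => ε⁻¹ • y)
        (ε⁻¹ • ContinuousLinearMap.id ℝ Space3) x := (hasFDerivAt_id x).const_smul ε⁻¹
    have h4 := (((hb.differentiable (ε⁻¹ • x)).hasFDerivAt.comp x h3).const_mul ((ε ^ 3)⁻¹)).fderiv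
    have h5 : fderiv ℝ (mollifier ε) x = _ := h4
    rw [h5]
    ext w
    simp [mul_assoc]
  refine ⟨?_, ?_, fun hx => ?_⟩
  · unfold mollifier
    rw [abs_mul, abs_of_pos hε3, mul_comm]
    exact mul_le_mul_of_nonneg_right ((h1 _).trans (by linarith)) hε3.le
  · rw [hd, norm_smul, Real.norm_of_nonneg (by positivity), mul_comm, mul_assoc (C₁ + C₂)]
    exact mul_le_mul_of_nonneg_right ((h2 _).trans (by linarith)) (by positivity)
  · have hn : ε⁻¹ • x ∉ tsupport (b.normed volume) := by
      rw [b.tsupport_normed_eq, mem_closedBall_zero_iff, norm_smul,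
        Real.norm_of_nonneg (by positivity), not_le, inv_mul_eq_div, lt_div_iff₀ hε]
      exact hx
    refine ⟨?_, ?_⟩
    · unfold mollifier
      rw [image_eq_zero_of_notMem_tsupport hn, mul_zero]
    · rw [hd, fderiv_of_notMem_tsupport ℝ hn, smul_zero]

/-- A kernel of size `ε⁻³` living at scale `ε` measures the mean oscillation at scale `ε`. -/
theorem abs_integral_sub_mul_le {q k : Space3 → ℝ} (hq : LocallyIntegrable q volume) {C ε : ℝ}
    (hε : 0 < ε) (x : Space3) (hk : ∀ y, |k y| ≤ C * (ε ^ 3)⁻¹)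
    (hk0 : ∀ y, 2 * ε < ‖x - y‖ → k y = 0) :
    |∫ y, (q y - q x) * k y|
      ≤ C * 8 * ballVol 1 * ⨍ y in Metric.closedBall x (2 * ε), ‖q y - q x‖ := by
  have hmeas : MeasurableSet (Metric.closedBall x (2 * ε)) := measurableSet_closedBall
  have hi : IntegrableOn (fun y => ‖q y - q x‖) (Metric.closedBall x (2 * ε)) :=
    ((hq.sub (locallyIntegrable_const (q x))).integrableOn_isCompact
      (isCompact_closedBall _ _)).norm
  have h1 : |∫ y, (q y - q x) * k y|
      ≤ ∫ y, (Metric.closedBall x (2 * ε)).indicator (fun y => C * (ε ^ 3)⁻¹ * ‖q y - q x‖) y := by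
    rw [← Real.norm_eq_abs]
    refine norm_integral_le_of_norm_le
      ((integrable_indicator_iff hmeas).2 (hi.const_mul _)) (.of_forall fun y => ?_)
    by_cases hy : y ∈ Metric.closedBall x (2 * ε)
    · rw [indicator_of_mem hy, norm_mul, mul_comm]
      exact mul_le_mul_of_nonneg_right (hk y) (norm_nonneg _)
    · rw [indicator_of_notMem hy, hk0 y, mul_zero, norm_zero]
      rw [mem_closedBall_iff_norm', not_le] at hy
      exact hy
  refine h1.trans (le_of_eq ?_)
  rw [integral_indicator hmeas, integral_const_mul, setAverage_eq,
    Measure.addHaar_real_closedBall _ _ (by positivity)]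
  have hV : 0 < volume.real (Metric.ball (0 : Space3) 1) := volume_unitBall_pos
  unfold ballVol
  rw [smul_eq_mul]
  simp only [finrank_euclideanSpace, Fintype.card_fin]
  field_simp
  ring

theorem average_norm_sub_le {q : Space3 → ℝ} {M : ℝ} (hM : ∀ x, |q x| ≤ M) (x : Space3) (r : ℝ) :
    ⨍ y in Metric.closedBall x r, ‖q y - q x‖ ≤ 2 * M := by
  have hM0 : 0 ≤ M := (abs_nonneg _).trans (hM x)
  have h := norm_setIntegral_le_of_norm_le_const (μ := (volume : Measure Space3))
    (f := fun y => ‖q y - q x‖) (s := Metric.closedBall x r) (C := 2 * M)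
    measure_closedBall_lt_top (fun y _ => by
      rw [norm_norm]
      refine (norm_sub_le _ _).trans ?_
      rw [Real.norm_eq_abs, Real.norm_eq_abs]
      linarith [hM x, hM y])
  rw [setAverage_eq, smul_eq_mul]
  have h' := (le_abs_self _).trans h
  rcases eq_or_lt_of_le (measureReal_nonneg (μ := (volume : Measure Space3))
    (s := Metric.closedBall x r)) with h0 | h0
  · rw [← h0, inv_zero, zero_mul]; positivity
  · rw [inv_mul_eq_div, div_le_iff₀ h0]; exact h'

/-- The rate of change of `∫ q(y) η(x - y) dy` when the density `q` is transported by `w`. -/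
noncomputable def smearedFlux (η q : Space3 → ℝ) (w : Space3 → Space3) (x : Space3) : ℝ :=
  ∫ y, q y * fderiv ℝ (fun z => η (x - z)) y (w y)

/-- The commutator between transport by `w` and convolution with `η`. -/
noncomputable def transportCommutator (η q : Space3 → ℝ) (w : Space3 → Space3) (x : Space3) : ℝ :=
  ∫ y, (q y - q x) * fderiv ℝ η (x - y) (w x - w y)

theorem LipField.integrable_fderiv {L : ℝ} {W : ℝ → Space3 → Space3} (hL : LipField L W) (t : ℝ)
    {φ : Space3 → ℝ} (hφ : IsTest φ) : Integrable fun x => fderiv ℝ φ x (W t x) := by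
  refine ((hφ.smooth.continuous_fderiv (by simp)).clm_apply
    (hL.continuous t)).integrable_of_hasCompactSupport
    ((hφ.supp.fderiv (𝕜 := ℝ)).mono fun z hz => ?_)
  rw [Function.mem_support] at hz ⊢
  intro h0; apply hz; rw [h0]; rfl

/-- Since `w` is divergence free, the commutator only sees the oscillation of the density. -/
theorem smearedFlux_eq {L : ℝ} {W : ℝ → Space3 → Space3} (hL : LipField L W) (t : ℝ)
    {q η : Space3 → ℝ} (hq : Integrable q) (hη : IsTest η) (x : Space3) :
    smearedFlux η q (W t) x
      = -fderiv ℝ (smear q η) x (W t x) + transportCommutator η q (W t) x := by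
  obtain ⟨K, hK0, hK⟩ := hη.exists_fderiv_bound
  have hηc := hη.smooth.continuous_fderiv (by simp)
  have hWc := hL.continuous t
  have hηx : IsTest fun z => η (x - z) := hη.comp_sub_left x
  have hsub : ∀ y w, fderiv ℝ (fun z => η (x - z)) y w = -fderiv ℝ η (x - y) w := fun y w => by
    rw [fderiv_comp_sub_left hη.differentiable]; rfl
  have hc1 : Continuous fun y => fderiv ℝ η (x - y) (W t x) :=
    (hηc.comp (continuous_const.sub continuous_id)).clm_apply continuous_const
  have hc2 : Continuous fun y => fderiv ℝ η (x - y) (W t y) :=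
    (hηc.comp (continuous_const.sub continuous_id)).clm_apply hWc
  have hb : ∀ y z, |fderiv ℝ η (x - y) (W t z)| ≤ K * L := fun y z =>
    ((fderiv ℝ η (x - y)).le_opNorm _).trans
      (mul_le_mul (hK _) (hL.bound t z) (norm_nonneg _) hK0.le)
  have i1 : Integrable fun y => q y * fderiv ℝ η (x - y) (W t x) :=
    hq.mul_bdd hc1.aestronglyMeasurable (.of_forall fun y => hb y x)
  have i2 : Integrable fun y => q y * fderiv ℝ η (x - y) (W t y) :=
    hq.mul_bdd hc2.aestronglyMeasurable (.of_forall fun y => hb y y)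
  have j2 : Integrable fun y => fderiv ℝ η (x - y) (W t y) := by
    refine (hL.integrable_fderiv t hηx).neg.congr (.of_forall fun y => ?_)
    simp only [Pi.neg_apply, hsub, neg_neg]
  have j1 : Integrable fun y => fderiv ℝ η (x - y) (W t x) := by
    have : Integrable fun y => fderiv ℝ η y (W t x) := by
      refine (hηc.clm_apply continuous_const).integrable_of_hasCompactSupport
        ((hη.supp.fderiv (𝕜 := ℝ)).mono fun z hz => ?_)
      rw [Function.mem_support] at hz ⊢
      intro h0; apply hz; rw [h0]; rfl
    exact this.comp_sub_left x
  have z1 : ∫ y, fderiv ℝ η (x - y) (W t x) = 0 := by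
    rw [integral_sub_left_eq_self (fun y => fderiv ℝ η y (W t x)) volume x]
    exact hη.integral_fderiv _
  have z2 : ∫ y, fderiv ℝ η (x - y) (W t y) = 0 := by
    have := hL.incompressible t _ hηx
    simp only [hsub, integral_neg, neg_eq_zero] at this
    exact this
  have hcomm : transportCommutator η q (W t) x = (∫ y, q y * fderiv ℝ η (x - y) (W t x))
      - (∫ y, q y * fderiv ℝ η (x - y) (W t y))
      - q x * ((∫ y, fderiv ℝ η (x - y) (W t x)) - ∫ y, fderiv ℝ η (x - y) (W t y)) := by
    have e := integral_sub (i1.sub i2) ((j1.sub j2).const_mul (q x))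
    simp only [Pi.sub_apply] at e
    rw [← integral_sub i1 i2, ← integral_sub j1 j2, ← integral_const_mul, ← e]
    unfold transportCommutator
    congr 1; funext y
    rw [map_sub]; ring
  rw [hcomm, z1, z2, fderiv_smear hq.locallyIntegrable hη]
  unfold smearedFlux
  simp only [hsub, mul_neg, integral_neg]
  ring

/-- The chain rule for the mollified density, up to the commutator. -/
theorem integral_deriv_smearedFlux {L : ℝ} {W : ℝ → Space3 → Space3} (hL : LipField L W) (t : ℝ)
    {q η ζ β : _} (hq : Integrable q) (hη : IsTest η) (hζ : IsTest ζ) (hβ : ContDiff ℝ ∞ β)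
    (hint : Integrable fun x => deriv β (smear q η x) * smearedFlux η q (W t) x * ζ x) :
    (Integrable fun x => deriv β (smear q η x) * transportCommutator η q (W t) x * ζ x) ∧
    ∫ x, deriv β (smear q η x) * smearedFlux η q (W t) x * ζ x
      = (∫ x, β (smear q η x) * fderiv ℝ ζ x (W t x))
        + ∫ x, deriv β (smear q η x) * transportCommutator η q (W t) x * ζ x := by
  have hf : ContDiff ℝ ∞ (smear q η) := contDiff_smear hq.locallyIntegrable hη
  have hβf : ContDiff ℝ ∞ fun x => β (smear q η x) := hβ.comp hf
  have hψ : IsTest fun x => β (smear q η x) * ζ x := ⟨hβf.mul hζ.smooth, hζ.supp.mul_left⟩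
  have hd : ∀ x, fderiv ℝ (fun x => β (smear q η x) * ζ x) x (W t x)
      = deriv β (smear q η x) * fderiv ℝ (smear q η) x (W t x) * ζ x
        + β (smear q η x) * fderiv ℝ ζ x (W t x) := by
    intro x
    have h1 : HasFDerivAt (fun x => β (smear q η x)) _ x :=
      (hβ.differentiable (by simp) _).hasDerivAt.comp_hasFDerivAt x
        (hf.differentiable (by simp) x).hasFDerivAt
    have h2 : fderiv ℝ (fun x => β (smear q η x) * ζ x) x = _ :=
      (h1.mul (hζ.differentiable x).hasFDerivAt).fderiv
    rw [h2]
    simp; ring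
  have hψi := hL.integrable_fderiv t hψ
  have hψ0 := hL.incompressible t _ hψ
  have hB : Integrable fun x => β (smear q η x) * fderiv ℝ ζ x (W t x) := by
    have h1 := (hL.continuous t)
    have h2 := hζ.smooth.continuous_fderiv (by simp)
    refine (hβf.continuous.mul (h2.clm_apply h1)).integrable_of_hasCompactSupport
      ((hζ.supp.fderiv (𝕜 := ℝ)).mono fun z hz => ?_)
    rw [Function.mem_support] at hz ⊢
    intro h0; apply hz; change β _ * fderiv ℝ ζ z _ = 0; rw [h0]; simp
  have hpt : ∀ x, deriv β (smear q η x) * transportCommutator η q (W t) x * ζ x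
      = deriv β (smear q η x) * smearedFlux η q (W t) x * ζ x
        - β (smear q η x) * fderiv ℝ ζ x (W t x)
        + fderiv ℝ (fun x => β (smear q η x) * ζ x) x (W t x) := by
    intro x
    rw [hd, smearedFlux_eq hL t hq hη]; ring
  simp only [hpt]
  refine ⟨(hint.sub hB).add hψi, ?_⟩
  have e1 := integral_add (hint.sub hB) hψi
  have e2 := integral_sub hint hB
  simp only [Pi.sub_apply] at e1
  rw [e1, e2, hψ0]
  ring

/-- The scales of the mollification. -/
noncomputable def scale (n : ℕ) : ℝ := 1 / ((n : ℝ) + 1)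

theorem scale_pos (n : ℕ) : 0 < scale n := by unfold scale; positivity

/-- The mean oscillation of `q` around `x` at the `n`-th scale. -/
noncomputable def meanOscillation (q : Space3 → ℝ) (n : ℕ) (x : Space3) : ℝ :=
  ⨍ y in Metric.closedBall x (2 * scale n), ‖q y - q x‖

theorem meanOscillation_nonneg (q : Space3 → ℝ) (n : ℕ) (x : Space3) : 0 ≤ meanOscillation q n x :=
  integral_nonneg fun _ => norm_nonneg _

theorem ae_tendsto_oscillation {q : Space3 → ℝ} (hq : LocallyIntegrable q volume) :
    ∀ᵐ x, Tendsto (fun n => meanOscillation q n x) atTop (𝓝 0) := by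
  filter_upwards [IsUnifLocDoublingMeasure.ae_tendsto_average_norm_sub (volume : Measure Space3)
    hq 1] with x hx
  refine hx (fun _ => x) (fun n => 2 * scale n) ?_ (.of_forall fun n => ?_)
  · rw [tendsto_nhdsWithin_iff]
    refine ⟨?_, .of_forall fun n => mul_pos two_pos (scale_pos n)⟩
    have := (tendsto_one_div_add_atTop_nhds_zero_nat (𝕜 := ℝ)).const_mul 2
    rw [mul_zero] at this; exact this
  · exact Metric.mem_closedBall_self (by have := scale_pos n; positivity)

/-- Mollification moves a density, and creates commutators, at most in proportion to the mean
oscillation. -/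
theorem exists_oscillation_bound {L : ℝ} {W : ℝ → Space3 → Space3} (hL : LipField L W) :
    ∃ C : ℝ, 0 ≤ C ∧ ∀ {q : Space3 → ℝ}, Integrable q → ∀ (t : ℝ) (n : ℕ) (x : Space3),
      |smear q (mollifier (scale n)) x - q x| ≤ C * meanOscillation q n x ∧
      |transportCommutator (mollifier (scale n)) q (W t) x| ≤ C * meanOscillation q n x := by
  obtain ⟨C, hC0, hC⟩ := exists_mollifier_bound
  have hV : 0 < ballVol 1 := ballVol_pos one_pos
  have hL0 := hL.nonneg
  refine ⟨(C + C * L * 2) * 8 * ballVol 1, by positivity, fun {q} hq t n x => ?_⟩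
  have hε := scale_pos n
  set ε := scale n
  have ho := meanOscillation_nonneg q n x
  have hε3 : 0 < (ε ^ 3)⁻¹ := by positivity
  have hη := isTest_mollifier hε
  constructor
  · have hηx := hη.comp_sub_left x
    have h1 : smear q (mollifier ε) x - q x = ∫ y, (q y - q x) * mollifier ε (x - y) := by
      simp only [sub_mul]
      rw [integral_sub (hηx.integrable_mul hq.locallyIntegrable) (hηx.integrable.const_mul _),
        integral_const_mul, integral_sub_left_eq_self (mollifier ε) volume x,
        integral_mollifier hε, mul_one]
      rfl
    rw [h1]
    refine (abs_integral_sub_mul_le hq.locallyIntegrable hε x (C := C)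
      (fun y => (hC ε hε (x - y)).1) fun y hy => ((hC ε hε (x - y)).2.2 hy).1).trans ?_
    refine mul_le_mul_of_nonneg_right ?_ ho
    gcongr
    linarith [mul_nonneg hC0.le hL0]
  · refine (abs_integral_sub_mul_le hq.locallyIntegrable hε x (C := C * L * 2)
      (k := fun y => fderiv ℝ (mollifier ε) (x - y) (W t x - W t y))
      (fun y => ?_) fun y hy => by rw [((hC ε hε (x - y)).2.2 hy).2]; rfl).trans ?_
    · rcases lt_or_ge (2 * ε) ‖x - y‖ with hy | hy
      · rw [((hC ε hε (x - y)).2.2 hy).2]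
        simp only [zero_apply, abs_zero]; positivity
      · calc |fderiv ℝ (mollifier ε) (x - y) (W t x - W t y)|
            ≤ ‖fderiv ℝ (mollifier ε) (x - y)‖ * ‖W t x - W t y‖ :=
              (fderiv ℝ (mollifier ε) (x - y)).le_opNorm _
          _ ≤ (C * (ε ^ 3)⁻¹ * ε⁻¹) * (L * (2 * ε)) := by
              refine mul_le_mul (hC ε hε (x - y)).2.1 ?_ (norm_nonneg _) (by positivity)
              exact (hL.lipschitz t x y).trans (mul_le_mul_of_nonneg_left hy hL0)
          _ = C * L * 2 * (ε ^ 3)⁻¹ := by field_simp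
    · refine mul_le_mul_of_nonneg_right ?_ ho
      gcongr
      linarith

theorem BddFamily.measurable_smear {M : ℝ} {τ : ℝ → Space3 → ℝ} (hτ : BddFamily M τ)
    {η : Space3 → ℝ} (hη : IsTest η) :
    Measurable fun z : ℝ × Space3 => smear (τ z.1) η z.2 := by
  have h1 : Measurable fun w : (ℝ × Space3) × Space3 => τ w.1.1 w.2 * η (w.1.2 - w.2) :=
    (hτ.measurable.comp (by fun_prop : Measurable fun w : (ℝ × Space3) × Space3 => (w.1.1, w.2))).mul
      (hη.continuous.measurable.comp (by fun_prop))
  exact h1.stronglyMeasurable.integral_prod_right'.measurable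

theorem BddFamily.measurable_smearedFlux {M L : ℝ} {τ : ℝ → Space3 → ℝ} (hτ : BddFamily M τ)
    {W : ℝ → Space3 → Space3} (hL : LipField L W) {η : Space3 → ℝ} (hη : IsTest η) :
    Measurable fun z : ℝ × Space3 => smearedFlux η (τ z.1) (W z.1) z.2 := by
  have hm : Measurable fun w : (ℝ × Space3) × Space3 => (w.1.1, w.2) := by fun_prop
  have hc : Continuous fun q : Space3 × Space3 => fderiv ℝ η q.1 q.2 :=
    ((hη.smooth.continuous_fderiv (by simp)).comp continuous_fst).clm_apply continuous_snd
  have h2 : Measurable fun w : (ℝ × Space3) × Space3 =>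
      fderiv ℝ (fun z => η (w.1.2 - z)) w.2 (W w.1.1 w.2) := by
    have : (fun w : (ℝ × Space3) × Space3 => fderiv ℝ (fun z => η (w.1.2 - z)) w.2 (W w.1.1 w.2))
        = fun w => -fderiv ℝ η (w.1.2 - w.2) (W w.1.1 w.2) := by
      funext w; rw [fderiv_comp_sub_left hη.differentiable]; rfl
    rw [this]
    exact (hc.measurable.comp
      ((by fun_prop : Measurable fun w : (ℝ × Space3) × Space3 => w.1.2 - w.2).prodMk
        (hL.measurable.comp hm))).neg
  exact ((hτ.measurable.comp hm).mul h2).stronglyMeasurable.integral_prod_right'.measurable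

theorem BddFamily.exists_smear_bound {M L : ℝ} {τ : ℝ → Space3 → ℝ} (hτ : BddFamily M τ)
    {W : ℝ → Space3 → Space3} (hL : LipField L W) {η : Space3 → ℝ} (hη : IsTest η) :
    ∃ C, ∀ t x, |smear (τ t) η x| ≤ C ∧ |smearedFlux η (τ t) (W t) x| ≤ C := by
  obtain ⟨K, hK0, hK⟩ := hη.exists_bound
  obtain ⟨K', hK'0, hK'⟩ := hη.exists_fderiv_bound
  refine ⟨max (K * M) (K' * L * M), fun t x => ⟨?_, ?_⟩⟩
  · exact (hτ.abs_integral_mul_le t fun y => hK (x - y)).trans (le_max_left _ _)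
  · refine (hτ.abs_integral_mul_le t fun y => ?_).trans (le_max_right _ _)
    rw [fderiv_comp_sub_left hη.differentiable]
    refine ((-fderiv ℝ η (x - y)).le_opNorm (W t y)).trans ?_
    rw [norm_neg]
    exact mul_le_mul (hK' _) (hL.bound t y) (norm_nonneg _) hK'0.le

theorem exists_abs_le_of_continuous {β : ℝ → ℝ} (hβ : Continuous β) (A : ℝ) :
    ∃ B, 0 ≤ B ∧ ∀ s, |s| ≤ A → |β s| ≤ B := by
  obtain ⟨B, hB⟩ := (isCompact_Icc (a := -A) (b := A)).exists_bound_of_continuousOn hβ.continuousOn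
  exact ⟨max B 0, le_max_right _ _, fun s hs => (hB s (abs_le.1 hs)).trans (le_max_left _ _)⟩

theorem contDiff_deriv_of_contDiff {β : ℝ → ℝ} (hβ : ContDiff ℝ ∞ β) : ContDiff ℝ ∞ (deriv β) :=
  (contDiff_infty_iff_deriv.1 hβ).2

/-- The transport equation, for a smooth function of the mollified density. -/
theorem WeakTransport.mollified {T M L : ℝ} {W : ℝ → Space3 → Space3} {τ₀ : Space3 → ℝ}
    {τ : ℝ → Space3 → ℝ} (h : WeakTransport T W τ₀ τ) (hL : LipField L W) (hτ : BddFamily M τ)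
    (hτ₀ : Integrable τ₀) {η ζ : Space3 → ℝ} (hη : IsTest η) (hζ : IsTest ζ) {β : ℝ → ℝ}
    (hβ : ContDiff ℝ ∞ β) :
    ∀ᵐ t ∂((volume : Measure ℝ).restrict (Ioo 0 T)),
      ∫ x, β (smear (τ t) η x) * ζ x = (∫ x, β (smear τ₀ η x) * ζ x)
        + ∫ s in (0 : ℝ)..t, ∫ x,
            deriv β (smear (τ s) η x) * smearedFlux η (τ s) (W s) x * ζ x := by
  obtain ⟨C, hC⟩ := hτ.exists_smear_bound hL hη
  have hβ' := contDiff_deriv_of_contDiff hβ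
  obtain ⟨B, hB0, hB⟩ := exists_abs_le_of_continuous hβ'.continuous C
  have hC0 : 0 ≤ C := (abs_nonneg _).trans (hC 0 0).1
  have hfm := hτ.measurable_smear hη
  have hgm := hτ.measurable_smearedFlux hL hη
  set f : ℝ → Space3 → ℝ := fun t x => smear (τ t) η x
  set g : ℝ → Space3 → ℝ := fun t x => smearedFlux η (τ t) (W t) x
  set f₀ : Space3 → ℝ := smear τ₀ η
  set H : ℝ → Space3 → ℝ := fun s x => deriv β (f s x) * g s x with hH
  have hHm : Measurable fun z : ℝ × Space3 => H z.1 z.2 :=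
    (hβ'.continuous.measurable.comp hfm).mul hgm
  have hHB : ∀ s x, |H s x| ≤ B * C := fun s x => by
    simp only [hH]; rw [abs_mul]
    exact mul_le_mul (hB _ (hC s x).1) (hC s x).2 (abs_nonneg _) hB0
  have hf₀ : Continuous f₀ := (contDiff_smear hτ₀.locallyIntegrable hη).continuous
  -- the equation at a fixed point, for almost every time
  have h1 : ∀ x, ∀ᵐ t ∂((volume : Measure ℝ).restrict (Ioo 0 T)),
      β (f t x) = β (f₀ x) + t * ∫ r in (0 : ℝ)..1, H (t * r) x := by
    intro x
    have hw := h _ (hη.comp_sub_left x)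
    have hgx : Measurable fun s => g s x := hgm.comp (by fun_prop : Measurable fun s : ℝ => (s, x))
    filter_upwards [hw, ae_restrict_mem measurableSet_Ioo] with t ht htT
    have e1 : f t x = f₀ x + ∫ s in (0 : ℝ)..t, g s x := ht
    rw [e1, comp_primitive_eq hβ hgx (fun s => (hC s x).2),
      intervalIntegral.mul_integral_comp_mul_left (f := fun s => H s x), mul_zero, mul_one]
    congr 1
    refine intervalIntegral.integral_congr_ae ?_
    rw [ae_restrict_iff' measurableSet_Ioo] at hw
    filter_upwards [hw] with s hs hst
    rw [uIoc_of_le htT.1.le] at hst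
    have e2 : f s x = f₀ x + ∫ r in (0 : ℝ)..s, g r x := hs ⟨hst.1, hst.2.trans_lt htT.2⟩
    simp only [hH]
    rw [e2]
  have hswap : ∀ᵐ t ∂((volume : Measure ℝ).restrict (Ioo 0 T)), ∀ᵐ x : Space3,
      β (f t x) = β (f₀ x) + t * ∫ r in (0 : ℝ)..1, H (t * r) x := by
    rw [Measure.ae_ae_comm]
    · exact .of_forall h1
    · refine measurableSet_eq_fun (hβ.continuous.measurable.comp hfm)
        ((hβ.continuous.measurable.comp (hf₀.measurable.comp measurable_snd)).add
          (measurable_fst.mul ?_))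
      simp only [intervalIntegral.integral_of_le zero_le_one]
      have : Measurable fun w : (ℝ × Space3) × ℝ => H (w.1.1 * w.2) w.1.2 :=
        hHm.comp (by fun_prop : Measurable fun w : (ℝ × Space3) × ℝ => (w.1.1 * w.2, w.1.2))
      exact this.stronglyMeasurable.integral_prod_right'.measurable
  filter_upwards [hswap, ae_restrict_mem measurableSet_Ioo] with t ht htT
  have hHζ : Integrable (Function.uncurry fun s x => H s x * ζ x)
      (((volume : Measure ℝ).restrict (uIoc 0 t)).prod volume) := by
    rw [uIoc_of_le htT.1.le]
    refine Integrable.mono' (g := fun z : ℝ × Space3 => B * C * |ζ z.2|) ?_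
      (hHm.mul (hζ.continuous.measurable.comp measurable_snd)).aestronglyMeasurable
      (.of_forall fun z => ?_)
    · exact Integrable.mul_prod (f := fun _ : ℝ => B * C) (g := fun x => |ζ x|)
        (integrable_const _) hζ.integrable.abs
    · simp only [Function.uncurry, norm_mul, Real.norm_eq_abs]
      exact mul_le_mul_of_nonneg_right (hHB _ _) (abs_nonneg _)
  have e3 : ∀ᵐ x : Space3, β (f t x) * ζ x
      = β (f₀ x) * ζ x + ∫ s in (0 : ℝ)..t, H s x * ζ x := by
    filter_upwards [ht] with x hx
    rw [hx, intervalIntegral.mul_integral_comp_mul_left (f := fun s => H s x), mul_zero, mul_one,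
      intervalIntegral.integral_mul_const]
    ring
  rw [integral_congr_ae e3, intervalIntegral_integral_swap hHζ, ← integral_add]
  · refine ((hβ.continuous.comp hf₀).mul hζ.continuous).integrable_of_hasCompactSupport
      hζ.supp.mul_left
  · have := hHζ.integral_prod_right
    rw [uIoc_of_le htT.1.le] at this
    simp only [intervalIntegral.integral_of_le htT.1.le]
    exact this

/-- Convergence of nonlinear functions of the mollified density. -/
theorem tendsto_integral_comp_smear {L : ℝ} {W : ℝ → Space3 → Space3} (hL : LipField L W)
    {M : ℝ} {β : ℝ → ℝ} (hβ : Continuous β) :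
    ∃ B, 0 ≤ B ∧ ∀ {q : Space3 → ℝ}, Integrable q → (∀ x, |q x| ≤ M) →
      (∀ n x, |β (smear q (mollifier (scale n)) x)| ≤ B) ∧
      ∀ {G : Space3 → ℝ}, Integrable G →
        Tendsto (fun n => ∫ x, β (smear q (mollifier (scale n)) x) * G x) atTop
          (𝓝 (∫ x, β (q x) * G x)) := by
  obtain ⟨C, hC0, hC⟩ := exists_oscillation_bound hL
  obtain ⟨B, hB0, hB⟩ := exists_abs_le_of_continuous hβ (M + C * (2 * M))
  refine ⟨B, hB0, fun {q} hq hqM => ?_⟩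
  have hbd : ∀ n x, |β (smear q (mollifier (scale n)) x)| ≤ B := by
    intro n x
    refine hB _ ?_
    have h1 := (hC hq 0 n x).1
    have h2 := h1.trans (mul_le_mul_of_nonneg_left (average_norm_sub_le hqM x _) hC0)
    have h3 := abs_add_le (smear q (mollifier (scale n)) x - q x) (q x)
    rw [sub_add_cancel] at h3
    linarith [hqM x]
  refine ⟨hbd, fun {G} hG => ?_⟩
  refine tendsto_integral_of_dominated_convergence (fun x => B * |G x|) (fun n => ?_)
    (hG.abs.const_mul B) (fun n => .of_forall fun x => ?_) ?_
  · exact (hβ.comp (contDiff_smear hq.locallyIntegrable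
      (isTest_mollifier (scale_pos n))).continuous).aestronglyMeasurable.mul hG.1
  · rw [norm_mul]; exact mul_le_mul_of_nonneg_right (hbd n x) (norm_nonneg _)
  · filter_upwards [ae_tendsto_oscillation hq.locallyIntegrable] with x hx
    have h1 : Tendsto (fun n => smear q (mollifier (scale n)) x - q x) atTop (𝓝 0) :=
      squeeze_zero_norm (fun n => (hC hq 0 n x).1) (by simpa using hx.const_mul C)
    have h2 := h1.add_const (q x)
    simp only [sub_add_cancel, zero_add] at h2
    exact ((hβ.tendsto _).comp h2).mul_const _

/-- The fluxes of the mollified densities converge, with a bound uniform in time. -/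
theorem BddFamily.tendsto_integral_smearedFlux {M L : ℝ} {τ : ℝ → Space3 → ℝ} (hτ : BddFamily M τ)
    {W : ℝ → Space3 → Space3} (hL : LipField L W) {ζ : Space3 → ℝ} (hζ : IsTest ζ) {β : ℝ → ℝ}
    (hβ : ContDiff ℝ ∞ β) :
    ∃ K, ∀ t, (∀ n, |∫ x, deriv β (smear (τ t) (mollifier (scale n)) x)
        * smearedFlux (mollifier (scale n)) (τ t) (W t) x * ζ x| ≤ K) ∧
      Tendsto (fun n => ∫ x, deriv β (smear (τ t) (mollifier (scale n)) x)
        * smearedFlux (mollifier (scale n)) (τ t) (W t) x * ζ x) atTop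
        (𝓝 (∫ x, β (τ t x) * fderiv ℝ ζ x (W t x))) := by
  have hβ' := contDiff_deriv_of_contDiff hβ
  obtain ⟨C, hC0, hC⟩ := exists_oscillation_bound hL
  obtain ⟨B, hB0, hB⟩ := tendsto_integral_comp_smear hL (M := M) hβ.continuous
  obtain ⟨B', hB'0, hB'⟩ := tendsto_integral_comp_smear hL (M := M) hβ'.continuous
  have hD : Integrable fun x => ‖fderiv ℝ ζ x‖ :=
    ((hζ.smooth.continuous_fderiv (by simp)).integrable_of_hasCompactSupport
      (hζ.supp.fderiv (𝕜 := ℝ))).norm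
  have hL0 := hL.nonneg
  have hint : ∀ t n, Integrable fun x => deriv β (smear (τ t) (mollifier (scale n)) x)
        * smearedFlux (mollifier (scale n)) (τ t) (W t) x * ζ x := by
    intro t n
    have hη := isTest_mollifier (scale_pos n)
    obtain ⟨C₁, hC₁⟩ := hτ.exists_smear_bound hL hη
    have m1 : Measurable fun x => smearedFlux (mollifier (scale n)) (τ t) (W t) x :=
      (hτ.measurable_smearedFlux hL hη).comp measurable_prodMk_left
    have m2 := (hβ'.continuous.comp (contDiff_smear (hτ.integrable t).locallyIntegrable
      hη).continuous).measurable
    refine hζ.integrable.bdd_mul (c := B' * C₁) (m2.mul m1).aestronglyMeasurable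
      (.of_forall fun x => ?_)
    rw [norm_mul]
    exact mul_le_mul ((hB' (hτ.integrable t) (hτ.bound t)).1 n x) (hC₁ t x).2 (abs_nonneg _) hB'0
  have hcomm : ∀ t n x, |deriv β (smear (τ t) (mollifier (scale n)) x)
      * transportCommutator (mollifier (scale n)) (τ t) (W t) x * ζ x|
      ≤ B' * (C * meanOscillation (τ t) n x) * |ζ x| := by
    intro t n x
    rw [abs_mul, abs_mul]
    refine mul_le_mul_of_nonneg_right ?_ (abs_nonneg _)
    exact mul_le_mul ((hB' (hτ.integrable t) (hτ.bound t)).1 n x)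
      (hC (hτ.integrable t) t n x).2 (abs_nonneg _) hB'0
  have hcomm2 : ∀ t n x, B' * (C * meanOscillation (τ t) n x) * |ζ x|
      ≤ B' * (C * (2 * M)) * |ζ x| := by
    intro t n x
    have := average_norm_sub_le (hτ.bound t) x (2 * scale n)
    exact mul_le_mul_of_nonneg_right (mul_le_mul_of_nonneg_left
      (mul_le_mul_of_nonneg_left this hC0) hB'0) (abs_nonneg _)
  refine ⟨(∫ x, B * (L * ‖fderiv ℝ ζ x‖)) + ∫ x, B' * (C * (2 * M)) * |ζ x|, fun t => ⟨fun n => ?_, ?_⟩⟩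
  · have hst := integral_deriv_smearedFlux hL t (hτ.integrable t)
      (isTest_mollifier (scale_pos n)) hζ hβ (hint t n)
    rw [hst.2]
    refine (abs_add_le _ _).trans (add_le_add ?_ ?_)
    · rw [← Real.norm_eq_abs]
      refine norm_integral_le_of_norm_le ((hD.const_mul L).const_mul B) (.of_forall fun x => ?_)
      rw [norm_mul]
      refine mul_le_mul ((hB (hτ.integrable t) (hτ.bound t)).1 n x) ?_ (norm_nonneg _) hB0
      refine ((fderiv ℝ ζ x).le_opNorm _).trans ?_
      rw [mul_comm]
      exact mul_le_mul_of_nonneg_right (hL.bound t x) (norm_nonneg _)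
    · rw [← Real.norm_eq_abs]
      exact norm_integral_le_of_norm_le (hζ.integrable.abs.const_mul (B' * (C * (2 * M))))
        (.of_forall fun x => (hcomm t n x).trans (hcomm2 t n x))
  · have hst := fun n => integral_deriv_smearedFlux hL t (hτ.integrable t)
      (isTest_mollifier (scale_pos n)) hζ hβ (hint t n)
    have e : ∀ n, _ := fun n => (hst n).2
    simp only [e]
    rw [← add_zero (∫ x, β (τ t x) * fderiv ℝ ζ x (W t x))]
    refine ((hB (hτ.integrable t) (hτ.bound t)).2 (hL.integrable_fderiv t hζ)).add ?_
    rw [← integral_zero Space3 ℝ (μ := volume)]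
    refine tendsto_integral_of_dominated_convergence (fun x => B' * (C * (2 * M)) * |ζ x|)
      (fun n => (hst n).1.1) (hζ.integrable.abs.const_mul _)
      (fun n => .of_forall fun x => (hcomm t n x).trans (hcomm2 t n x)) ?_
    filter_upwards [ae_tendsto_oscillation (hτ.integrable t).locallyIntegrable] with x hx
    refine squeeze_zero_norm (fun n => hcomm t n x) ?_
    simpa using ((hx.const_mul C).const_mul B').mul_const |ζ x|

/-- Smooth functions of a bounded transported density are transported. -/
theorem WeakTransport.renormalize {T M L : ℝ} {W : ℝ → Space3 → Space3} {τ₀ : Space3 → ℝ}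
    {τ : ℝ → Space3 → ℝ} (h : WeakTransport T W τ₀ τ) (hL : LipField L W) (hτ : BddFamily M τ)
    (hτ₀ : Integrable τ₀) (hτ₀M : ∀ x, |τ₀ x| ≤ M) {β : ℝ → ℝ} (hβ : ContDiff ℝ ∞ β) :
    WeakTransport T W (fun x => β (τ₀ x)) (fun t x => β (τ t x)) := by
  intro ζ hζ
  obtain ⟨K, hK⟩ := hτ.tendsto_integral_smearedFlux hL hζ hβ
  obtain ⟨B, -, hB⟩ := tendsto_integral_comp_smear hL (M := M) hβ.continuous
  have hβ' := contDiff_deriv_of_contDiff hβ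
  have hall := ae_all_iff.2 fun n : ℕ =>
    h.mollified hL hτ hτ₀ (isTest_mollifier (scale_pos n)) hζ hβ
  filter_upwards [hall] with t ht
  refine tendsto_nhds_unique ((hB (hτ.integrable t) (hτ.bound t)).2 hζ.integrable) ?_
  simp only [ht]
  refine ((hB hτ₀ hτ₀M).2 hζ.integrable).add ?_
  refine intervalIntegral.tendsto_integral_filter_of_dominated_convergence (fun _ => K)
    (.of_forall fun n => ?_) (.of_forall fun n => .of_forall fun s _ => (hK s).1 n)
    intervalIntegrable_const (.of_forall fun s _ => (hK s).2)
  have hη := isTest_mollifier (scale_pos n)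
  exact (((hβ'.continuous.measurable.comp (hτ.measurable_smear hη)).mul
    (hτ.measurable_smearedFlux hL hη)).mul (hζ.continuous.measurable.comp
      measurable_snd)).stronglyMeasurable.integral_prod_right'.aestronglyMeasurable

/-! ### Conservation of mass and of the range of the density -/

theorem BddFamily.mono {M M' : ℝ} {τ : ℝ → Space3 → ℝ} (h : BddFamily M τ) (hM : M ≤ M') :
    BddFamily M' τ :=
  ⟨h.measurable, fun t x => (h.bound t x).trans hM, h.integrable, fun t => (h.mass t).trans hM⟩

/-- Smooth cutoffs on larger and larger balls, with gradients tending to zero. -/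
theorem exists_cutoff : ∃ (χ : ℕ → Space3 → ℝ) (C : ℝ), (∀ n, IsTest (χ n)) ∧
    (∀ n x, |χ n x| ≤ 1) ∧ (∀ n x, ‖fderiv ℝ (χ n) x‖ ≤ C * scale n) ∧
    ∀ x, Tendsto (fun n => χ n x) atTop (𝓝 1) := by
  set b : ContDiffBump (0 : Space3) := ⟨1, 2, one_pos, one_lt_two⟩ with hb'
  have hb : IsTest b := ⟨b.contDiff, b.hasCompactSupport⟩
  obtain ⟨C, hC0, hC⟩ := hb.exists_fderiv_bound
  refine ⟨fun n x => b (scale n • x), C, fun n => ?_, fun n x => ?_, fun n x => ?_, fun x => ?_⟩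
  · exact hb.comp_homeomorph (Homeomorph.smulOfNeZero (scale n) (scale_pos n).ne')
      (show ContDiff ℝ ∞ fun x : Space3 => scale n • x from contDiff_const_smul _)
  · rw [abs_of_nonneg b.nonneg]; exact b.le_one
  · have h3 : HasFDerivAt (fun y : Space3 => scale n • y)
        (scale n • ContinuousLinearMap.id ℝ Space3) x := (hasFDerivAt_id x).const_smul (scale n)
    have h4 : fderiv ℝ (fun x => b (scale n • x)) x = _ :=
      ((hb.differentiable (scale n • x)).hasFDerivAt.comp x h3).fderiv
    rw [h4, ContinuousLinearMap.comp_smul, norm_smul, Real.norm_of_nonneg (scale_pos n).le,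
      mul_comm, ContinuousLinearMap.comp_id]
    exact mul_le_mul_of_nonneg_right (hC _) (scale_pos n).le
  · have h1 : Tendsto (fun n => scale n • x) atTop (𝓝 ((0 : ℝ) • x)) :=
      (tendsto_one_div_add_atTop_nhds_zero_nat (𝕜 := ℝ)).smul_const x
    rw [zero_smul] at h1
    have h2 := (b.continuous.tendsto 0).comp h1
    rwa [b.one_of_mem_closedBall (Metric.mem_closedBall_self b.rIn_pos.le)] at h2

/-- Conservation of mass: test with cutoff functions whose gradients tend to zero. -/
theorem WeakTransport.integral_eq {T M L : ℝ} {W : ℝ → Space3 → Space3} {τ₀ : Space3 → ℝ}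
    {τ : ℝ → Space3 → ℝ} (h : WeakTransport T W τ₀ τ) (hL : LipField L W) (hτ : BddFamily M τ)
    (hτ₀ : Integrable τ₀) :
    ∀ᵐ t ∂((volume : Measure ℝ).restrict (Ioo 0 T)), ∫ x, τ t x = ∫ x, τ₀ x := by
  obtain ⟨χ, C, hχ, hχ1, hχC, hχlim⟩ := exists_cutoff
  have hall := ae_all_iff.2 fun n : ℕ => h (χ n) (hχ n)
  have hlim : ∀ {q : Space3 → ℝ}, Integrable q →
      Tendsto (fun n => ∫ x, q x * χ n x) atTop (𝓝 (∫ x, q x)) := by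
    intro q hq
    refine tendsto_integral_of_dominated_convergence (fun x => |q x|)
      (fun n => hq.1.mul (hχ n).continuous.aestronglyMeasurable) hq.abs
      (fun n => .of_forall fun x => ?_) (.of_forall fun x => ?_)
    · rw [norm_mul]; exact mul_le_of_le_one_right (norm_nonneg _) (hχ1 n x)
    · simpa using (hχlim x).const_mul (q x)
  filter_upwards [hall] with t ht
  refine tendsto_nhds_unique (hlim (hτ.integrable t)) ?_
  simp only [ht]
  rw [← add_zero (∫ x, τ₀ x)]
  refine (hlim hτ₀).add (squeeze_zero_norm (a := fun n => C * scale n * L * M * |t - 0|)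
    (fun n => ?_) ?_)
  · refine intervalIntegral.norm_integral_le_of_norm_le_const fun s _ => ?_
    refine hτ.abs_integral_mul_le s fun x => ?_
    exact ((fderiv ℝ (χ n) x).le_opNorm _).trans
      (mul_le_mul (hχC n x) (hL.bound s x) (norm_nonneg _) ((norm_nonneg _).trans (hχC n x)))
  · have h1 : Tendsto scale atTop (𝓝 0) := tendsto_one_div_add_atTop_nhds_zero_nat (𝕜 := ℝ)
    simpa using (((h1.const_mul C).mul_const L).mul_const M).mul_const |t - 0|

/-- A transported density which starts with values in `{0, m}` keeps its values there: the function
`s² (s - m)²` of the density has mass zero. -/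
theorem WeakTransport.range {T M L m : ℝ} {W : ℝ → Space3 → Space3} {τ₀ : Space3 → ℝ}
    {τ : ℝ → Space3 → ℝ} (h : WeakTransport T W τ₀ τ) (hL : LipField L W) (hτ : BddFamily M τ)
    (hτ₀ : Integrable τ₀) (hm : 0 ≤ m) (hτ₀m : ∀ x, τ₀ x = 0 ∨ τ₀ x = m) :
    ∀ᵐ t ∂((volume : Measure ℝ).restrict (Ioo 0 T)), ∀ᵐ x, τ t x = 0 ∨ τ t x = m := by
  -- the initial datum has to satisfy the same bound as the density
  set N := max M m
  have hτN : BddFamily N τ := hτ.mono (le_max_left _ _)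
  have hN : 0 ≤ N := (hτN.bddDensity 0).nonneg
  have hmN : m ≤ N := le_max_right _ _
  set β : ℝ → ℝ := fun s => s ^ 2 * (s - m) ^ 2 with hβ
  have hβs : ContDiff ℝ ∞ β := by fun_prop
  have hβ0 : ∀ x, β (τ₀ x) = 0 := fun x => by
    rcases hτ₀m x with hx | hx <;> simp [hβ, hx]
  have hw := h.renormalize hL hτN hτ₀ (fun x => by
    rcases hτ₀m x with hx | hx
    · rw [hx, abs_zero]; exact hN
    · rw [hx, abs_of_nonneg hm]; exact hmN) hβs
  have hβle : ∀ t x, |β (τ t x)| ≤ N * (N + m) ^ 2 * |τ t x| := by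
    intro t x
    have h1 := hτN.bound t x
    have h2 : |τ t x - m| ≤ N + m := (abs_sub _ _).trans (by rw [abs_of_nonneg hm]; linarith)
    simp only [hβ]
    rw [abs_mul, abs_pow, abs_pow]
    calc |τ t x| ^ 2 * |τ t x - m| ^ 2 ≤ (N * |τ t x|) * (N + m) ^ 2 := by
          refine mul_le_mul ?_ (pow_le_pow_left₀ (abs_nonneg _) h2 2) (by positivity)
            (by positivity)
          rw [sq]; exact mul_le_mul_of_nonneg_right h1 (abs_nonneg _)
      _ = _ := by ring
  set K := N * (N + m) ^ 2 * N with hK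
  have hβτ : BddFamily K (fun t x => β (τ t x)) := by
    refine ⟨hβs.continuous.measurable.comp hτ.measurable,
      fun t x => (hβle t x).trans (mul_le_mul_of_nonneg_left (hτN.bound t x) (by positivity)),
      fun t => ?_, fun t => ?_⟩
    · refine Integrable.mono' ((hτ.integrable t).abs.const_mul (N * (N + m) ^ 2)) ?_
        (.of_forall (hβle t))
      exact hβs.continuous.comp_aestronglyMeasurable (hτ.integrable t).1
    · refine (integral_mono_of_nonneg (.of_forall fun _ => abs_nonneg _)
        ((hτ.integrable t).abs.const_mul (N * (N + m) ^ 2)) (.of_forall (hβle t))).trans ?_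
      rw [integral_const_mul]
      exact mul_le_mul_of_nonneg_left (hτN.mass t) (by positivity)
  have hmass := hw.integral_eq hL hβτ (by simp only [hβ0]; exact integrable_zero _ _ _)
  filter_upwards [hmass] with t ht
  simp only [hβ0, integral_zero] at ht
  rw [integral_eq_zero_iff_of_nonneg (fun x => by simp only [hβ]; positivity)
    (hβτ.integrable t)] at ht
  filter_upwards [ht] with x hx
  simp only [hβ, Pi.zero_apply, mul_eq_zero, pow_eq_zero_iff two_ne_zero, sub_eq_zero] at hx
  exact hx

/-! ### The Newtonian energy of a density concentrated near a sphere -/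

theorem neg_dropVel_two_of_le {R : ℝ} {x : Space3} (hx : ‖x‖ ≤ R) :
    -dropVel R x 2 = R ^ 2 / 3 - 2 / 15 * ‖x‖ ^ 2 + x 2 ^ 2 / 15 := by
  have h : ‖x‖ ^ 2 ≤ R ^ 2 := pow_le_pow_left₀ (norm_nonneg _) hx 2
  rw [dropVel_apply]
  unfold dropV dropA dropD
  simp only [glue_of_le _ _ h, if_true]
  ring

theorem neg_dropVel_two_of_ge {R : ℝ} (hR : 0 < R) {x : Space3} (hx : R ≤ ‖x‖) :
    -dropVel R x 2 = R ^ 3 / 6 * (‖x‖ ^ 2 + x 2 ^ 2) * (‖x‖ ^ 3)⁻¹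
      + R ^ 5 / 30 * (‖x‖ ^ 2 - 3 * x 2 ^ 2) * (‖x‖ ^ 5)⁻¹ := by
  rcases hx.eq_or_lt with h | h
  · rw [neg_dropVel_two_of_le h.ge, ← h]
    field_simp
    ring
  · have hr : 0 < ‖x‖ := hR.trans h
    have h' : R ^ 2 < ‖x‖ ^ 2 := pow_lt_pow_left₀ h hR.le two_ne_zero
    rw [dropVel_apply]
    unfold dropV dropA dropD
    simp only [glue_of_lt _ _ h', if_true, invSqrtPow_norm]
    field_simp
    ring

/-- The vertical velocity generated by a ball grows with the ball at most like the square of the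
radius, uniformly in space. -/
theorem dropVel_two_sub_le {a b : ℝ} (ha : 0 < a) (hab : a ≤ b) (x : Space3) :
    dropVel a x 2 - dropVel b x 2 ≤ b ^ 2 - a ^ 2 := by
  have hx2 : x 2 ^ 2 ≤ ‖x‖ ^ 2 := sq_le_sq.2 (by rw [abs_norm]; exact abs_coord_le x 2)
  have hin : ∀ {a b : ℝ}, a ≤ b → 0 < a → ‖x‖ ≤ a →
      dropVel a x 2 - dropVel b x 2 ≤ b ^ 2 - a ^ 2 := by
    intro a b hab ha hx
    have h1 := neg_dropVel_two_of_le hx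
    have h2 := neg_dropVel_two_of_le (hx.trans hab)
    have h3 : a ^ 2 ≤ b ^ 2 := pow_le_pow_left₀ ha.le hab 2
    linarith
  have hout : ∀ {a b : ℝ}, a ≤ b → 0 < a → b ≤ ‖x‖ →
      dropVel a x 2 - dropVel b x 2 ≤ b ^ 2 - a ^ 2 := by
    intro a b hab ha hx
    have hb := ha.trans_le hab
    have hr : 0 < ‖x‖ := hb.trans_le hx
    have h1 := neg_dropVel_two_of_ge ha (hab.trans hx)
    have h2 := neg_dropVel_two_of_ge hb hx
    set r := ‖x‖
    have hsq : 0 ≤ b ^ 2 - a ^ 2 := sub_nonneg.2 (pow_le_pow_left₀ ha.le hab 2)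
    have h3 : b ^ 3 - a ^ 3 ≤ 2 * r * (b ^ 2 - a ^ 2) := by
      have e1 : b ^ 3 - a ^ 3 ≤ 2 * b * (b ^ 2 - a ^ 2) := by
        have : 0 ≤ (b - a) * (b * (b - a) + a * (b - a) + 2 * a * b) := by
          have := sub_nonneg.2 hab; positivity
        nlinarith [this]
      exact e1.trans (mul_le_mul_of_nonneg_right (by linarith) hsq)
    have h3' : 0 ≤ b ^ 3 - a ^ 3 := sub_nonneg.2 (pow_le_pow_left₀ ha.le hab 3)
    have h5 : b ^ 5 - a ^ 5 ≤ 5 * r ^ 3 * (b ^ 2 - a ^ 2) := by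
      have e1 : b ^ 5 - a ^ 5 = b ^ 2 * (b ^ 3 - a ^ 3) + a ^ 3 * (b ^ 2 - a ^ 2) := by ring
      have e2 : b ^ 2 * (b ^ 3 - a ^ 3) ≤ r ^ 2 * (2 * r * (b ^ 2 - a ^ 2)) :=
        mul_le_mul (pow_le_pow_left₀ hb.le hx 2) h3 h3' (by positivity)
      have e3 : a ^ 3 * (b ^ 2 - a ^ 2) ≤ r ^ 3 * (b ^ 2 - a ^ 2) :=
        mul_le_mul_of_nonneg_right (pow_le_pow_left₀ ha.le (hab.trans hx) 3) hsq
      have e4 : 0 ≤ r ^ 3 * (b ^ 2 - a ^ 2) := by positivity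
      linarith
    have h5' : 0 ≤ b ^ 5 - a ^ 5 := sub_nonneg.2 (pow_le_pow_left₀ ha.le hab 5)
    have k1 : (b ^ 3 - a ^ 3) / 6 * (r ^ 2 + x 2 ^ 2) * (r ^ 3)⁻¹ ≤ 2 / 3 * (b ^ 2 - a ^ 2) := by
      rw [mul_inv_le_iff₀ (by positivity)]
      calc (b ^ 3 - a ^ 3) / 6 * (r ^ 2 + x 2 ^ 2)
          ≤ (2 * r * (b ^ 2 - a ^ 2)) / 6 * (r ^ 2 + r ^ 2) := by gcongr
        _ = _ := by ring
    have k2 : (b ^ 5 - a ^ 5) / 30 * (r ^ 2 - 3 * x 2 ^ 2) * (r ^ 5)⁻¹ ≤ 1 / 6 * (b ^ 2 - a ^ 2) := by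
      rw [mul_inv_le_iff₀ (by positivity)]
      calc (b ^ 5 - a ^ 5) / 30 * (r ^ 2 - 3 * x 2 ^ 2)
          ≤ (b ^ 5 - a ^ 5) / 30 * r ^ 2 := by
            refine mul_le_mul_of_nonneg_left ?_ (by positivity)
            linarith [sq_nonneg (x 2)]
        _ ≤ (5 * r ^ 3 * (b ^ 2 - a ^ 2)) / 30 * r ^ 2 := by gcongr
        _ = _ := by ring
    have e : dropVel a x 2 - dropVel b x 2
        = (b ^ 3 - a ^ 3) / 6 * (r ^ 2 + x 2 ^ 2) * (r ^ 3)⁻¹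
          + (b ^ 5 - a ^ 5) / 30 * (r ^ 2 - 3 * x 2 ^ 2) * (r ^ 5)⁻¹ := by linarith
    rw [e]; linarith
  rcases le_total ‖x‖ a with h1 | h1
  · exact hin hab ha h1
  rcases le_total b ‖x‖ with h2 | h2
  · exact hout hab ha h2
  · have e1 := hout h1 ha le_rfl
    have e2 := hin h2 (ha.trans_le h1) le_rfl
    linarith

/-- The closed-open annulus around the origin. -/
def annulus (a b : ℝ) : Set Space3 := {y | a ≤ ‖y‖ ∧ ‖y‖ < b}

theorem neg_oseen_two_ge (z : Space3) : oseenConst * ‖z‖⁻¹ ≤ -oseen z 2 := by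
  have h : -oseen z 2 = oseenConst * ‖z‖⁻¹ + oseenConst * (z 2 ^ 2 * (‖z‖ ^ 3)⁻¹) := by
    simp [oseen, e₃]; ring
  rw [h]
  have := oseenConst_pos
  have : 0 ≤ oseenConst * (z 2 ^ 2 * (‖z‖ ^ 3)⁻¹) := by positivity
  linarith

/-- The Newtonian potential of an annulus is at most proportional to the difference of the squared
radii: it is dominated by the vertical velocity which the annulus generates. -/
theorem integral_annulus_inv_norm_le {a b : ℝ} (ha : 0 < a) (hab : a ≤ b) (x : Space3) :
    Integrable ((annulus a b).indicator fun y => ‖x - y‖⁻¹) ∧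
    ∫ y, (annulus a b).indicator (fun y => ‖x - y‖⁻¹) y ≤ oseenConst⁻¹ * (b ^ 2 - a ^ 2) := by
  have hb := ha.trans_le hab
  have hκ := oseenConst_pos
  have hpt : ∀ {R : ℝ}, 0 < R → ∀ y, ballVol R * ballDensity R y
      = (Metric.ball (0 : Space3) R).indicator (fun _ => 1) y := fun hR y => by
    rw [ballDensity_eq, ← mul_assoc, mul_inv_cancel₀ (ballVol_pos hR).ne', one_mul]
  have hind : ∀ y (c : ℝ), (annulus a b).indicator (fun _ => c) y
      = (ballVol b * ballDensity b y - ballVol a * ballDensity a y) * c := by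
    intro y c
    rw [hpt ha, hpt hb]
    by_cases h1 : ‖y‖ < a
    · have h2 := h1.trans_le hab
      rw [indicator_of_notMem (fun h => h.1.not_gt h1), indicator_of_mem (by simpa using h2),
        indicator_of_mem (by simpa using h1)]
      ring
    · by_cases h2 : ‖y‖ < b
      · rw [indicator_of_mem (show y ∈ annulus a b from ⟨not_lt.1 h1, h2⟩), indicator_of_mem (by simpa using h2),
          indicator_of_notMem (by simpa using h1)]
        ring
      · rw [indicator_of_notMem (fun h => h2 h.2), indicator_of_notMem (by simpa using h2),
          indicator_of_notMem (by simpa using h1)]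
        ring
  have hvel : ∀ {R : ℝ}, 0 < R → Integrable (fun y => ballVol R * ballDensity R y * oseen (x - y) 2) ∧
      dropVel R x 2 = ∫ y, ballVol R * ballDensity R y * oseen (x - y) 2 := by
    intro R hR
    have hd := bddDensity_ballDensity hR
    have hi : Integrable fun y => ballDensity R y * oseen (x - y) 2 :=
      (EuclideanSpace.proj (2 : Fin 3) : Space3 →L[ℝ] ℝ).integrable_comp
        (hd.integrable_smul_oseen x)
    simp only [mul_assoc]
    refine ⟨hi.const_mul _, ?_⟩
    rw [integral_const_mul, ← hd.stokesVel_apply, ← ballVel_eq_stokesVel hR]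
    simp only [ballVel, PiLp.smul_apply, smul_eq_mul]
    rw [← mul_assoc, mul_inv_cancel₀ (ballVol_pos hR).ne', one_mul]
  have hkint : Integrable fun y => oseenConst * (annulus a b).indicator (fun y => ‖x - y‖⁻¹) y := by
    have h1 : ∀ {R : ℝ}, 0 < R → Integrable fun y => ballVol R * (ballDensity R y * ‖x - y‖⁻¹) := by
      intro R hR
      have := ((bddDensity_ballDensity hR).riesz one_le_two x).1
      simp only [abs_of_nonneg (ballDensity_nonneg hR _), pow_one] at this
      exact this.const_mul _
    refine (((h1 hb).sub (h1 ha)).const_mul oseenConst).congr (.of_forall fun y => ?_)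
    have := hind y ‖x - y‖⁻¹
    simp only [Pi.sub_apply]
    rw [show (annulus a b).indicator (fun y => ‖x - y‖⁻¹) y
      = (annulus a b).indicator (fun _ => ‖x - y‖⁻¹) y from by
        by_cases hy : y ∈ annulus a b <;> simp [hy], this]
    ring
  constructor
  · simpa [hκ.ne', ← mul_assoc] using hkint.const_mul oseenConst⁻¹
  rw [← mul_le_mul_iff_right₀ hκ, ← mul_assoc, mul_inv_cancel₀ hκ.ne', one_mul,
    ← integral_const_mul]
  refine le_trans ?_ (dropVel_two_sub_le ha hab x)
  rw [(hvel ha).2, (hvel hb).2, ← integral_sub (hvel ha).1 (hvel hb).1]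
  refine integral_mono hkint ((hvel ha).1.sub (hvel hb).1) fun y => ?_
  have h1 := hind y (-oseen (x - y) 2)
  have h2 : (annulus a b).indicator (fun _ => -oseen (x - y) 2) y
      = ballVol a * ballDensity a y * oseen (x - y) 2
        - ballVol b * ballDensity b y * oseen (x - y) 2 := by rw [h1]; ring
  change _ ≤ ballVol a * ballDensity a y * oseen (x - y) 2
    - ballVol b * ballDensity b y * oseen (x - y) 2
  rw [← h2]
  by_cases hy : y ∈ annulus a b
  · simp only [indicator_of_mem hy]; exact neg_oseen_two_ge _
  · simp [hy]

/-- A height function which is `|y|² - R²` near the ball, and is bounded below outside: the density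
at heights at most `|h x|` generates at `x` a potential of size at most `|h x|`. -/
theorem BddDensity.exists_sublevel_potential_le {M R : ℝ} (hR : 0 < R) {h : Space3 → ℝ}
    (hm : Measurable h) (hin : ∀ y, ‖y‖ ≤ 2 * R → h y = ‖y‖ ^ 2 - R ^ 2)
    (hout : ∀ y, 2 * R < ‖y‖ → R ^ 2 ≤ h y) :
    ∃ C, 0 ≤ C ∧ ∀ {σ : Space3 → ℝ}, BddDensity M σ → ∀ x, h x ≠ 0 →
      ∫ y, {y | |h y| ≤ |h x|}.indicator (fun y => |σ y| * ‖x - y‖⁻¹) y ≤ C * |h x| := by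
  have hκ := oseenConst_pos
  rcases lt_or_ge M 0 with hM | hM
  · exact ⟨0, le_rfl, fun hσ => absurd hσ.nonneg hM.not_ge⟩
  have hr := rieszConst_pos 1
  refine ⟨M * (oseenConst⁻¹ * 3) + rieszConst 1 * M / R ^ 2, by positivity, fun {σ} hσ x hx => ?_⟩
  set δ := |h x| with hδ
  have hδ0 : 0 < δ := abs_pos.2 hx
  have hmeas : MeasurableSet {y | |h y| ≤ δ} := measurableSet_le hm.abs measurable_const
  have hri := hσ.riesz one_le_two x
  simp only [pow_one] at hri
  -- for `δ < R²` the sublevel set lies in an annulus of size `δ`; the factor `2` makes room for the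
  -- strict inequality at the outer radius
  rcases lt_or_ge δ (R ^ 2) with hlt | hge
  · set a := √(R ^ 2 - δ)
    set b := √(R ^ 2 + 2 * δ)
    have ha : 0 < a := Real.sqrt_pos.2 (by linarith)
    have hab : a ≤ b := Real.sqrt_le_sqrt (by linarith)
    have ha2 : a ^ 2 = R ^ 2 - δ := Real.sq_sqrt (by linarith)
    have hb2 : b ^ 2 = R ^ 2 + 2 * δ := Real.sq_sqrt (by positivity)
    have hsub : {y | |h y| ≤ δ} ⊆ annulus a b := by
      intro y hy
      have hy2 : ‖y‖ ≤ 2 * R := by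
        by_contra hlt2
        have h1 := hout y (not_le.1 hlt2)
        have h2 := (le_abs_self _).trans (show |h y| ≤ δ from hy)
        linarith
      rw [mem_ofPred_eq, hin y hy2, abs_le] at hy
      refine ⟨Real.sqrt_le_iff.2 ⟨norm_nonneg _, by linarith [hy.1]⟩, ?_⟩
      exact Real.lt_sqrt (norm_nonneg _) |>.2 (by linarith [hy.2])
    have han := integral_annulus_inv_norm_le ha hab x
    calc ∫ y, {y | |h y| ≤ δ}.indicator (fun y => |σ y| * ‖x - y‖⁻¹) y
        ≤ ∫ y, M * (annulus a b).indicator (fun y => ‖x - y‖⁻¹) y := by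
          refine integral_mono_ae (hri.1.indicator hmeas) (han.1.const_mul M) ?_
          filter_upwards [hσ.bound] with y hy
          by_cases hyδ : y ∈ {y | |h y| ≤ δ}
          · rw [indicator_of_mem hyδ, indicator_of_mem (hsub hyδ)]
            exact mul_le_mul_of_nonneg_right hy (by positivity)
          · rw [indicator_of_notMem hyδ]
            exact mul_nonneg hM (indicator_nonneg (fun _ _ => by positivity) _)
      _ ≤ M * (oseenConst⁻¹ * (b ^ 2 - a ^ 2)) := by
          rw [integral_const_mul]; exact mul_le_mul_of_nonneg_left han.2 hM
      _ = M * (oseenConst⁻¹ * 3) * δ := by rw [ha2, hb2]; ring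
      _ ≤ _ := by
          refine mul_le_mul_of_nonneg_right ?_ hδ0.le
          have : 0 ≤ rieszConst 1 * M / R ^ 2 := by positivity
          linarith
  · calc ∫ y, {y | |h y| ≤ δ}.indicator (fun y => |σ y| * ‖x - y‖⁻¹) y
        ≤ ∫ y, |σ y| * ‖x - y‖⁻¹ := by
          refine integral_mono (hri.1.indicator hmeas) hri.1 fun y => ?_
          exact indicator_le_self' (fun _ _ => by positivity) y
      _ ≤ rieszConst 1 * M := hri.2
      _ ≤ rieszConst 1 * M / R ^ 2 * δ := by
          rw [div_mul_eq_mul_div, le_div_iff₀ (by positivity)]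
          exact mul_le_mul_of_nonneg_left hge (by positivity)
      _ ≤ _ := by
          refine mul_le_mul_of_nonneg_right ?_ hδ0.le
          have : 0 ≤ M * (oseenConst⁻¹ * 3) := by positivity
          linarith

/-- The interaction energy is at most twice the interaction of every point with the points of
smaller height. -/
theorem BddDensity.interaction_le {M C : ℝ} {σ h : Space3 → ℝ} (hσ : BddDensity M σ)
    (hσm : Measurable σ) (hm : Measurable h) (h0 : ∀ᵐ x, h x ≠ 0)
    (hσh : Integrable fun x => |σ x| * |h x|)
    (hC : ∀ x, h x ≠ 0 →
      ∫ y, {y | |h y| ≤ |h x|}.indicator (fun y => |σ y| * ‖x - y‖⁻¹) y ≤ C * |h x|) :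
    (Integrable fun x => |σ x| * ∫ y, |σ y| * ‖x - y‖⁻¹) ∧
    ∫ x, |σ x| * ∫ y, |σ y| * ‖x - y‖⁻¹ ≤ 2 * C * ∫ x, |σ x| * |h x| := by
  set F : Space3 × Space3 → ℝ := fun z => |σ z.1| * (|σ z.2| * ‖z.1 - z.2‖⁻¹) with hF
  have hFm : Measurable F := by
    have h1 : Measurable fun z : Space3 × Space3 => σ z.1 := hσm.comp measurable_fst
    have h2 : Measurable fun z : Space3 × Space3 => σ z.2 := hσm.comp measurable_snd
    exact h1.abs.mul (h2.abs.mul (measurable_fst.sub measurable_snd).norm.inv)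
  have hF0 : ∀ z, 0 ≤ F z := fun z => by simp only [hF]; positivity
  have hri := fun x => hσ.riesz one_le_two x
  simp only [pow_one] at hri
  have hFint : Integrable F (volume.prod volume) := by
    rw [integrable_prod_iff hFm.aestronglyMeasurable]
    refine ⟨.of_forall fun x => (hri x).1.const_mul |σ x|, ?_⟩
    refine Integrable.mono' (hσ.integrable.abs.mul_const (rieszConst 1 * M))
      hFm.norm.stronglyMeasurable.integral_prod_right'.aestronglyMeasurable
      (.of_forall fun x => ?_)
    simp only [Real.norm_of_nonneg (hF0 _)]
    rw [Real.norm_of_nonneg (integral_nonneg fun y => hF0 _)]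
    simp only [hF]
    rw [integral_const_mul]
    exact mul_le_mul_of_nonneg_left (hri x).2 (abs_nonneg _)
  set A : Set (Space3 × Space3) := {z | |h z.2| ≤ |h z.1|} with hA
  have hAm : MeasurableSet A :=
    measurableSet_le (hm.comp measurable_snd).abs (hm.comp measurable_fst).abs
  have hA1 : Integrable (A.indicator F) (volume.prod volume) := hFint.indicator hAm
  have hA2 := hA1.swap
  have hsw : ∫ z, A.indicator F z.swap ∂((volume : Measure Space3).prod volume)
      = ∫ z, A.indicator F z ∂(volume.prod volume) := integral_prod_swap _
  have hle : ∫ z, F z ∂(volume.prod volume) ≤ 2 * ∫ z, A.indicator F z ∂(volume.prod volume) := by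
    calc ∫ z, F z ∂(volume.prod volume)
        ≤ ∫ z, (A.indicator F z + A.indicator F z.swap) ∂(volume.prod volume) := by
          refine integral_mono hFint (hA1.add hA2) fun z => ?_
          have hsymm : F z.swap = F z := by
            simp only [hF, Prod.fst_swap, Prod.snd_swap]
            rw [norm_sub_rev]; ring
          have hn : ∀ w, 0 ≤ A.indicator F w := fun w => indicator_nonneg (fun _ _ => hF0 _) w
          rcases le_total |h z.2| |h z.1| with h1 | h1
          · have e : A.indicator F z = F z := indicator_of_mem (show z ∈ A from h1) F
            linarith [hn z.swap]
          · have e : A.indicator F z.swap = F z.swap := 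
              indicator_of_mem (show z.swap ∈ A from h1) F
            linarith [hn z]
      _ = _ := by
          have := integral_add hA1 hA2
          simp only [Function.comp_apply] at this
          rw [this, hsw]; ring
  have h1 : ∫ z, A.indicator F z ∂(volume.prod volume) ≤ C * ∫ x, |σ x| * |h x| := by
    rw [integral_prod _ hA1, ← integral_const_mul]
    refine integral_mono_ae hA1.integral_prod_left (hσh.const_mul C) ?_
    filter_upwards [h0] with x hx
    have e : ∀ y, A.indicator F (x, y) = |σ x| *
        {y | |h y| ≤ |h x|}.indicator (fun y => |σ y| * ‖x - y‖⁻¹) y := by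
      intro y
      by_cases hy : |h y| ≤ |h x|
      · rw [indicator_of_mem (show (x, y) ∈ A from hy),
          indicator_of_mem (show y ∈ {y | |h y| ≤ |h x|} from hy)]
      · rw [indicator_of_notMem (show (x, y) ∉ A from hy),
          indicator_of_notMem (show y ∉ {y | |h y| ≤ |h x|} from hy), mul_zero]
    simp only [e]
    rw [integral_const_mul]
    calc |σ x| * _ ≤ |σ x| * (C * |h x|) := mul_le_mul_of_nonneg_left (hC x hx) (abs_nonneg _)
      _ = _ := by ring
  have e : ∀ x, ∫ y, F (x, y) = |σ x| * ∫ y, |σ y| * ‖x - y‖⁻¹ := fun x => by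
    simp only [hF]; rw [integral_const_mul]
  refine ⟨hFint.integral_prod_left.congr (.of_forall e), ?_⟩
  rw [integral_prod _ hFint] at hle
  simp only [e] at hle
  linarith

/-! ### Stability of the falling ball -/

theorem fderiv_comp_norm_sq {Θ θ : ℝ → ℝ} (hΘ : ∀ s, HasDerivAt Θ (θ s) s) (x w : Space3) :
    fderiv ℝ (fun y : Space3 => Θ (‖y‖ ^ 2)) x w = θ (‖x‖ ^ 2) * (2 * inner ℝ x w) := by
  have h1 := (hasStrictFDerivAt_norm_sq (F := Space3) x).hasFDerivAt
  have h2 : fderiv ℝ (fun y : Space3 => Θ (‖y‖ ^ 2)) x = _ :=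
    ((hΘ (‖x‖ ^ 2)).comp_hasFDerivAt x h1).fderiv
  rw [h2]
  simp

/-- A weakly divergence free field has zero flux through the spheres, weighted over the ball. -/
theorem integral_ballDensity_inner {R : ℝ} (hR : 0 < R) {w : Space3 → Space3} (hw : Continuous w)
    (hdiv : ∀ φ, IsTest φ → ∫ x, fderiv ℝ φ x (w x) = 0) :
    ∫ x, ballDensity R x * (2 * inner ℝ x (w x)) = 0 := by
  set S := R ^ 2 with hS
  -- `Θ n` is smooth, vanishes outside the ball, and has derivative tending to one inside
  set θ : ℕ → ℝ → ℝ := fun n s => Real.smoothTransition (n * (S - s)) with hθ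
  have hθs : ∀ n, ContDiff ℝ ∞ (θ n) := fun n =>
    Real.smoothTransition.contDiff.comp (by fun_prop)
  set Θ : ℕ → ℝ → ℝ := fun n s => ∫ r in S..s, θ n r with hΘ
  have hΘd : ∀ n s, HasDerivAt (Θ n) (θ n s) s := fun n s =>
    intervalIntegral.integral_hasDerivAt_right ((hθs n).continuous.intervalIntegrable _ _)
      ((hθs n).continuous.stronglyMeasurableAtFilter _ _) (hθs n).continuous.continuousAt
  have hΘs : ∀ n, ContDiff ℝ ∞ (Θ n) := fun n => by
    rw [contDiff_infty_iff_deriv, show deriv (Θ n) = θ n from funext fun s => (hΘd n s).deriv]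
    exact ⟨fun s => (hΘd n s).differentiableAt, hθs n⟩
  have hθ0 : ∀ n s, S ≤ s → θ n s = 0 := fun n s hs =>
    Real.smoothTransition.zero_of_nonpos
      (mul_nonpos_of_nonneg_of_nonpos (Nat.cast_nonneg n) (by linarith))
  have hΘ0 : ∀ n s, S ≤ s → Θ n s = 0 := fun n s hs => by
    simp only [hΘ]
    rw [intervalIntegral.integral_congr (g := fun _ => 0)]
    · simp
    · intro r hr
      rw [uIcc_of_le hs] at hr
      exact hθ0 n r hr.1
  have htest : ∀ n, IsTest fun x : Space3 => Θ n (‖x‖ ^ 2) := fun n => by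
    refine ⟨(hΘs n).comp (contDiff_norm_sq ℝ), HasCompactSupport.intro
      (isCompact_closedBall (0 : Space3) R) fun x hx => hΘ0 n _ ?_⟩
    rw [mem_closedBall_zero_iff, not_le] at hx
    exact pow_le_pow_left₀ hR.le hx.le 2
  have hzero : ∀ n, ∫ x, θ n (‖x‖ ^ 2) * (2 * inner ℝ x (w x)) = 0 := fun n => by
    rw [← hdiv _ (htest n)]
    simp only [fderiv_comp_norm_sq (hΘd n)]
  have hc : Continuous fun x : Space3 => 2 * inner ℝ x (w x) := by fun_prop
  have hlim : Tendsto (fun n => ∫ x, θ n (‖x‖ ^ 2) * (2 * inner ℝ x (w x))) atTop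
      (𝓝 (∫ x, ballVol R * ballDensity R x * (2 * inner ℝ x (w x)))) := by
    refine tendsto_integral_of_dominated_convergence
      ((Metric.closedBall (0 : Space3) R).indicator fun x => ‖2 * inner ℝ x (w x)‖)
      (fun n => (((hθs n).continuous.comp (by fun_prop)).mul hc).aestronglyMeasurable)
      ((integrable_indicator_iff measurableSet_closedBall).2
        (hc.norm.continuousOn.integrableOn_compact (isCompact_closedBall _ _)))
      (fun n => .of_forall fun x => ?_) (.of_forall fun x => ?_)
    · rcases le_or_gt ‖x‖ R with hx | hx
      · rw [indicator_of_mem (by simpa using hx), norm_mul]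
        refine mul_le_of_le_one_left (norm_nonneg _) ?_
        rw [Real.norm_of_nonneg (Real.smoothTransition.nonneg _)]
        exact Real.smoothTransition.le_one _
      · rw [hθ0 n _ (pow_le_pow_left₀ hR.le hx.le 2), zero_mul, norm_zero]
        exact indicator_nonneg (fun _ _ => norm_nonneg _) _
    · refine Tendsto.mul_const _ (tendsto_nhds_of_eventually_eq ?_)
      rcases lt_or_ge ‖x‖ R with hx | hx
      · have hs : 0 < S - ‖x‖ ^ 2 := sub_pos.2 (pow_lt_pow_left₀ hx (norm_nonneg _) two_ne_zero)
        filter_upwards [(tendsto_natCast_atTop_atTop (R := ℝ)).eventually_ge_atTop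
          (S - ‖x‖ ^ 2)⁻¹] with n hn
        rw [ballDensity_of_norm_lt hx, mul_inv_cancel₀ (ballVol_pos hR).ne']
        refine Real.smoothTransition.one_of_one_le ?_
        rw [inv_le_iff_one_le_mul₀ hs] at hn
        exact hn
      · refine .of_forall fun n => ?_
        rw [ballDensity_of_le_norm hx, mul_zero]
        exact hθ0 n _ (pow_le_pow_left₀ hR.le hx 2)
  simp only [hzero, mul_assoc] at hlim
  rw [integral_const_mul] at hlim
  have := tendsto_nhds_unique hlim tendsto_const_nhds
  exact (mul_eq_zero.1 this).resolve_left (ballVol_pos hR).ne'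

/-- A test function which is `|x|² - 2 R²` near the ball of radius `R` and nonnegative far away. -/
theorem exists_height {R : ℝ} (hR : 0 < R) : ∃ ζ : Space3 → ℝ, IsTest ζ ∧
    (∀ x, ‖x‖ ≤ 2 * R → ζ x = ‖x‖ ^ 2 - 2 * R ^ 2) ∧ ∀ x, 2 * R < ‖x‖ → 0 ≤ ζ x := by
  let b : ContDiffBump (0 : Space3) := ⟨2 * R, 3 * R, by positivity, by linarith⟩
  refine ⟨fun x => (‖x‖ ^ 2 - 2 * R ^ 2) * b x,
    ⟨((contDiff_norm_sq ℝ).sub contDiff_const).mul b.contDiff, b.hasCompactSupport.mul_left⟩,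
    fun x hx => ?_, fun x hx => ?_⟩
  · change _ * b x = _
    rw [b.one_of_mem_closedBall (by rw [mem_closedBall_zero_iff]; exact hx), mul_one]
  · refine mul_nonneg ?_ b.nonneg
    have := pow_le_pow_left₀ (by positivity) hx.le 2
    nlinarith [sq_nonneg R]

theorem fderiv_height {R : ℝ} {ζ : Space3 → ℝ}
    (hζ : ∀ x, ‖x‖ ≤ 2 * R → ζ x = ‖x‖ ^ 2 - 2 * R ^ 2) {x : Space3} (hx : ‖x‖ < 2 * R)
    (w : Space3) : fderiv ℝ ζ x w = 2 * inner ℝ x w := by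
  have he : ζ =ᶠ[𝓝 x] fun y => (fun s => s - 2 * R ^ 2) (‖y‖ ^ 2) := by
    filter_upwards [(continuous_norm.isOpen_preimage _ isOpen_Iio).mem_nhds hx] with y hy
    exact hζ y (le_of_lt hy)
  rw [he.fderiv_eq, fderiv_comp_norm_sq (Θ := fun s => s - 2 * R ^ 2) (θ := fun _ => 1)
    (fun s => (hasDerivAt_id s).sub_const _), one_mul]

/-- The flow relative to the falling ball is tangent to its boundary, so that it moves heights at
most in proportion to the height. -/
theorem exists_relVel_bound {R : ℝ} (hR : 0 < R) {ζ : Space3 → ℝ} (hζ : IsTest ζ)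
    (hin : ∀ x, ‖x‖ ≤ 2 * R → ζ x = ‖x‖ ^ 2 - 2 * R ^ 2) (hout : ∀ x, 2 * R < ‖x‖ → 0 ≤ ζ x) :
    ∃ C, 0 ≤ C ∧ ∀ x, |fderiv ℝ ζ x (ballVel R x - fallVel R)| ≤ C * |ζ x + R ^ 2| := by
  have hfam : BddFamily (max (ballVol R)⁻¹ 1) (fun _ : ℝ => ballDensity R) := by
    have hd := bddDensity_ballDensity hR
    refine ⟨(measurable_ballDensity R).comp measurable_snd, fun _ x => ?_,
      fun _ => hd.integrable, fun _ => hd.mass⟩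
    rw [abs_of_nonneg (ballDensity_nonneg hR x)]
    exact (ballDensity_le hR x).trans (le_max_left _ _)
  obtain ⟨L, hL⟩ := hfam.exists_lipField (fallVel R)
  simp only [← ballVel_eq_stokesVel hR] at hL
  set U : Space3 → Space3 := fun x => ballVel R x - fallVel R
  have hUb : ∀ x, ‖U x‖ ≤ L := hL.bound 0
  have hUl : ∀ x y, ‖U x - U y‖ ≤ L * ‖x - y‖ := hL.lipschitz 0
  have hL0 := hL.nonneg
  obtain ⟨K, hK0, hK⟩ := hζ.exists_fderiv_bound
  have hV := ballVol_pos hR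
  have htan : ∀ x, ‖x‖ ≤ R →
      inner ℝ x (U x) = (ballVol R)⁻¹ / 15 * (x 2 * (‖x‖ ^ 2 - R ^ 2)) := by
    intro x hx
    simp only [U]
    rw [ballVel_sub_fallVel (pow_le_pow_left₀ (norm_nonneg _) hx 2), inner_smul_right,
      inner_sub_right, inner_smul_right, inner_smul_right, real_inner_self_eq_norm_sq,
      real_inner_comm, inner_e₃]
    ring
  refine ⟨2 * ((ballVol R)⁻¹ / 15 * R) + 2 * L + K * L / R ^ 2, by positivity, fun x => ?_⟩
  have hp1 : 0 ≤ 2 * ((ballVol R)⁻¹ / 15 * R) := by positivity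
  have hp2 : 0 ≤ K * L / R ^ 2 := by positivity
  rcases lt_or_ge ‖x‖ (2 * R) with hx2 | hx2
  · have hh : ζ x + R ^ 2 = ‖x‖ ^ 2 - R ^ 2 := by rw [hin x hx2.le]; ring
    rw [fderiv_height hin hx2, hh, abs_mul, abs_two]
    rcases le_or_gt ‖x‖ R with hx | hx
    · rw [htan x hx, abs_mul, abs_mul, abs_of_nonneg (show 0 ≤ (ballVol R)⁻¹ / 15 by positivity)]
      calc 2 * ((ballVol R)⁻¹ / 15 * (|x 2| * |‖x‖ ^ 2 - R ^ 2|))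
          ≤ 2 * ((ballVol R)⁻¹ / 15 * (R * |‖x‖ ^ 2 - R ^ 2|)) := by
            gcongr
            exact (abs_coord_le x 2).trans hx
        _ = 2 * ((ballVol R)⁻¹ / 15 * R) * |‖x‖ ^ 2 - R ^ 2| := by ring
        _ ≤ _ := mul_le_mul_of_nonneg_right (by linarith) (abs_nonneg _)
    · -- compare with the radial projection of `x` to the sphere
      have hr : 0 < ‖x‖ := hR.trans hx
      set y : Space3 := (R / ‖x‖) • x with hy
      have hyn : ‖y‖ = R := by
        rw [hy, norm_smul, Real.norm_of_nonneg (by positivity)]; field_simp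
      have hy0 : inner ℝ x (U y) = 0 := by
        have h1 := htan y hyn.le
        rw [hyn, sub_self, mul_zero, mul_zero, hy, inner_smul_left] at h1
        exact (mul_eq_zero.1 h1).resolve_left (by simp [hR.ne', hr.ne'])
      have hxy : ‖x - y‖ = ‖x‖ - R := by
        have : x - y = (1 - R / ‖x‖) • x := by rw [hy, sub_smul, one_smul]
        rw [this, norm_smul, Real.norm_of_nonneg (sub_nonneg.2 ((div_le_one hr).2 hx.le))]
        field_simp
      have h2 : |inner ℝ x (U x)| ≤ ‖x‖ * (L * (‖x‖ - R)) := by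
        rw [← sub_zero (inner ℝ x (U x)), ← hy0, ← inner_sub_right, ← hxy]
        exact (abs_real_inner_le_norm _ _).trans
          (mul_le_mul_of_nonneg_left (hUl x y) (norm_nonneg _))
      have hs : 0 ≤ ‖x‖ ^ 2 - R ^ 2 := sub_nonneg.2 (pow_le_pow_left₀ hR.le hx.le 2)
      rw [abs_of_nonneg hs]
      have h3 : ‖x‖ * (‖x‖ - R) ≤ ‖x‖ ^ 2 - R ^ 2 := by nlinarith
      calc 2 * |inner ℝ x (U x)| ≤ 2 * (‖x‖ * (L * (‖x‖ - R))) := by linarith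
        _ = 2 * L * (‖x‖ * (‖x‖ - R)) := by ring
        _ ≤ 2 * L * (‖x‖ ^ 2 - R ^ 2) := mul_le_mul_of_nonneg_left h3 (by positivity)
        _ ≤ _ := mul_le_mul_of_nonneg_right (by linarith) hs
  · have hge : R ^ 2 ≤ ζ x + R ^ 2 := by
      rcases hx2.eq_or_lt with h | h
      · rw [hin x h.ge, ← h]; nlinarith [sq_nonneg R]
      · linarith [hout x h]
    calc |fderiv ℝ ζ x (U x)| ≤ K * L :=
          ((fderiv ℝ ζ x).le_opNorm _).trans (mul_le_mul (hK x) (hUb x) (norm_nonneg _) hK0.le)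
      _ = K * L / R ^ 2 * R ^ 2 := by field_simp
      _ ≤ K * L / R ^ 2 * |ζ x + R ^ 2| :=
          mul_le_mul_of_nonneg_left (hge.trans (le_abs_self _)) hp2
      _ ≤ _ := mul_le_mul_of_nonneg_right (by linarith) (abs_nonneg _)

/-- Grönwall's lemma, in integral form. -/
theorem ae_eq_zero_of_le_integral {T K C : ℝ} {E : ℝ → ℝ} (hE : Measurable E)
    (hE0 : ∀ t, 0 ≤ E t) (hEK : ∀ t, E t ≤ K) (hC : 0 ≤ C)
    (h : ∀ᵐ t ∂((volume : Measure ℝ).restrict (Ioo 0 T)), E t ≤ C * ∫ s in (0 : ℝ)..t, E s) :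
    ∀ᵐ t ∂((volume : Measure ℝ).restrict (Ioo 0 T)), E t = 0 := by
  have hEi := intervalIntegrable_of_bound hE fun t => by rw [abs_of_nonneg (hE0 t)]; exact hEK t
  have hstep : ∀ n : ℕ, ∀ᵐ t ∂((volume : Measure ℝ).restrict (Ioo 0 T)),
      E t ≤ K * ((C * t) ^ n / n.factorial) := by
    intro n
    induction n with
    | zero => exact .of_forall fun t => by simpa using hEK t
    | succ n ih =>
      filter_upwards [h, ae_restrict_mem measurableSet_Ioo] with t ht htT
      refine ht.trans ?_
      have h1 : ∫ s in (0 : ℝ)..t, E s ≤ ∫ s in (0 : ℝ)..t, K * ((C * s) ^ n / n.factorial) := by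
        refine intervalIntegral.integral_mono_ae_restrict htT.1.le (hEi _ _)
          ((by fun_prop : Continuous fun s : ℝ =>
            K * ((C * s) ^ n / n.factorial)).intervalIntegrable _ _) ?_
        rw [← restrict_Ioo_eq_restrict_Icc]
        exact ae_restrict_of_ae_restrict_of_subset (Ioo_subset_Ioo_right htT.2.le) ih
      have h2 : ∫ s in (0 : ℝ)..t, K * ((C * s) ^ n / n.factorial)
          = K * (C ^ n * (t ^ (n + 1) / (n + 1)) / n.factorial) := by
        simp only [mul_pow]
        rw [intervalIntegral.integral_const_mul, intervalIntegral.integral_div,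
          intervalIntegral.integral_const_mul, integral_pow]
        simp
      rw [h2] at h1
      refine (mul_le_mul_of_nonneg_left h1 hC).trans (le_of_eq ?_)
      rw [Nat.factorial_succ]
      push_cast
      field_simp
      ring
  filter_upwards [ae_all_iff.2 hstep] with t ht
  have hlim : Tendsto (fun n : ℕ => K * ((C * t) ^ n / n.factorial)) atTop (𝓝 0) := by
    simpa using (FloorSemiring.tendsto_pow_div_factorial_atTop (C * t)).const_mul K
  exact le_antisymm (ge_of_tendsto' hlim ht) (hE0 t)

theorem BddFamily.sub_ballDensity {M R : ℝ} (hR : 0 < R) {τ : ℝ → Space3 → ℝ}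
    (hτ : BddFamily M τ) :
    BddFamily (M + max (ballVol R)⁻¹ 1) (fun t x => τ t x - ballDensity R x) := by
  have hd := bddDensity_ballDensity hR
  have hb : ∀ x, |ballDensity R x| ≤ max (ballVol R)⁻¹ 1 := fun x => by
    rw [abs_of_nonneg (ballDensity_nonneg hR x)]
    exact (ballDensity_le hR x).trans (le_max_left _ _)
  exact ⟨hτ.measurable.sub ((measurable_ballDensity R).comp measurable_snd),
    fun t x => (abs_sub _ _).trans (add_le_add (hτ.bound t x) (hb x)),
    fun t => (hτ.integrable t).sub hd.integrable, fun t => ((hτ.bddDensity t).sub hd).mass⟩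

/-- The instantaneous stability estimate. For a density `q` with the mass and the range of
`ballDensity R`, the rate of change of `∫ q ζ` along the flow which `q` generates is controlled by
the distance between `q` and the ball, weighted by height. -/
theorem exists_flux_le {M R : ℝ} (hR : 0 < R) {ζ : Space3 → ℝ} (hζ : IsTest ζ)
    (hin : ∀ x, ‖x‖ ≤ 2 * R → ζ x = ‖x‖ ^ 2 - 2 * R ^ 2) (hout : ∀ x, 2 * R < ‖x‖ → 0 ≤ ζ x) :
    ∃ C, 0 ≤ C ∧ ∀ {q : Space3 → ℝ}, BddDensity M q →
      BddDensity (M + max (ballVol R)⁻¹ 1) (fun x => q x - ballDensity R x) → Measurable q →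
      |∫ x, q x * fderiv ℝ ζ x (stokesVel q x - fallVel R)|
        ≤ C * ∫ x, |q x - ballDensity R x| * |ζ x + R ^ 2| := by
  have hd := bddDensity_ballDensity hR
  have hdm := measurable_ballDensity R
  set d := ballDensity R with hddef
  set N := M + max (ballVol R)⁻¹ 1
  set U : Space3 → Space3 := fun x => ballVel R x - fallVel R
  obtain ⟨C₁, hC₁0, hC₁⟩ := exists_relVel_bound hR hζ hin hout
  obtain ⟨K, hK0, hK⟩ := hζ.exists_fderiv_bound
  obtain ⟨Kζ, hKζ0, hKζ⟩ := hζ.exists_bound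
  have hζc := hζ.smooth.continuous_fderiv (by simp)
  have hhm : Measurable fun x => ζ x + R ^ 2 := (hζ.continuous.add continuous_const).measurable
  obtain ⟨C₂, hC₂0, hC₂⟩ := BddDensity.exists_sublevel_potential_le (M := N) hR hhm
    (fun y hy => by rw [hin y hy]; ring) (fun y hy => by linarith [hout y hy])
  have hh0 : ∀ᵐ x : Space3, ζ x + R ^ 2 ≠ 0 := by
    filter_upwards [ae_norm_sq_ne (R ^ 2)] with x hx h0
    rcases le_or_gt ‖x‖ (2 * R) with h1 | h1
    · rw [hin x h1] at h0; exact hx (by linarith)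
    · have := hout x h1
      have : 0 < R ^ 2 := by positivity
      linarith
  have hκ := oseenConst_pos
  refine ⟨C₁ + K * (2 * oseenConst) * (2 * C₂), by positivity, fun {q} hq hσ hqm => ?_⟩
  set σ : Space3 → ℝ := fun x => q x - d x with hσdef
  have hσm : Measurable σ := hqm.sub hdm
  set w : Space3 → Space3 := stokesVel σ with hw
  have hwc : Continuous w := hσ.continuous_stokesVel
  have hUc : Continuous U := (continuous_ballVel hR).sub continuous_const
  have hvel : ∀ x, stokesVel q x - fallVel R = U x + w x := fun x => by
    rw [hw, hσdef, hq.stokesVel_sub hd, ← ballVel_eq_stokesVel hR]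
    simp only [U]; abel
  have hσh : Integrable fun x => |σ x| * |ζ x + R ^ 2| := by
    refine hσ.integrable.abs.mul_bdd (c := Kζ + R ^ 2) hhm.abs.aestronglyMeasurable
      (.of_forall fun x => ?_)
    rw [norm_abs_eq_norm]
    refine (norm_add_le _ _).trans (add_le_add (hKζ x) ?_)
    rw [Real.norm_of_nonneg (by positivity)]
  -- products of a density with a transported test function are integrable
  have hprod : ∀ {f : Space3 → ℝ} {V : Space3 → Space3}, Integrable f → Continuous V →
      Integrable fun x => f x * fderiv ℝ ζ x (V x) := by
    intro f V hf hV
    have hc : Continuous fun x => fderiv ℝ ζ x (V x) := hζc.clm_apply hV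
    obtain ⟨c, hc'⟩ := hc.bounded_above_of_compact_support
      ((hζ.supp.fderiv (𝕜 := ℝ)).mono fun z hz => by
        rw [Function.mem_support] at hz ⊢
        intro h0; apply hz; rw [h0]; rfl)
    exact hf.mul_bdd hc.aestronglyMeasurable (.of_forall hc')
  have hsplit : ∀ x, q x * fderiv ℝ ζ x (stokesVel q x - fallVel R)
      = d x * fderiv ℝ ζ x (U x) + d x * fderiv ℝ ζ x (w x)
        + (σ x * fderiv ℝ ζ x (U x) + σ x * fderiv ℝ ζ x (w x)) := fun x => by
    rw [hvel, map_add]; simp only [hσdef]; ring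
  have z1 : ∫ x, d x * fderiv ℝ ζ x (U x) = 0 := integral_ballDensity_relVel hR hζ
  have z2 : ∫ x, d x * fderiv ℝ ζ x (w x) = 0 := by
    rw [← integral_ballDensity_inner hR hwc fun φ hφ => hσ.stokesVel_incompressible hφ]
    congr 1; funext x
    rcases lt_or_ge ‖x‖ R with hx | hx
    · rw [fderiv_height hin (by linarith)]
    · rw [hddef, ballDensity_of_le_norm hx, zero_mul, zero_mul]
  have e : ∫ x, q x * fderiv ℝ ζ x (stokesVel q x - fallVel R)
      = (∫ x, σ x * fderiv ℝ ζ x (U x)) + ∫ x, σ x * fderiv ℝ ζ x (w x) := by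
    simp only [hsplit]
    have e1 := integral_add ((hprod hd.integrable hUc).add (hprod hd.integrable hwc))
      ((hprod hσ.integrable hUc).add (hprod hσ.integrable hwc))
    have e2 := integral_add (hprod hd.integrable hUc) (hprod hd.integrable hwc)
    have e3 := integral_add (hprod hσ.integrable hUc) (hprod hσ.integrable hwc)
    simp only [Pi.add_apply] at e1
    rw [e1, e2, e3, z1, z2]; ring
  rw [e, add_mul]
  refine (abs_add_le _ _).trans (add_le_add ?_ ?_)
  · rw [← integral_const_mul, ← Real.norm_eq_abs]
    refine norm_integral_le_of_norm_le (hσh.const_mul C₁) (.of_forall fun x => ?_)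
    rw [norm_mul, Real.norm_eq_abs, Real.norm_eq_abs]
    calc |σ x| * |fderiv ℝ ζ x (U x)| ≤ |σ x| * (C₁ * |ζ x + R ^ 2|) :=
          mul_le_mul_of_nonneg_left (hC₁ x) (abs_nonneg _)
      _ = _ := by ring
  · have hI := hσ.interaction_le hσm hhm hh0 hσh (fun x hx => hC₂ hσ x hx)
    refine le_trans ?_ ((mul_le_mul_of_nonneg_left hI.2
      (show 0 ≤ K * (2 * oseenConst) by positivity)).trans (le_of_eq (by ring)))
    rw [← integral_const_mul, ← Real.norm_eq_abs]
    refine norm_integral_le_of_norm_le (hI.1.const_mul _) (.of_forall fun x => ?_)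
    rw [norm_mul, Real.norm_eq_abs]
    calc |σ x| * ‖fderiv ℝ ζ x (w x)‖
        ≤ |σ x| * (K * (2 * oseenConst * ∫ y, |σ y| * ‖x - y‖⁻¹)) := by
          refine mul_le_mul_of_nonneg_left ?_ (abs_nonneg _)
          exact ((fderiv ℝ ζ x).le_opNorm _).trans (mul_le_mul (hK x)
            (hσ.norm_stokesVel_le_potential x) (norm_nonneg _) hK0.le)
      _ = _ := by ring

/-- In the falling frame, a density which starts as the ball and is transported by its own flow
remains the ball. The functional `∫ |τ - 1_B/|B|| ||x|² - R²|` is linear along densities with the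
range and the mass of the ball, and satisfies a Grönwall inequality. -/
theorem WeakTransport.ae_eq_ballDensity {T M R : ℝ} (hR : 0 < R) {τ : ℝ → Space3 → ℝ}
    (hτ : BddFamily M τ)
    (h : WeakTransport T (fun t x => stokesVel (τ t) x - fallVel R) (ballDensity R) τ) :
    ∀ᵐ t ∂((volume : Measure ℝ).restrict (Ioo 0 T)), ∀ᵐ x, τ t x = ballDensity R x := by
  have hd := bddDensity_ballDensity hR
  have hV := inv_pos.2 (ballVol_pos hR)
  obtain ⟨L, hL⟩ := hτ.exists_lipField (fallVel R)
  have hσ := hτ.sub_ballDensity hR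
  set N := M + max (ballVol R)⁻¹ 1
  obtain ⟨ζ, hζ, hin, hout⟩ := exists_height hR
  obtain ⟨C, hC0, hC⟩ := exists_flux_le (M := M) hR hζ hin hout
  obtain ⟨Kζ, hKζ0, hKζ⟩ := hζ.exists_bound
  have hR2 : 0 < R ^ 2 := by positivity
  have hhm : Measurable fun x => ζ x + R ^ 2 := (hζ.continuous.add continuous_const).measurable
  have hhb : ∀ x, |ζ x + R ^ 2| ≤ Kζ + R ^ 2 := fun x => (abs_add_le _ _).trans (by
    rw [abs_of_pos hR2]; linarith [hKζ x])
  -- `ζ + R²` is the height `|x|² - R²` near the ball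
  set E : ℝ → ℝ := fun t => ∫ x, |τ t x - ballDensity R x| * |ζ x + R ^ 2| with hE
  have hEm : Measurable E :=
    (hσ.measurable.abs.mul
      (hhm.comp measurable_snd).abs).stronglyMeasurable.integral_prod_right'.measurable
  have hE0 : ∀ t, 0 ≤ E t := fun t => integral_nonneg fun x => by positivity
  have hEi : ∀ t, Integrable fun x => |τ t x - ballDensity R x| * |ζ x + R ^ 2| := fun t =>
    (hσ.integrable t).abs.mul_bdd (c := Kζ + R ^ 2) hhm.abs.aestronglyMeasurable
      (.of_forall fun x => by rw [norm_abs_eq_norm]; exact hhb x)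
  have hEK : ∀ t, E t ≤ (Kζ + R ^ 2) * N := fun t => by
    refine (integral_mono (hEi t) ((hσ.integrable t).abs.const_mul (Kζ + R ^ 2)) fun x => ?_).trans ?_
    · change |τ t x - ballDensity R x| * |ζ x + R ^ 2| ≤ (Kζ + R ^ 2) * |τ t x - ballDensity R x|
      rw [mul_comm]; exact mul_le_mul_of_nonneg_right (hhb x) (abs_nonneg _)
    · rw [integral_const_mul]; exact mul_le_mul_of_nonneg_left (hσ.mass t) (by positivity)
  have hrange := h.range hL hτ hd.integrable hV.le fun x => by
    rcases lt_or_ge ‖x‖ R with hx | hx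
    · exact .inr (ballDensity_of_norm_lt hx)
    · exact .inl (ballDensity_of_le_norm hx)
  have hmass := h.integral_eq hL hτ hd.integrable
  have hlin : ∀ {q : Space3 → ℝ}, Integrable q → Integrable fun x => q x * ζ x := fun hq =>
    hq.mul_bdd hζ.continuous.aestronglyMeasurable (.of_forall hKζ)
  have hineq : ∀ᵐ t ∂((volume : Measure ℝ).restrict (Ioo 0 T)),
      E t ≤ C * ∫ s in (0 : ℝ)..t, E s := by
    filter_upwards [hrange, hmass, h ζ hζ, ae_restrict_mem measurableSet_Ioo] with t hr hm ht htT
    have e1 : E t = ∫ x, (τ t x * ζ x - ballDensity R x * ζ x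
        + R ^ 2 * (τ t x - ballDensity R x)) := by
      refine integral_congr_ae ?_
      filter_upwards [hr] with x hx
      -- both factors change sign exactly at the sphere
      have hsgn : |τ t x - ballDensity R x| * |ζ x + R ^ 2|
          = (τ t x - ballDensity R x) * (ζ x + R ^ 2) := by
        rcases lt_or_ge ‖x‖ R with hxR | hxR
        · have h1 : ζ x + R ^ 2 ≤ 0 := by
            rw [hin x (by linarith)]
            have := pow_le_pow_left₀ (norm_nonneg _) hxR.le 2
            linarith
          have h2 : τ t x - ballDensity R x ≤ 0 := by
            rw [ballDensity_of_norm_lt hxR]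
            rcases hx with hx | hx <;> rw [hx] <;> linarith
          rw [abs_of_nonpos h1, abs_of_nonpos h2]; ring
        · have h1 : 0 ≤ ζ x + R ^ 2 := by
            rcases le_or_gt ‖x‖ (2 * R) with h2 | h2
            · rw [hin x h2]
              have := pow_le_pow_left₀ hR.le hxR 2
              linarith
            · linarith [hout x h2]
          have h2 : 0 ≤ τ t x - ballDensity R x := by
            rw [ballDensity_of_le_norm hxR]
            rcases hx with hx | hx <;> rw [hx] <;> linarith
          rw [abs_of_nonneg h1, abs_of_nonneg h2]
      rw [hsgn]; ring
    have e2 : E t = ∫ s in (0 : ℝ)..t, ∫ x, τ s x * fderiv ℝ ζ x (stokesVel (τ s) x - fallVel R) := by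
      have i1 := (hlin (hτ.integrable t)).sub (hlin hd.integrable)
      have i2 := ((hτ.integrable t).sub hd.integrable).const_mul (R ^ 2)
      have e3 := integral_add i1 i2
      simp only [Pi.sub_apply] at e3
      rw [e1, e3, integral_const_mul, integral_sub (hlin (hτ.integrable t)) (hlin hd.integrable),
        integral_sub (hτ.integrable t) hd.integrable, ht, hm]
      ring
    rw [e2, ← intervalIntegral.integral_const_mul]
    have hEint := intervalIntegrable_of_bound hEm
      (fun t => by rw [abs_of_nonneg (hE0 t)]; exact hEK t) 0 t
    refine (le_abs_self _).trans ?_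
    rw [← Real.norm_eq_abs]
    refine intervalIntegral.norm_integral_le_of_norm_le htT.1.le (.of_forall fun s _ => ?_)
      (hEint.const_mul C)
    exact hC (hτ.bddDensity s) (hσ.bddDensity s) (hτ.measurable.comp measurable_prodMk_left)
  filter_upwards [ae_eq_zero_of_le_integral hEm hE0 hEK hC0 hineq] with t ht
  simp only [hE] at ht
  rw [integral_eq_zero_iff_of_nonneg (fun x => by positivity) (hEi t)] at ht
  filter_upwards [ht, ae_norm_sq_ne (R ^ 2)] with x hx hx2
  rcases mul_eq_zero.1 hx with h1 | h1
  · exact sub_eq_zero.1 (abs_eq_zero.1 h1)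
  · exfalso
    rw [abs_eq_zero] at h1
    rcases le_or_gt ‖x‖ (2 * R) with h2 | h2
    · rw [hin x h2] at h1; exact hx2 (by linarith)
    · linarith [hout x h2]

theorem IsTransportStokesSolution.ae_eq_translatingPatch {R : ℝ} (hR : 0 < R)
    {ρ : ℝ → Space3 → ℝ} {u : ℝ → Space3 → Space3} {p : ℝ → Space3 → ℝ}
    (h : IsTransportStokesSolution (ballDensity R) ρ u p) :
    ∀ᵐ z ∂((volume : Measure (ℝ × Space3)).restrict positiveTimes),
      ρ z.1 z.2 = translatingPatch R z.1 z.2 := by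
  have hloc : ∀ n : ℕ, ∀ᵐ t ∂((volume : Measure ℝ).restrict (Ioo 0 ((n : ℝ) + 1))),
      ∀ᵐ x, ρ t x = translatingPatch R t x := by
    intro n
    obtain ⟨M, τ, hτ, hw, hρ⟩ := h.exists_weakTransport (T := (n : ℝ) + 1) (by positivity)
      (fallVel R)
    filter_upwards [hρ, hw.ae_eq_ballDensity hR hτ] with t h1 h2
    have h3 : ∀ᵐ x, ρ t (x + t • fallVel R) = ballDensity R x := by
      filter_upwards [h1, h2] with x hx1 hx2
      rw [hx1, hx2]
    filter_upwards [(measurePreserving_sub_right volume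
      (t • fallVel R)).quasiMeasurePreserving.ae h3] with x hx
    rw [translatingPatch_eq hR, ← hx, sub_add_cancel]
  have hall : ∀ᵐ t ∂((volume : Measure ℝ).restrict (Ioi 0)),
      ∀ᵐ x, ρ t x = translatingPatch R t x := by
    simp only [ae_restrict_iff' measurableSet_Ioo] at hloc
    rw [ae_restrict_iff' measurableSet_Ioi]
    filter_upwards [ae_all_iff.2 hloc] with t ht ht0
    obtain ⟨n, hn⟩ := exists_nat_gt t
    exact ht n ⟨ht0, by linarith⟩
  obtain ⟨g, hg, hρg⟩ := h.aestronglyMeasurable_density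
  have hpm : Measurable fun z : ℝ × Space3 => translatingPatch R z.1 z.2 := by
    simp only [translatingPatch_eq hR]
    exact (measurable_ballDensity R).comp (by fun_prop)
  have hmeas : MeasurableSet {z : ℝ × Space3 | g z = translatingPatch R z.1 z.2} :=
    measurableSet_eq_fun hg.measurable hpm
  have hgp : ∀ᵐ z ∂((volume : Measure (ℝ × Space3)).restrict positiveTimes),
      g z = translatingPatch R z.1 z.2 := by
    rw [volume_restrict_positiveTimes] at hρg ⊢
    rw [Measure.ae_prod_iff_ae_ae hmeas]
    filter_upwards [hall, Measure.ae_ae_of_ae_prod hρg] with t h1 h2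
    filter_upwards [h1, h2] with x hx1 hx2
    rw [← hx1, ← hx2]
  filter_upwards [hρg, hgp] with z h1 h2
  rw [h1, h2]

theorem mainTheorem3 (R : ℝ) (hR : 0 < R) :
    (∃ (u : ℝ → Space3 → Space3) (p : ℝ → Space3 → ℝ),
      IsTransportStokesSolution (ballDensity R) (translatingPatch R) u p) ∧
    ∀ (ρ : ℝ → Space3 → ℝ) (u : ℝ → Space3 → Space3) (p : ℝ → Space3 → ℝ),
      IsTransportStokesSolution (ballDensity R) ρ u p →
        ∀ᵐ z ∂((volume : Measure (ℝ × Space3)).restrict positiveTimes),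
          ρ z.1 z.2 = translatingPatch R z.1 z.2 :=
  ⟨⟨_, _, isTransportStokesSolution_translatingPatch hR⟩,
    fun _ _ _ h => h.ae_eq_translatingPatch hR⟩
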